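/- Let $\mathcal E$ be a locally cartesian closed category with a terminal object. For $f:B\to A$ write $\Sigma_f\dashv f^*\dashv\Pi_f$ for post-composition with $f$, pullback along $f$, and dependent product. A \emph{polynomial} $F:I\to J$ is a diagram $I\xleftarrow{s}B\xrightarrow{f}A\xrightarrow{t}J$ in $\mathcal E$; its \emph{extension} is the functor $P_F=\Sigma_t\Pi_f s^*:\mathcal E/I\to\mathcal E/J$. Each slice $\mathcal E/I$ is tensored over $\mathcal E$ by $K\otimes(X\to I)=(K\times X\to X\to I)$. A \emph{strong functor} $T:\mathcal E/I\to\mathcal E/J$ is a functor together with a natural family $K\otimes T(x)\to T(K\otimes x)$ compatible with the associativity and unit isomorphisms, and a \emph{strong natural transformation} is one commuting with the strengths. The functors $\Sigma_t$, $\Pi_f$, $s^*$ carry canonical strengths, so $P_F$ is a strong functor. A \emph{polynomial functor} is a strong functor that is isomorphic, by a strong natural isomorphism, to $P_F$ for some polynomial $F$. For polynomials $G=(I\xleftarrow{u}D\xrightarrow{g}C\xrightarrow{v}J)$ and $F=(I\xleftarrow{s}B\xrightarrow{f}A\xrightarrow{t}J)$, a \emph{morphism diagram} from $G$ to $F$ consists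 of an object $M$ and maps $w:M\to D$, $\beta:M\to B$, $\alpha:C\to A$ with $u w=s\beta$, $t\alpha=v$, and such that $\beta$ and $g w$ exhibit $M$ as a pullback of $f$ along $\alpha$. Two diagrams are identified if they have the same $\alpha$ and differ by an isomorphism of the objects $M$ compatible with $w$ and $\beta$. Diagrams compose by pullback of the middle objects, so the polynomials from $I$ to $J$ form a category $\mathbf{Poly}_{\mathcal E}(I,J)$. A diagram induces the transformation $$P_G=\Sigma_v\Pi_g u^*\to\Sigma_v\Pi_g\Pi_w w^*u^*\cong\Sigma_v\Pi_{gw}\beta^*s^*\cong\Sigma_t\Sigma_\alpha\alpha^*\Pi_f s^*\to\Sigma_t\Pi_f s^*=P_F$$ given by the unit of $w^*\dashv\Pi_w$, the Beck--Chevalley isomorphism, and the counit of $\Sigma_\alpha\dashv\alpha^*$. For polynomials $F=(I\xleftarrow{s}B\xrightarrow{f}A\xrightarrow{t}J)$ and $G=(J\xleftarrow{u}D\xrightarrow{g}C\xrightarrow{v}K)$ the \emph{substitution} $G\circ F$ is the polynomial $I\leftarrow N\to M\to K$ defined as follows: $A'=A\times_JD$ with projections $h:A'\to A$ and $k:A'\to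 D$; $M=\Pi_g(k)$ with structure map $w:M\to C$; $D'=M\times_CD$, with projection $q:D'\to M$ and counit $\varepsilon:D'\to A'$; $B'=B\times_AA'$; and $N=B'\times_{A'}D'$. Its maps are $N\to B'\to B\xrightarrow{s}I$, $N\to D'\xrightarrow{q}M$ and $M\xrightarrow{w}C\xrightarrow{v}K$. The identity polynomial on $I$ consists of three identity maps. Pseudofunctoriality of pullbacks, sums and products, the Beck--Chevalley isomorphisms, and the distributivity transformation $\Sigma_w\Pi_q\varepsilon^*\to\Pi_g\Sigma_k$ give canonical transformations $\alpha_{G,F}:P_{G\circ F}\to P_G P_F$ and $\alpha_I:P_{\mathrm{id}_I}\to 1_{\mathcal E/I}$. \textbf{Theorem.} \begin{enumerate} \item Identity functors of slices and composites of polynomial functors are polynomial functors. Hence there is a 2-category $\mathbf{PolyFun}_{\mathcal E}$ whose 0-cells are the slices of $\mathcal E$, whose 1-cells are polynomial functors, and whose 2-cells are strong natural transformations. \item There is a bicategory $\mathbf{Poly}_{\mathcal E}$ whose 0-cells are the objects of $\mathcal E$, whose categories of 1-cells and 2-cells are the categories $\mathbf{Poly}_{\mathcal E}(I,J)$ of polynomials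 and morphism diagrams, and whose composition and identities on 1-cells are substitution and the identity polynomials; and there is a pseudofunctor $$\mathrm{Ext}:\mathbf{Poly}_{\mathcal E}\to\mathbf{PolyFun}_{\mathcal E}$$ that sends $I$ to $\mathcal E/I$, a polynomial $F$ to $P_F$, and the class of a morphism diagram to its induced transformation, and whose structure 2-cells are $\alpha_{G,F}$ and $\alpha_I$ (in particular these are invertible and strong). \item For all $I,J$ the functor $\mathbf{Poly}_{\mathcal E}(I,J)\to\mathbf{PolyFun}_{\mathcal E}(\mathcal E/I,\mathcal E/J)$ is an equivalence of categories. \item $\mathrm{Ext}$ is a biequivalence: it is surjective on 0-cells up to internal equivalence, and an equivalence on each hom-category. \end{enumerate} -/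

import Mathlib

open CategoryTheory Limits

universe v u

namespace PolyLCC

noncomputable section

section Generalities

universe w₁ w₂ v₁ v₂ u₁ u₂

open Bicategory

/-- A property of 1-cells that contains identities and is closed under composition. -/
structure OneCellProperty (B : Type u₁) [Bicategory.{w₁, v₁} B] where
  prop (a b : B) : ObjectProperty (a ⟶ b)
  id_mem (a : B) : prop a a (𝟙 a)
  comp_mem {a b c : B} (f : a ⟶ b) (g : b ⟶ c) : prop a b f → prop b c g → prop a c (f ≫ g)

/-- The objects of the locally full sub-bicategory given by a property of 1-cells. -/
@[ext]
structure SubBicategory {B : Type u₁} [Bicategory.{w₁, v₁} B] (P : OneCellProperty B) where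
  obj : B

namespace SubBicategory

variable {B : Type u₁} [Bicategory.{w₁, v₁} B] (P : OneCellProperty B)

instance : CategoryStruct (SubBicategory P) where
  Hom a b := (P.prop a.obj b.obj).FullSubcategory
  id a := ⟨𝟙 a.obj, P.id_mem _⟩
  comp f g := ⟨f.obj ≫ g.obj, P.comp_mem _ _ f.property g.property⟩

instance (a b : SubBicategory P) : Category (a ⟶ b) :=
  inferInstanceAs (Category (P.prop a.obj b.obj).FullSubcategory)

/-- The locally full sub-bicategory given by a property of 1-cells. -/
instance : Bicategory (SubBicategory P) where
  homCategory := inferInstance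
  whiskerLeft f _ _ η := ObjectProperty.homMk (f.obj ◁ η.hom)
  whiskerRight η h := ObjectProperty.homMk (η.hom ▷ h.obj)
  associator f g h := ObjectProperty.isoMk _ (α_ f.obj g.obj h.obj)
  leftUnitor f := ObjectProperty.isoMk _ (λ_ f.obj)
  rightUnitor f := ObjectProperty.isoMk _ (ρ_ f.obj)
  whiskerLeft_id _ _ := ObjectProperty.hom_ext _ (whiskerLeft_id _ _)
  whiskerLeft_comp _ _ _ _ _ _ := ObjectProperty.hom_ext _ (whiskerLeft_comp _ _ _)
  id_whiskerLeft _ := ObjectProperty.hom_ext _ (id_whiskerLeft _)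
  comp_whiskerLeft _ _ _ _ _ := ObjectProperty.hom_ext _ (comp_whiskerLeft _ _ _)
  id_whiskerRight _ _ := ObjectProperty.hom_ext _ (id_whiskerRight _ _)
  comp_whiskerRight _ _ _ := ObjectProperty.hom_ext _ (comp_whiskerRight _ _ _)
  whiskerRight_id _ := ObjectProperty.hom_ext _ (whiskerRight_id _)
  whiskerRight_comp _ _ _ := ObjectProperty.hom_ext _ (whiskerRight_comp _ _ _)
  whisker_assoc _ _ _ _ _ := ObjectProperty.hom_ext _ (whisker_assoc _ _ _)
  whisker_exchange _ _ := ObjectProperty.hom_ext _ (whisker_exchange _ _)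
  pentagon _ _ _ _ := ObjectProperty.hom_ext _ (pentagon _ _ _ _)
  triangle _ _ := ObjectProperty.hom_ext _ (triangle _ _)

lemma eqToIso_hom_hom {a b : SubBicategory P} {f g : a ⟶ b} (h : f = g) :
    (eqToIso (congrArg ObjectProperty.FullSubcategory.obj h)).hom = (eqToIso h).hom.hom := by
  subst h; rfl

/-- A locally full sub-bicategory of a 2-category is a 2-category. -/
instance [Strict B] : Strict (SubBicategory P) where
  id_comp f := ObjectProperty.FullSubcategory.ext (Strict.id_comp f.obj)
  comp_id f := ObjectProperty.FullSubcategory.ext (Strict.comp_id f.obj)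
  assoc f g h := ObjectProperty.FullSubcategory.ext (Strict.assoc f.obj g.obj h.obj)
  leftUnitor_eqToIso f := Iso.ext (ObjectProperty.hom_ext _
    ((congrArg Iso.hom (Strict.leftUnitor_eqToIso f.obj)).trans
      (eqToIso_hom_hom P (f := 𝟙 _ ≫ f) (g := f)
        (ObjectProperty.FullSubcategory.ext (Strict.id_comp f.obj)))))
  rightUnitor_eqToIso f := Iso.ext (ObjectProperty.hom_ext _
    ((congrArg Iso.hom (Strict.rightUnitor_eqToIso f.obj)).trans
      (eqToIso_hom_hom P (f := f ≫ 𝟙 _) (g := f)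
        (ObjectProperty.FullSubcategory.ext (Strict.comp_id f.obj)))))
  associator_eqToIso f g h := Iso.ext (ObjectProperty.hom_ext _
    ((congrArg Iso.hom (Strict.associator_eqToIso f.obj g.obj h.obj)).trans
      (eqToIso_hom_hom P (f := (f ≫ g) ≫ h) (g := f ≫ g ≫ h)
        (ObjectProperty.FullSubcategory.ext (Strict.assoc f.obj g.obj h.obj)))))

end SubBicategory

/-- The data and axioms completing given 1-cells and categories of 2-cells to a bicategory. -/
structure BicategoryCompletion (B : Type u₁) [CategoryStruct.{v₁} B]
    [∀ a b : B, Category.{w₁} (a ⟶ b)] where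
  whiskerLeft {a b c : B} (f : a ⟶ b) {g h : b ⟶ c} (η : g ⟶ h) : f ≫ g ⟶ f ≫ h
  whiskerRight {a b c : B} {f g : a ⟶ b} (η : f ⟶ g) (h : b ⟶ c) : f ≫ h ⟶ g ≫ h
  associator {a b c d : B} (f : a ⟶ b) (g : b ⟶ c) (h : c ⟶ d) : (f ≫ g) ≫ h ≅ f ≫ g ≫ h
  leftUnitor {a b : B} (f : a ⟶ b) : 𝟙 a ≫ f ≅ f
  rightUnitor {a b : B} (f : a ⟶ b) : f ≫ 𝟙 b ≅ f
  whiskerLeft_id {a b c : B} (f : a ⟶ b) (g : b ⟶ c) : whiskerLeft f (𝟙 g) = 𝟙 (f ≫ g)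
  whiskerLeft_comp {a b c : B} (f : a ⟶ b) {g h i : b ⟶ c} (η : g ⟶ h) (θ : h ⟶ i) :
    whiskerLeft f (η ≫ θ) = whiskerLeft f η ≫ whiskerLeft f θ
  id_whiskerLeft {a b : B} {f g : a ⟶ b} (η : f ⟶ g) :
    whiskerLeft (𝟙 a) η = (leftUnitor f).hom ≫ η ≫ (leftUnitor g).inv
  comp_whiskerLeft {a b c d : B} (f : a ⟶ b) (g : b ⟶ c) {h h' : c ⟶ d} (η : h ⟶ h') :
    whiskerLeft (f ≫ g) η =
      (associator f g h).hom ≫ whiskerLeft f (whiskerLeft g η) ≫ (associator f g h').inv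
  id_whiskerRight {a b c : B} (f : a ⟶ b) (g : b ⟶ c) : whiskerRight (𝟙 f) g = 𝟙 (f ≫ g)
  comp_whiskerRight {a b c : B} {f g h : a ⟶ b} (η : f ⟶ g) (θ : g ⟶ h) (i : b ⟶ c) :
    whiskerRight (η ≫ θ) i = whiskerRight η i ≫ whiskerRight θ i
  whiskerRight_id {a b : B} {f g : a ⟶ b} (η : f ⟶ g) :
    whiskerRight η (𝟙 b) = (rightUnitor f).hom ≫ η ≫ (rightUnitor g).inv
  whiskerRight_comp {a b c d : B} {f f' : a ⟶ b} (η : f ⟶ f') (g : b ⟶ c) (h : c ⟶ d) :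
    whiskerRight η (g ≫ h) =
      (associator f g h).inv ≫ whiskerRight (whiskerRight η g) h ≫ (associator f' g h).hom
  whisker_assoc {a b c d : B} (f : a ⟶ b) {g g' : b ⟶ c} (η : g ⟶ g') (h : c ⟶ d) :
    whiskerRight (whiskerLeft f η) h =
      (associator f g h).hom ≫ whiskerLeft f (whiskerRight η h) ≫ (associator f g' h).inv
  whisker_exchange {a b c : B} {f g : a ⟶ b} {h i : b ⟶ c} (η : f ⟶ g) (θ : h ⟶ i) :
    whiskerLeft f θ ≫ whiskerRight η i = whiskerRight η h ≫ whiskerLeft g θ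
  pentagon {a b c d e : B} (f : a ⟶ b) (g : b ⟶ c) (h : c ⟶ d) (i : d ⟶ e) :
    whiskerRight (associator f g h).hom i ≫
        (associator f (g ≫ h) i).hom ≫ whiskerLeft f (associator g h i).hom =
      (associator (f ≫ g) h i).hom ≫ (associator f g (h ≫ i)).hom
  triangle {a b c : B} (f : a ⟶ b) (g : b ⟶ c) :
    (associator f (𝟙 b) g).hom ≫ whiskerLeft f (leftUnitor g).hom =
      whiskerRight (rightUnitor f).hom g

/-- The resulting bicategory. -/
@[reducible] def BicategoryCompletion.toBicategory {B : Type u₁} [CategoryStruct.{v₁} B]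
    [∀ a b : B, Category.{w₁} (a ⟶ b)] (S : BicategoryCompletion.{w₁} B) :
    Bicategory.{w₁, v₁} B where
  homCategory := inferInstance
  whiskerLeft := S.whiskerLeft
  whiskerRight := S.whiskerRight
  associator := S.associator
  leftUnitor := S.leftUnitor
  rightUnitor := S.rightUnitor
  whiskerLeft_id := S.whiskerLeft_id
  whiskerLeft_comp := S.whiskerLeft_comp
  id_whiskerLeft := S.id_whiskerLeft
  comp_whiskerLeft := S.comp_whiskerLeft
  id_whiskerRight := S.id_whiskerRight
  comp_whiskerRight := S.comp_whiskerRight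
  whiskerRight_id := S.whiskerRight_id
  whiskerRight_comp := S.whiskerRight_comp
  whisker_assoc := S.whisker_assoc
  whisker_exchange := S.whisker_exchange
  pentagon := S.pentagon
  triangle := S.triangle

/-- The data and axioms completing given maps on 0-cells and 1-cells to a pseudofunctor. -/
structure PseudofunctorCompletion {B : Type u₁} [Bicategory.{w₁, v₁} B] {C : Type u₂}
    [Bicategory.{w₂, v₂} C] (F : Prefunctor B C) where
  map₂ {a b : B} {f g : a ⟶ b} (η : f ⟶ g) : F.map f ⟶ F.map g
  map₂_id {a b : B} (f : a ⟶ b) : map₂ (𝟙 f) = 𝟙 (F.map f)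
  map₂_comp {a b : B} {f g h : a ⟶ b} (η : f ⟶ g) (θ : g ⟶ h) :
    map₂ (η ≫ θ) = map₂ η ≫ map₂ θ
  mapId (a : B) : F.map (𝟙 a) ≅ 𝟙 (F.obj a)
  mapComp {a b c : B} (f : a ⟶ b) (g : b ⟶ c) : F.map (f ≫ g) ≅ F.map f ≫ F.map g
  map₂_whisker_left {a b c : B} (f : a ⟶ b) {g h : b ⟶ c} (η : g ⟶ h) :
    map₂ (f ◁ η) = (mapComp f g).hom ≫ F.map f ◁ map₂ η ≫ (mapComp f h).inv
  map₂_whisker_right {a b c : B} {f g : a ⟶ b} (η : f ⟶ g) (h : b ⟶ c) :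
    map₂ (η ▷ h) = (mapComp f h).hom ≫ map₂ η ▷ F.map h ≫ (mapComp g h).inv
  map₂_associator {a b c d : B} (f : a ⟶ b) (g : b ⟶ c) (h : c ⟶ d) :
    map₂ (α_ f g h).hom = (mapComp (f ≫ g) h).hom ≫ (mapComp f g).hom ▷ F.map h ≫
      (α_ (F.map f) (F.map g) (F.map h)).hom ≫ F.map f ◁ (mapComp g h).inv ≫
      (mapComp f (g ≫ h)).inv
  map₂_left_unitor {a b : B} (f : a ⟶ b) :
    map₂ (λ_ f).hom = (mapComp (𝟙 a) f).hom ≫ (mapId a).hom ▷ F.map f ≫ (λ_ (F.map f)).hom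
  map₂_right_unitor {a b : B} (f : a ⟶ b) :
    map₂ (ρ_ f).hom = (mapComp f (𝟙 b)).hom ≫ F.map f ◁ (mapId b).hom ≫ (ρ_ (F.map f)).hom

/-- The resulting pseudofunctor. -/
def PseudofunctorCompletion.toPseudofunctor {B : Type u₁} [Bicategory.{w₁, v₁} B] {C : Type u₂}
    [Bicategory.{w₂, v₂} C] {F : Prefunctor B C} (S : PseudofunctorCompletion F) :
    Pseudofunctor B C where
  toPrefunctor := F
  map₂ := S.map₂
  map₂_id := S.map₂_id
  map₂_comp := S.map₂_comp
  mapId := S.mapId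
  mapComp := S.mapComp
  map₂_whisker_left := S.map₂_whisker_left
  map₂_whisker_right := S.map₂_whisker_right
  map₂_associator := S.map₂_associator
  map₂_left_unitor := S.map₂_left_unitor
  map₂_right_unitor := S.map₂_right_unitor

/-- A biequivalence: a pseudofunctor that is surjective on 0-cells up to internal equivalence and
is an equivalence on each category of 1-cells and 2-cells. -/
structure IsBiequivalence {B : Type u₁} [Bicategory.{w₁, v₁} B] {C : Type u₂}
    [Bicategory.{w₂, v₂} C] (F : Pseudofunctor B C) : Prop where
  essSurj (c : C) : ∃ b : B, Nonempty (Bicategory.Equivalence (F.obj b) c)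
  isEquivalence (a b : B) : (F.mapFunctor a b).IsEquivalence

end Generalities

section Main

open MonoidalCategory CartesianMonoidalCategory
open scoped MonoidalLeftAction

variable {E : Type u} [Category.{v} E]

/-- Every pullback functor `f^* : E/A ⥤ E/B` has a right adjoint. -/
class LocallyCartesianClosed (E : Type u) [Category.{v} E] [HasPullbacks E] : Prop where
  isLeftAdjoint {B A : E} (f : B ⟶ A) : (Over.pullback f).IsLeftAdjoint

section Pullback

variable [HasPullbacks E] {B A : E} (f : B ⟶ A)

/-- The projection `X ×_A B ⟶ X`. -/
def pbFst (x : Over A) : ((Over.pullback f).obj x).left ⟶ x.left := pullback.fst x.hom f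

/-- The map `W ⟶ X ×_A B` with the given components. -/
def pbLift (x : Over A) {W : E} (a : W ⟶ x.left) (b : W ⟶ B) (h : a ≫ x.hom = b ≫ f) :
    W ⟶ ((Over.pullback f).obj x).left := pullback.lift a b h

lemma pbFst_w (x : Over A) :
    pbFst f x ≫ x.hom = ((Over.pullback f).obj x).hom ≫ f := pullback.condition

lemma pbFst_w_assoc (x : Over A) {Z : E} (g : A ⟶ Z) :
    pbFst f x ≫ x.hom ≫ g = ((Over.pullback f).obj x).hom ≫ f ≫ g := by
  rw [← Category.assoc, pbFst_w, Category.assoc]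

@[simp] lemma pbLift_pbFst (x : Over A) {W : E} (a : W ⟶ x.left) (b : W ⟶ B)
    (h : a ≫ x.hom = b ≫ f) : pbLift f x a b h ≫ pbFst f x = a := pullback.lift_fst a b h

@[simp] lemma pbLift_pbFst_assoc (x : Over A) {W : E} (a : W ⟶ x.left) (b : W ⟶ B)
    (h : a ≫ x.hom = b ≫ f) {Z : E} (g : x.left ⟶ Z) :
    pbLift f x a b h ≫ pbFst f x ≫ g = a ≫ g := by
  rw [← Category.assoc, pbLift_pbFst]

@[simp] lemma pbLift_hom (x : Over A) {W : E} (a : W ⟶ x.left) (b : W ⟶ B)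
    (h : a ≫ x.hom = b ≫ f) : pbLift f x a b h ≫ ((Over.pullback f).obj x).hom = b :=
  pullback.lift_snd a b h

@[simp] lemma pbLift_hom_assoc (x : Over A) {W : E} (a : W ⟶ x.left) (b : W ⟶ B)
    (h : a ≫ x.hom = b ≫ f) {Z : E} (g : B ⟶ Z) :
    pbLift f x a b h ≫ ((Over.pullback f).obj x).hom ≫ g = b ≫ g := by
  rw [← Category.assoc]
  exact congrArg (· ≫ g) (pbLift_hom f x a b h)

lemma pb_ext {x : Over A} {W : E} {g h : W ⟶ ((Over.pullback f).obj x).left}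
    (h₁ : g ≫ pbFst f x = h ≫ pbFst f x)
    (h₂ : g ≫ ((Over.pullback f).obj x).hom = h ≫ ((Over.pullback f).obj x).hom) : g = h :=
  pullback.hom_ext h₁ h₂

@[simp] lemma pullback_map_pbFst {x y : Over A} (g : x ⟶ y) :
    ((Over.pullback f).map g).left ≫ pbFst f y = pbFst f x ≫ g.left :=
  pullback.lift_fst _ _ _

@[simp] lemma pullback_map_pbFst_assoc {x y : Over A} (g : x ⟶ y) {Z : E} (h : y.left ⟶ Z) :
    ((Over.pullback f).map g).left ≫ pbFst f y ≫ h = pbFst f x ≫ g.left ≫ h := by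
  rw [← Category.assoc, pullback_map_pbFst, Category.assoc]

end Pullback

attribute [-simp] Over.pullback_obj_left Over.pullback_obj_hom Over.pullback_map_left

section Tensoring

variable [CartesianMonoidalCategory E]

/-- The tensoring of `E/I` over `E`: `K ⊗ (a : A ⟶ I)` is `K × A ⟶ A ⟶ I`. -/
instance overAction (I : E) : MonoidalLeftAction E (Over I) where
  actionObj K a := Over.mk (snd K a.left ≫ a.hom)
  actionHomLeft k a := Over.homMk (k ▷ a.left) (by simp)
  actionHomRight K _ _ g := Over.homMk (K ◁ g.left) (by simp)
  actionAssocIso K L a := Over.isoMk (α_ K L a.left) (by simp)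
  actionUnitIso a := Over.isoMk (λ_ a.left) (by simp [leftUnitor_hom])
  actionHom_comp _ _ _ _ := by ext; simp [whisker_exchange_assoc]
  actionAssocIso_hom_naturality f g h := by
    ext; simp [MonoidalCategory.tensorHom_def]
  actionUnitIso_hom_naturality f := by ext; simp
  whiskerLeft_actionHomLeft c _ _ f d := by ext; simp
  whiskerRight_actionHomLeft c f d := by ext; simp
  associator_actionHom c₁ c₂ c₃ d := by ext1; simp [MonoidalCategory.pentagon]
  leftUnitor_actionHom c d := by ext; simp
  rightUnitor_actionHom c d := by ext; simp

@[simp] lemma actionObj_left {I : E} (K : E) (a : Over I) : (K ⊙ₗ a).left = K ⊗ a.left := rfl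

@[simp] lemma actionObj_hom {I : E} (K : E) (a : Over I) :
    (K ⊙ₗ a).hom = snd K a.left ≫ a.hom := rfl

@[simp] lemma actionHomLeft_left {I : E} {K L : E} (k : K ⟶ L) (a : Over I) :
    (k ⊵ₗ a).left = k ▷ a.left := rfl

@[simp] lemma actionHomRight_left {I : E} (K : E) {a b : Over I} (g : a ⟶ b) :
    (K ⊴ₗ g).left = K ◁ g.left := rfl

@[simp] lemma actionAssocIso_hom_left {I : E} (K L : E) (a : Over I) :
    (αₗ K L a).hom.left = (α_ K L a.left).hom := rfl

@[simp] lemma actionUnitIso_hom_left {I : E} (a : Over I) :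
    (λₗ[E] a).hom.left = (λ_ a.left).hom := rfl

@[simp] lemma actionUnitIso_inv_left {I : E} (a : Over I) :
    (λₗ[E] a).inv.left = (λ_ a.left).inv := rfl

open Functor in
/-- The identity strength. -/
@[reducible] def idStrength (I : E) : (𝟭 (Over I)).LaxLeftLinear E where
  μₗ K a := 𝟙 (K ⊙ₗ a)

open Functor in
/-- The strength of a composite functor. -/
@[reducible] def compStrength {I J K : E} (F : Over I ⥤ Over J) (G : Over J ⥤ Over K)
    [F.LaxLeftLinear E] [G.LaxLeftLinear E] : (F ⋙ G).LaxLeftLinear E where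
  μₗ L a := LaxLeftLinear.μₗ G L (F.obj a) ≫ G.map (LaxLeftLinear.μₗ F L a)
  μₗ_naturality_left f d := by simp [← Functor.map_comp]
  μₗ_naturality_right c _ _ f := by simp [← Functor.map_comp]
  μₗ_associativity c c' d := by
    have h := LaxLeftLinear.μₗ_associativity F c c' d
    have h' := LaxLeftLinear.μₗ_associativity G c c' (F.obj d)
    simp only [Functor.comp_obj, Functor.comp_map, Category.assoc, ← Functor.map_comp, h]
    simp only [Functor.map_comp, reassoc_of% h', MonoidalLeftAction.actionHomRight_comp,
      Category.assoc, LaxLeftLinear.μₗ_naturality_right_assoc]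
  μₗ_unitality d := by simp [← Functor.map_comp]

/-- The strength of `Σ_f`, which is the identity `K × X = K × X`. -/
instance mapStrength {B A : E} (f : B ⟶ A) : (Over.map f).LaxLeftLinear E where
  μₗ K x := Over.homMk (𝟙 (K ⊗ x.left)) (by simp)

variable [HasPullbacks E]

/-- The strength `K × (X ×_A B) ⟶ (K × X) ×_A B` of `f^*`. -/
instance pullbackStrength {B A : E} (f : B ⟶ A) : (Over.pullback f).LaxLeftLinear E where
  μₗ K x := Over.homMk (pbLift f (K ⊙ₗ x) (K ◁ pbFst f x) (snd K _ ≫ ((Over.pullback f).obj x).hom)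
      (by simp [pbFst_w])) (by simp)
  μₗ_naturality_left k x := by ext1; apply pb_ext <;> simp [whisker_exchange]
  μₗ_naturality_right K _ _ g := by ext1; apply pb_ext <;> simp [← whiskerLeft_comp]
  μₗ_associativity K L x := by
    ext1; apply pb_ext <;> simp [← whiskerLeft_comp]
  μₗ_unitality x := by ext1; apply pb_ext <;> simp [leftUnitor_hom]

@[simp] lemma pullbackStrength_left {B A : E} (f : B ⟶ A) (K : E) (x : Over A) :
    (Functor.LaxLeftLinear.μₗ (Over.pullback f) K x).left =
      pbLift f (K ⊙ₗ x) (K ◁ pbFst f x) (snd K _ ≫ ((Over.pullback f).obj x).hom)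
        (by simp [pbFst_w]) := rfl

/-- The strength of `f^*` is invertible, with inverse `(K × X) ×_A B ⟶ K × (X ×_A B)`. -/
instance pullbackLeftLinear {B A : E} (f : B ⟶ A) : (Over.pullback f).LeftLinear E where
  toLaxLeftLinear := pullbackStrength f
  δₗ K x := Over.homMk (lift (pbFst f (K ⊙ₗ x) ≫ fst K x.left)
    (pbLift f x (pbFst f (K ⊙ₗ x) ≫ snd K x.left) ((Over.pullback f).obj (K ⊙ₗ x)).hom
      (by simpa using pbFst_w f (K ⊙ₗ x)))) (by simp)
  δₗ_naturality_left k x := by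
    ext1; apply CartesianMonoidalCategory.hom_ext
    · simp
    · apply pb_ext <;> simp
  δₗ_naturality_right K _ _ g := by
    ext1; apply CartesianMonoidalCategory.hom_ext
    · simp
    · apply pb_ext <;> simp
  δₗ_associativity K L x := by
    ext1; apply CartesianMonoidalCategory.hom_ext
    · simp
    · apply CartesianMonoidalCategory.hom_ext
      · simp
      · apply pb_ext <;> simp
  δₗ_unitality_inv x := by
    ext1; apply CartesianMonoidalCategory.hom_ext
    · apply toUnit_unique
    · apply pb_ext <;> simp
  μₗ_comp_δₗ K x := by
    ext1; apply CartesianMonoidalCategory.hom_ext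
    · simp
    · apply pb_ext <;> simp
  δₗ_comp_μₗ K x := by
    ext1; apply pb_ext
    · simp only [Over.comp_left, Over.homMk_left, Category.assoc]
      apply CartesianMonoidalCategory.hom_ext <;> simp
    · simp

open Functor in
/-- The strength of a right adjoint `R` of `L`: the transpose of
`L (K ⊗ R b) ⟶ K ⊗ L (R b) ⟶ K ⊗ b`. -/
@[reducible] def rightAdjointStrength {I J : E} {L : Over I ⥤ Over J} {R : Over J ⥤ Over I}
    (adj : L ⊣ R) [L.OplaxLeftLinear E] : R.LaxLeftLinear E where
  μₗ K b := adj.homEquiv (K ⊙ₗ R.obj b) (K ⊙ₗ b)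
    (OplaxLeftLinear.δₗ L K (R.obj b) ≫ K ⊴ₗ adj.counit.app b)
  μₗ_naturality_left k b := by
    rw [← adj.homEquiv_naturality_left, ← adj.homEquiv_naturality_right]
    simp [MonoidalLeftAction.action_exchange]
  μₗ_naturality_right K _ _ g := by
    rw [← adj.homEquiv_naturality_left, ← adj.homEquiv_naturality_right]
    simp [← MonoidalLeftAction.actionHomRight_comp]
  μₗ_associativity K K' b := by
    have h : L.map (adj.homEquiv (K' ⊙ₗ R.obj b) (K' ⊙ₗ b)
        (OplaxLeftLinear.δₗ L K' (R.obj b) ≫ K' ⊴ₗ adj.counit.app b)) ≫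
          adj.counit.app (K' ⊙ₗ b) =
        OplaxLeftLinear.δₗ L K' (R.obj b) ≫ K' ⊴ₗ adj.counit.app b := by
      exact (adj.homEquiv_counit _ _ _).symm.trans (Equiv.symm_apply_apply _ _)
    rw [← adj.homEquiv_naturality_right, ← adj.homEquiv_naturality_left,
      ← adj.homEquiv_naturality_left]
    congr 1
    rw [OplaxLeftLinear.δₗ_naturality_right_assoc, ← MonoidalLeftAction.actionHomRight_comp, h]
    simp
  μₗ_unitality b := by
    rw [← adj.homEquiv_naturality_right, ← Equiv.symm_apply_eq, Adjunction.homEquiv_counit]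
    simp

variable [LocallyCartesianClosed E]

/-- The dependent product functor `Π_f`, right adjoint to `f^*`. -/
def push {B A : E} (f : B ⟶ A) : Over B ⥤ Over A :=
  haveI := LocallyCartesianClosed.isLeftAdjoint f
  (Over.pullback f).rightAdjoint

/-- The adjunction `f^* ⊣ Π_f`. -/
def pullbackPushAdj {B A : E} (f : B ⟶ A) : Over.pullback f ⊣ push f :=
  haveI := LocallyCartesianClosed.isLeftAdjoint f
  Adjunction.ofIsLeftAdjoint (Over.pullback f)

instance pushStrength {B A : E} (f : B ⟶ A) : (push f).LaxLeftLinear E :=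
  rightAdjointStrength (pullbackPushAdj f)

end Tensoring

section Canonical

variable [HasPullbacks E]

/-- Pseudofunctoriality of `Σ`. -/
def mapCompIso {X Y Z : E} {f : X ⟶ Y} {g : Y ⟶ Z} {k : X ⟶ Z} (h : k = f ≫ g) :
    Over.map k ≅ Over.map f ⋙ Over.map g :=
  Over.mapCongr k (f ≫ g) h ≪≫ Over.mapComp f g

/-- Pseudofunctoriality of pullback. -/
def pullbackCompIso {X Y Z : E} {f : X ⟶ Y} {g : Y ⟶ Z} {k : X ⟶ Z} (h : k = f ≫ g) :
    Over.pullback k ≅ Over.pullback g ⋙ Over.pullback f :=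
  conjugateIsoEquiv (Over.mapPullbackAdj k) ((Over.mapPullbackAdj f).comp (Over.mapPullbackAdj g))
    (mapCompIso h).symm

/-- The Beck–Chevalley isomorphism `Σ_k h^* ≅ u^* Σ_t` of a cartesian square. -/
def beckChevalleySum {P X Y Z : E} {h : P ⟶ X} {k : P ⟶ Y} {t : X ⟶ Z} {u : Y ⟶ Z}
    (sq : IsPullback h k t u) :
    Over.pullback h ⋙ Over.map k ≅ Over.map t ⋙ Over.pullback u :=
  NatIso.ofComponents
    (fun x => Over.isoMk
      { hom := pbLift u ((Over.map t).obj x) (pbFst h x) (((Over.pullback h).obj x).hom ≫ k)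
          (by simp [pbFst_w_assoc, sq.w])
        inv := pbLift h x (pbFst u ((Over.map t).obj x))
          (sq.lift (pbFst u ((Over.map t).obj x) ≫ x.hom)
            ((Over.pullback u).obj ((Over.map t).obj x)).hom
            (by simpa using pbFst_w u ((Over.map t).obj x))) (by simp)
        hom_inv_id := by
          apply pb_ext
          · simp
          · apply sq.hom_ext <;> simp [pbFst_w]
        inv_hom_id := by apply pb_ext <;> simp }
      (by simp))
    (fun g => by ext1; apply pb_ext <;> simp)

variable [LocallyCartesianClosed E]

/-- Pseudofunctoriality of `Π`. -/
def pushCompIso {X Y Z : E} {f : X ⟶ Y} {g : Y ⟶ Z} {k : X ⟶ Z} (h : k = f ≫ g) :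
    push k ≅ push f ⋙ push g :=
  conjugateIsoEquiv (pullbackPushAdj k) ((pullbackPushAdj g).comp (pullbackPushAdj f))
    (pullbackCompIso h).symm

/-- The isomorphism `Π_id ≅ Id`. -/
def pushIdIso (I : E) : push (𝟙 I) ≅ 𝟭 (Over I) :=
  conjugateIsoEquiv (pullbackPushAdj (𝟙 I)) Adjunction.id Over.pullbackId.symm

/-- The Beck–Chevalley isomorphism `Π_p β^* ≅ α^* Π_f` of a cartesian square, obtained from
`Σ_β p^* ≅ f^* Σ_α` by passing to right adjoints. -/
def beckChevalleyProd {P B C A : E} {β : P ⟶ B} {p : P ⟶ C} {f : B ⟶ A} {α : C ⟶ A}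
    (sq : IsPullback β p f α) :
    Over.pullback β ⋙ push p ≅ push f ⋙ Over.pullback α :=
  conjugateIsoEquiv ((pullbackPushAdj p).comp (Over.mapPullbackAdj β))
    ((Over.mapPullbackAdj α).comp (pullbackPushAdj f)) (beckChevalleySum sq.flip).symm

section Distributivity

variable {X D C : E} (k : X ⟶ D) (g : D ⟶ C)

/-- The object `w : M ⟶ C` obtained by applying `Π_g` to `k : X ⟶ D`. -/
def distM : Over C := (push g).obj (Over.mk k)

/-- The projection `q : D' ⟶ M`, where `D' = M ×_C D`. -/
def distQ : ((Over.pullback g).obj (distM k g)).left ⟶ (distM k g).left := pbFst g (distM k g)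

/-- The `k`-component `D' ⟶ X` of the counit of `g^* ⊣ Π_g`. -/
def distE : ((Over.pullback g).obj (distM k g)).left ⟶ X :=
  ((pullbackPushAdj g).counit.app (Over.mk k)).left

lemma distE_w : ((Over.pullback g).obj (distM k g)).hom = distE k g ≫ k :=
  (Over.w ((pullbackPushAdj g).counit.app (Over.mk k))).symm

lemma dist_isPullback : IsPullback (distQ k g) ((Over.pullback g).obj (distM k g)).hom
    (distM k g).hom g :=
  IsPullback.of_hasPullback _ _

/-- The transpose `g^* Σ_w Π_q ε^* ≅ Σ_{w'} q^* Π_q ε^* ⟶ Σ_{w'} ε^* ≅ Σ_k Σ_ε ε^* ⟶ Σ_k` of the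
distributivity transformation. -/
def distTranspose :
    (Over.pullback (distE k g) ⋙ push (distQ k g) ⋙ Over.map (distM k g).hom) ⋙ Over.pullback g ⟶
      Over.map k :=
  Functor.whiskerLeft (Over.pullback (distE k g) ⋙ push (distQ k g))
      (beckChevalleySum (dist_isPullback k g)).inv ≫
    Functor.whiskerLeft (Over.pullback (distE k g))
      (Functor.whiskerRight (pullbackPushAdj (distQ k g)).counit
        (Over.map ((Over.pullback g).obj (distM k g)).hom)) ≫
    Functor.whiskerLeft (Over.pullback (distE k g)) (mapCompIso (distE_w k g)).hom ≫
    Functor.whiskerRight (Over.mapPullbackAdj (distE k g)).counit (Over.map k)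

/-- The canonical distributivity transformation `Σ_w Π_q ε^* ⟶ Π_g Σ_k`. -/
def distributivity :
    Over.pullback (distE k g) ⋙ push (distQ k g) ⋙ Over.map (distM k g).hom ⟶
      Over.map k ⋙ push g :=
  Functor.whiskerLeft (Over.pullback (distE k g) ⋙ push (distQ k g) ⋙ Over.map (distM k g).hom)
      (pullbackPushAdj g).unit ≫
    Functor.whiskerRight (distTranspose k g) (push g)

end Distributivity

end Canonical

section StrongFunctors

variable [CartesianMonoidalCategory E]

/-- A functor `E/I ⥤ E/J` with a tensorial strength. -/
structure StrongFunctor (I J : E) where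
  functor : Over I ⥤ Over J
  strength : functor.LaxLeftLinear E

attribute [instance] StrongFunctor.strength

namespace StrongFunctor

open Functor

/-- A strong natural transformation: one compatible with the strengths. -/
@[ext]
structure Hom {I J : E} (F G : StrongFunctor I J) where
  natTrans : F.functor ⟶ G.functor
  strong (K : E) (x : Over I) :
    LaxLeftLinear.μₗ F.functor K x ≫ natTrans.app (K ⊙ₗ x) =
      K ⊴ₗ natTrans.app x ≫ LaxLeftLinear.μₗ G.functor K x

attribute [simp] Hom.strong

@[simp] lemma Hom.strong_assoc {I J : E} {F G : StrongFunctor I J} (φ : Hom F G) (K : E)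
    (x : Over I) {Z : Over J} (h : G.functor.obj (K ⊙ₗ x) ⟶ Z) :
    LaxLeftLinear.μₗ F.functor K x ≫ φ.natTrans.app (K ⊙ₗ x) ≫ h =
      K ⊴ₗ φ.natTrans.app x ≫ LaxLeftLinear.μₗ G.functor K x ≫ h := by
  rw [← Category.assoc, φ.strong, Category.assoc]

@[simps]
instance (I J : E) : Category (StrongFunctor I J) where
  Hom := Hom
  id F := { natTrans := 𝟙 _, strong := by simp }
  comp φ ψ :=
    { natTrans := φ.natTrans ≫ ψ.natTrans
      strong := by simp }

@[ext] lemma hom_ext {I J : E} {F G : StrongFunctor I J} {φ ψ : F ⟶ G}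
    (h : φ.natTrans = ψ.natTrans) : φ = ψ := Hom.ext h

lemma hom_ext_app {I J : E} {F G : StrongFunctor I J} {φ ψ : F ⟶ G}
    (h : ∀ x, φ.natTrans.app x = ψ.natTrans.app x) : φ = ψ :=
  hom_ext (NatTrans.ext (funext h))

/-- An isomorphism of strong functors from a natural isomorphism that is strong. -/
@[simps]
def isoMk {I J : E} {F G : StrongFunctor I J} (e : F.functor ≅ G.functor)
    (h : ∀ (K : E) (x : Over I), LaxLeftLinear.μₗ F.functor K x ≫ e.hom.app (K ⊙ₗ x) =
      K ⊴ₗ e.hom.app x ≫ LaxLeftLinear.μₗ G.functor K x) : F ≅ G where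
  hom := { natTrans := e.hom, strong := h }
  inv :=
    { natTrans := e.inv
      strong := fun K x => by
        rw [← cancel_mono (e.hom.app (K ⊙ₗ x)), Category.assoc, Category.assoc, h,
          ← MonoidalLeftAction.actionHomRight_comp_assoc]
        simp }

/-- The identity strong functor. -/
@[simps] def id (I : E) : StrongFunctor I I := ⟨𝟭 _, idStrength I⟩

/-- Composition of strong functors. -/
@[simps] def comp {I J K : E} (F : StrongFunctor I J) (G : StrongFunctor J K) :
    StrongFunctor I K := ⟨F.functor ⋙ G.functor, compStrength F.functor G.functor⟩

end StrongFunctor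

/-- The slices of `E`: the object `⟨I⟩` stands for the category `E/I`. -/
structure Slice (E : Type u) where
  base : E

instance : CategoryStruct (Slice E) where
  Hom I J := StrongFunctor I.base J.base
  id I := StrongFunctor.id I.base
  comp F G := F.comp G

instance (I J : Slice E) : Category (I ⟶ J) :=
  inferInstanceAs (Category (StrongFunctor I.base J.base))

/-- The 2-category of slices of `E`, strong functors and strong natural transformations, with the
compositions of the 2-category of categories. -/
instance strongBicategory : Bicategory (Slice E) where
  homCategory := inferInstance
  whiskerLeft F G H φ :=
    { natTrans := Functor.whiskerLeft F.functor φ.natTrans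
      strong := fun K x => by
        change (Functor.LaxLeftLinear.μₗ G.functor K (F.functor.obj x) ≫
            G.functor.map (Functor.LaxLeftLinear.μₗ F.functor K x)) ≫ φ.natTrans.app _ =
          K ⊴ₗ φ.natTrans.app (F.functor.obj x) ≫
            (Functor.LaxLeftLinear.μₗ H.functor K (F.functor.obj x) ≫
              H.functor.map (Functor.LaxLeftLinear.μₗ F.functor K x))
        simp }
  whiskerRight φ G :=
    { natTrans := Functor.whiskerRight φ.natTrans G.functor
      strong := fun K x => by
        change (Functor.LaxLeftLinear.μₗ G.functor K _ ≫
            G.functor.map (Functor.LaxLeftLinear.μₗ _ K x)) ≫ G.functor.map (φ.natTrans.app _) =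
          K ⊴ₗ G.functor.map (φ.natTrans.app x) ≫
            (Functor.LaxLeftLinear.μₗ G.functor K _ ≫
              G.functor.map (Functor.LaxLeftLinear.μₗ _ K x))
        rw [Category.assoc, ← Functor.map_comp, StrongFunctor.Hom.strong]
        simp }
  associator F G H := StrongFunctor.isoMk
    (Functor.associator F.functor G.functor H.functor) (fun K x => by
      change (Functor.LaxLeftLinear.μₗ H.functor K _ ≫ H.functor.map
          (Functor.LaxLeftLinear.μₗ G.functor K _ ≫
            G.functor.map (Functor.LaxLeftLinear.μₗ F.functor K x))) ≫ 𝟙 _ =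
        K ⊴ₗ 𝟙 _ ≫ ((Functor.LaxLeftLinear.μₗ H.functor K _ ≫
          H.functor.map (Functor.LaxLeftLinear.μₗ G.functor K _)) ≫
            H.functor.map (G.functor.map (Functor.LaxLeftLinear.μₗ F.functor K x)))
      rw [Category.comp_id, MonoidalLeftAction.actionHomRight_id, Category.id_comp,
        Functor.map_comp, Category.assoc])
  leftUnitor F := StrongFunctor.isoMk F.functor.leftUnitor (fun K x => by
    change (Functor.LaxLeftLinear.μₗ F.functor K x ≫ F.functor.map (𝟙 _)) ≫ 𝟙 _ =
      K ⊴ₗ 𝟙 _ ≫ Functor.LaxLeftLinear.μₗ F.functor K x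
    rw [CategoryTheory.Functor.map_id, MonoidalLeftAction.actionHomRight_id, Category.id_comp,
      Category.comp_id, Category.comp_id])
  rightUnitor F := StrongFunctor.isoMk F.functor.rightUnitor (fun K x => by
    change (𝟙 _ ≫ Functor.LaxLeftLinear.μₗ F.functor K x) ≫ 𝟙 _ =
      K ⊴ₗ 𝟙 _ ≫ Functor.LaxLeftLinear.μₗ F.functor K x
    rw [MonoidalLeftAction.actionHomRight_id, Category.comp_id])
  whiskerLeft_id _ _ := StrongFunctor.hom_ext_app (fun _ => rfl)
  whiskerLeft_comp _ _ _ _ _ _ := StrongFunctor.hom_ext_app (fun _ => rfl)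
  id_whiskerLeft η := StrongFunctor.hom_ext_app (fun x => by
    change η.natTrans.app x = 𝟙 _ ≫ η.natTrans.app x ≫ 𝟙 _; simp)
  comp_whiskerLeft f g h h' η := StrongFunctor.hom_ext_app (fun x => by
    change η.natTrans.app (g.functor.obj (f.functor.obj x)) =
      𝟙 _ ≫ η.natTrans.app (g.functor.obj (f.functor.obj x)) ≫ 𝟙 _
    simp)
  id_whiskerRight f g := StrongFunctor.hom_ext_app (fun x => by
    exact g.functor.map_id _)
  comp_whiskerRight _ _ i := StrongFunctor.hom_ext_app (fun x => by
    exact i.functor.map_comp _ _)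
  whiskerRight_id η := StrongFunctor.hom_ext_app (fun x => by
    change η.natTrans.app x = 𝟙 _ ≫ η.natTrans.app x ≫ 𝟙 _; simp)
  whiskerRight_comp η g h := StrongFunctor.hom_ext_app (fun x => by
    change h.functor.map (g.functor.map (η.natTrans.app x)) =
      𝟙 _ ≫ h.functor.map (g.functor.map (η.natTrans.app x)) ≫ 𝟙 _
    simp)
  whisker_assoc f g g' η h := StrongFunctor.hom_ext_app (fun x => by
    change h.functor.map (η.natTrans.app (f.functor.obj x)) =
      𝟙 _ ≫ h.functor.map (η.natTrans.app (f.functor.obj x)) ≫ 𝟙 _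
    simp)
  whisker_exchange {_ _ _ f g h i} η θ := StrongFunctor.hom_ext_app (fun x => by
    exact (θ.natTrans.naturality (η.natTrans.app x)).symm)
  pentagon f g h i := StrongFunctor.hom_ext_app (fun x => by
    change i.functor.map (𝟙 _) ≫ 𝟙 _ ≫ 𝟙 _ = 𝟙 _ ≫ 𝟙 _
    simp)
  triangle f g := StrongFunctor.hom_ext_app (fun x => by
    change 𝟙 _ ≫ 𝟙 _ = g.functor.map (𝟙 _)
    simp)

lemma StrongFunctor.ext_of {I J : E} {T : Over I ⥤ Over J} {s s' : T.LaxLeftLinear E}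
    (h : ∀ K x, s.μₗ K x = s'.μₗ K x) : StrongFunctor.mk T s = StrongFunctor.mk T s' := by
  have : s = s' := by
    cases s; cases s'; congr; funext K x; exact h K x
  rw [this]

lemma Slice.id_comp {I J : Slice E} (F : I ⟶ J) : 𝟙 I ≫ F = F := by
  refine StrongFunctor.ext_of (T := F.functor)
    (s := ((StrongFunctor.id _).comp F).strength) ?_
  intro K x
  change _ ≫ F.functor.map (𝟙 _) = _
  rw [CategoryTheory.Functor.map_id]; exact Category.comp_id _

lemma Slice.comp_id {I J : Slice E} (F : I ⟶ J) : F ≫ 𝟙 J = F := by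
  refine StrongFunctor.ext_of (T := F.functor)
    (s := (StrongFunctor.comp F (StrongFunctor.id _)).strength) ?_
  intro K x
  exact Category.id_comp _

lemma Slice.comp_assoc {I J K L : Slice E} (F : I ⟶ J) (G : J ⟶ K) (H : K ⟶ L) :
    (F ≫ G) ≫ H = F ≫ G ≫ H := by
  refine StrongFunctor.ext_of (T := F.functor ⋙ G.functor ⋙ H.functor)
    (s := ((F.comp G).comp H).strength) (s' := (F.comp (G.comp H)).strength) ?_
  intro K x
  refine (congrArg (_ ≫ ·) (H.functor.map_comp _ _)).trans ?_
  exact (Category.assoc _ _ _).symm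

lemma Slice.eqToIso_app {I J : Slice E} {F G : I ⟶ J} (h : F = G) (x : Over I.base) :
    (eqToIso h).hom.natTrans.app x = eqToHom (by rw [h]) := by
  subst h; rfl

/-- The bicategory of slices and strong functors is a 2-category. -/
instance : Bicategory.Strict (Slice E) where
  id_comp := Slice.id_comp
  comp_id := Slice.comp_id
  assoc := Slice.comp_assoc
  leftUnitor_eqToIso F := Iso.ext (StrongFunctor.hom_ext_app (fun x =>
    (Slice.eqToIso_app (Slice.id_comp F) x).symm))
  rightUnitor_eqToIso F := Iso.ext (StrongFunctor.hom_ext_app (fun x =>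
    (Slice.eqToIso_app (Slice.comp_id F) x).symm))
  associator_eqToIso F G H := Iso.ext (StrongFunctor.hom_ext_app (fun x =>
    (Slice.eqToIso_app (Slice.comp_assoc F G H) x).symm))

end StrongFunctors


section Polynomials

/-- A polynomial `I ⟵ B ⟶ A ⟶ J` from `I` to `J`. -/
structure Polynomial (I J : E) where
  {B A : E}
  s : B ⟶ I
  f : B ⟶ A
  t : A ⟶ J

namespace Polynomial

variable {I J K : E}

/-- A diagram representing a morphism from `G`, with maps `I ⟵ D ⟶ C ⟶ J`, to `F`, with maps
`I ⟵ B ⟶ A ⟶ J`: an object `mid` with maps `w : mid ⟶ D` and `β : mid ⟶ B`, and a map `α : C ⟶ A`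
over `J`, such that `w` and `β` agree on `I` and the square with sides `β`, `w ≫ G.f`, `F.f`, `α`
is cartesian. -/
structure Diagram (G F : Polynomial I J) where
  mid : E
  w : mid ⟶ G.B
  β : mid ⟶ F.B
  α : G.A ⟶ F.A
  isPullback : IsPullback β (w ≫ G.f) F.f α
  w_s : w ≫ G.s = β ≫ F.s
  α_t : α ≫ F.t = G.t

/-- Two diagrams are identified when they differ only by the choice of the pullback. -/
instance Diagram.setoid (G F : Polynomial I J) : Setoid (Diagram G F) where
  r d d' := d.α = d'.α ∧ ∃ e : d.mid ≅ d'.mid, e.hom ≫ d'.w = d.w ∧ e.hom ≫ d'.β = d.β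
  iseqv :=
    { refl := fun d => ⟨rfl, Iso.refl _, by simp, by simp⟩
      symm := fun ⟨h, e, hw, hβ⟩ => ⟨h.symm, e.symm, by simp [← hw], by simp [← hβ]⟩
      trans := fun ⟨h, e, hw, hβ⟩ ⟨h', e', hw', hβ'⟩ =>
        ⟨h.trans h', e ≪≫ e', by simp [hw', hw], by simp [hβ', hβ]⟩ }

/-- A map between the middle objects suffices, since it is a map of pullbacks. -/
lemma Diagram.equiv_of {G F : Polynomial I J} (d d' : Diagram G F) (hα : d.α = d'.α)
    (φ : d.mid ⟶ d'.mid) (hw : φ ≫ d'.w = d.w) (hβ : φ ≫ d'.β = d.β) : d ≈ d' := by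
  have h := d.isPullback
  rw [hα] at h
  have hφ : φ = (h.isoIsPullback _ _ d'.isPullback).hom := by
    apply d'.isPullback.hom_ext
    · simp [hβ]
    · simp [reassoc_of% hw]
  refine ⟨hα, h.isoIsPullback _ _ d'.isPullback, ?_, ?_⟩
  · rw [← hφ, hw]
  · rw [← hφ, hβ]

/-- The identity diagram. -/
def Diagram.id (F : Polynomial I J) : Diagram F F where
  mid := F.B
  w := 𝟙 _
  β := 𝟙 _
  α := 𝟙 _
  isPullback := by simpa using IsPullback.id_horiz F.f
  w_s := rfl
  α_t := by simp

variable [HasPullbacks E]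

/-- Vertical composition of diagrams, by pullback of the middle parts. -/
def Diagram.comp {G F H : Polynomial I J} (d : Diagram G F) (d' : Diagram F H) :
    Diagram G H where
  mid := pullback d.β d'.w
  w := pullback.fst d.β d'.w ≫ d.w
  β := pullback.snd d.β d'.w ≫ d'.β
  α := d.α ≫ d'.α
  isPullback := by
    have h := (IsPullback.of_hasPullback d.β d'.w).paste_horiz d.isPullback.flip
    simpa using (h.paste_vert d'.isPullback.flip).flip
  w_s := by simp [d.w_s, ← d'.w_s, pullback.condition_assoc]
  α_t := by simp [d.α_t, d'.α_t]

/-- The map into the middle object of a composite with the given components. -/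
def Diagram.compLift {G F H : Polynomial I J} (d : Diagram G F) (d' : Diagram F H) {W : E}
    (a : W ⟶ d.mid) (b : W ⟶ d'.mid) (h : a ≫ d.β = b ≫ d'.w) : W ⟶ (d.comp d').mid :=
  pullback.lift a b h

lemma Diagram.compLift_w {G F H : Polynomial I J} (d : Diagram G F) (d' : Diagram F H) {W : E}
    (a : W ⟶ d.mid) (b : W ⟶ d'.mid) (h : a ≫ d.β = b ≫ d'.w) :
    d.compLift d' a b h ≫ (d.comp d').w = a ≫ d.w :=
  pullback.lift_fst_assoc _ _ _ _

lemma Diagram.compLift_β {G F H : Polynomial I J} (d : Diagram G F) (d' : Diagram F H) {W : E}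
    (a : W ⟶ d.mid) (b : W ⟶ d'.mid) (h : a ≫ d.β = b ≫ d'.w) :
    d.compLift d' a b h ≫ (d.comp d').β = b ≫ d'.β :=
  pullback.lift_snd_assoc _ _ _ _

/-- The first projection of the middle object of a composite. -/
def Diagram.compFst {G F H : Polynomial I J} (d : Diagram G F) (d' : Diagram F H) :
    (d.comp d').mid ⟶ d.mid := pullback.fst d.β d'.w

/-- The second projection of the middle object of a composite. -/
def Diagram.compSnd {G F H : Polynomial I J} (d : Diagram G F) (d' : Diagram F H) :
    (d.comp d').mid ⟶ d'.mid := pullback.snd d.β d'.w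

lemma Diagram.comp_condition {G F H : Polynomial I J} (d : Diagram G F) (d' : Diagram F H) :
    d.compFst d' ≫ d.β = d.compSnd d' ≫ d'.w := pullback.condition

lemma Diagram.comp_w {G F H : Polynomial I J} (d : Diagram G F) (d' : Diagram F H) :
    (d.comp d').w = d.compFst d' ≫ d.w := rfl

lemma Diagram.comp_β {G F H : Polynomial I J} (d : Diagram G F) (d' : Diagram F H) :
    (d.comp d').β = d.compSnd d' ≫ d'.β := rfl

/-- The category of polynomials from `I` to `J`; its morphisms are diagrams up to the choice of
the pullback. -/
instance category (I J : E) : Category (Polynomial I J) where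
  Hom G F := Quotient (Diagram.setoid G F)
  id F := ⟦Diagram.id F⟧
  comp {G F H} := Quotient.map₂ Diagram.comp (by
    rintro d₁ d₂ ⟨h, e, hw, hβ⟩ d₁' d₂' ⟨h', e', hw', hβ'⟩
    refine Diagram.equiv_of _ _ (congrArg₂ _ h h')
      (d₂.compLift d₂' (d₁.compFst d₁' ≫ e.hom) (d₁.compSnd d₁' ≫ e'.hom) ?_) ?_ ?_
    · rw [Category.assoc, Category.assoc, hβ, hw', Diagram.comp_condition]
    · rw [Diagram.compLift_w, Category.assoc, hw, Diagram.comp_w]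
    · rw [Diagram.compLift_β, Category.assoc, hβ', Diagram.comp_β])
  id_comp := by
    rintro G F ⟨d⟩
    refine Quotient.sound (Diagram.equiv_of _ _ (Category.id_comp _)
      (Diagram.compSnd _ _) ?_ ?_)
    · rw [← Diagram.comp_condition, Diagram.comp_w]; rfl
    · rw [Diagram.comp_β]
  comp_id := by
    rintro G F ⟨d⟩
    refine Quotient.sound (Diagram.equiv_of _ _ (Category.comp_id _)
      (Diagram.compFst _ _) ?_ ?_)
    · rw [Diagram.comp_w]
    · rw [Diagram.comp_condition, Diagram.comp_β]; rfl
  assoc := by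
    rintro G F H L ⟨d⟩ ⟨d'⟩ ⟨d''⟩
    refine Quotient.sound (Diagram.equiv_of _ _ (Category.assoc _ _ _)
      (d.compLift (d'.comp d'') ((d.comp d').compFst d'' ≫ d.compFst d')
        (d'.compLift d'' ((d.comp d').compFst d'' ≫ d.compSnd d')
          ((d.comp d').compSnd d'') ?_) ?_) ?_ ?_)
    · rw [Category.assoc, ← Diagram.comp_β, Diagram.comp_condition]
    · rw [Diagram.compLift_w, Category.assoc, Diagram.comp_condition, Category.assoc]
    · rw [Diagram.compLift_w, Diagram.comp_w, Diagram.comp_w, Category.assoc]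
    · rw [Diagram.compLift_β]
      exact Diagram.compLift_β ..

/-- The class of a diagram. -/
def Diagram.toHom {G F : Polynomial I J} (d : Diagram G F) : G ⟶ F := ⟦d⟧

/-- The identity polynomial. -/
@[simps] def id (I : E) : Polynomial I I := ⟨𝟙 I, 𝟙 I, 𝟙 I⟩

variable [LocallyCartesianClosed E]

section Substitution

variable (F : Polynomial I J) (G : Polynomial J K)

/-- `h : A' ⟶ A`, where `A' = A ×_J D`. -/
def subH : pullback F.t G.s ⟶ F.A := pullback.fst F.t G.s

/-- `k : A' ⟶ D`, where `A' = A ×_J D`. -/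
def subK : pullback F.t G.s ⟶ G.B := pullback.snd F.t G.s

/-- `m : B' ⟶ B`, where `B' = B ×_A A'`. -/
def subM : pullback F.f (subH F G) ⟶ F.B := pullback.fst F.f (subH F G)

/-- `r : B' ⟶ A'`, where `B' = B ×_A A'`. -/
def subR : pullback F.f (subH F G) ⟶ pullback F.t G.s := pullback.snd F.f (subH F G)

/-- `n : N ⟶ B'`, where `N = B' ×_{A'} D'`. -/
def subN : pullback (subR F G) (distE (subK F G) G.f) ⟶ pullback F.f (subH F G) :=
  pullback.fst (subR F G) (distE (subK F G) G.f)

/-- `p : N ⟶ D'`, where `N = B' ×_{A'} D'`. -/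
def subP : pullback (subR F G) (distE (subK F G) G.f) ⟶
    ((Over.pullback G.f).obj (distM (subK F G) G.f)).left :=
  pullback.snd (subR F G) (distE (subK F G) G.f)

/-- The substitution `G ∘ F`, in diagrammatic order. For `F` with maps `I ⟵ B ⟶ A ⟶ J` and `G` with
maps `J ⟵ D ⟶ C ⟶ K`, it is `I ⟵ N ⟶ M ⟶ K`, where `A' = A ×_J D`, `M = Π_g (A' ⟶ D)`,
`D' = M ×_C D`, `ε : D' ⟶ A'` is the counit, `B' = B ×_A A'` and `N = B' ×_{A'} D'`. The map `N ⟶ I`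
is `N ⟶ B' ⟶ B ⟶ I`, the map `N ⟶ M` is `N ⟶ D' ⟶ M` and the map `M ⟶ K` is `M ⟶ C ⟶ K`. -/
@[simps] def comp : Polynomial I K where
  B := pullback (subR F G) (distE (subK F G) G.f)
  A := (distM (subK F G) G.f).left
  s := subN F G ≫ subM F G ≫ F.s
  f := subP F G ≫ distQ (subK F G) G.f
  t := (distM (subK F G) G.f).hom ≫ G.t

end Substitution

/-- The functor `Σ_t Π_f s^* : E/I ⥤ E/J`. -/
def extFunctor (F : Polynomial I J) : Over I ⥤ Over J :=
  Over.pullback F.s ⋙ push F.f ⋙ Over.map F.t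

/-- The transformation induced by a diagram: the composite
`Σ_v Π_g u^* ⟶ Σ_v Π_g Π_w w^* u^* ≅ Σ_v Π_{gw} β^* s^* ≅ Σ_t Σ_α α^* Π_f s^* ⟶ Σ_t Π_f s^*`
of the unit of `w^* ⊣ Π_w`, Beck–Chevalley, and the counit of `Σ_α ⊣ α^*`. -/
def Diagram.extNatTrans {G F : Polynomial I J} (d : Diagram G F) :
    extFunctor G ⟶ extFunctor F :=
  let c₁ : Over.pullback G.s ⋙ push G.f ⋙ Over.map G.t ⟶
      Over.pullback G.s ⋙ (Over.pullback d.w ⋙ push d.w) ⋙ push G.f ⋙ Over.map G.t :=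
    Functor.whiskerLeft (Over.pullback G.s)
      (Functor.whiskerRight (pullbackPushAdj d.w).unit (push G.f ⋙ Over.map G.t))
  let c₂ : (Over.pullback G.s ⋙ Over.pullback d.w) ⋙ (push d.w ⋙ push G.f) ⋙ Over.map G.t ⟶
      (Over.pullback F.s ⋙ Over.pullback d.β) ⋙ push (d.w ≫ G.f) ⋙ Over.map G.t :=
    Functor.whiskerRight ((pullbackCompIso rfl).inv ≫ (pullbackCompIso d.w_s).hom)
        ((push d.w ⋙ push G.f) ⋙ Over.map G.t) ≫
      Functor.whiskerLeft (Over.pullback F.s ⋙ Over.pullback d.β)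
        (Functor.whiskerRight (pushCompIso rfl).inv (Over.map G.t))
  let c₃ : Over.pullback F.s ⋙ (Over.pullback d.β ⋙ push (d.w ≫ G.f)) ⋙ Over.map G.t ⟶
      Over.pullback F.s ⋙ (push F.f ⋙ Over.pullback d.α) ⋙ Over.map d.α ⋙ Over.map F.t :=
    Functor.whiskerLeft (Over.pullback F.s)
      (Functor.whiskerRight (beckChevalleyProd d.isPullback).hom (Over.map G.t) ≫
        Functor.whiskerLeft (push F.f ⋙ Over.pullback d.α) (mapCompIso d.α_t.symm).hom)
  let c₄ : (Over.pullback F.s ⋙ push F.f) ⋙ (Over.pullback d.α ⋙ Over.map d.α) ⋙ Over.map F.t ⟶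
      (Over.pullback F.s ⋙ push F.f) ⋙ Over.map F.t :=
    Functor.whiskerLeft (Over.pullback F.s ⋙ push F.f)
      (Functor.whiskerRight (Over.mapPullbackAdj d.α).counit (Over.map F.t))
  c₁ ≫ c₂ ≫ c₃ ≫ c₄

/-- The canonical transformation from the extension of the identity polynomial to the identity. -/
def extId (I : E) : extFunctor (id I) ⟶ 𝟭 (Over I) :=
  Functor.whiskerRight Over.pullbackId.hom (push (𝟙 I) ⋙ Over.map (𝟙 I)) ≫
    Functor.whiskerRight (pushIdIso I).hom (Over.map (𝟙 I)) ≫ (Over.mapId I).hom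

/-- The canonical transformation from the extension of `G ∘ F` to the composite of the extensions:
the composite
`Σ_{vw} Π_{qp} (smn)^* ≅ Σ_v Σ_w Π_q Π_p n^* m^* s^* ≅ Σ_v Σ_w Π_q ε^* Π_r m^* s^*`
`≅ Σ_v Σ_w Π_q ε^* h^* Π_f s^* ⟶ Σ_v Π_g Σ_k h^* Π_f s^* ≅ Σ_v Π_g u^* Σ_t Π_f s^*`
of pseudofunctoriality, Beck–Chevalley, and distributivity. -/
def extComp (F : Polynomial I J) (G : Polynomial J K) :
    extFunctor (comp F G) ⟶ extFunctor F ⋙ extFunctor G :=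
  let h := subH F G
  let k := subK F G
  let m := subM F G
  let r := subR F G
  let n := subN F G
  let p := subP F G
  let q := distQ (subK F G) G.f
  let ε := distE (subK F G) G.f
  let w := (distM (subK F G) G.f).hom
  let sq₁ : IsPullback h k F.t G.s := IsPullback.of_hasPullback _ _
  let sq₃ : IsPullback m r F.f h := IsPullback.of_hasPullback _ _
  let sq₄ : IsPullback n p r ε := IsPullback.of_hasPullback _ _
  let c₁ : Over.pullback (n ≫ m ≫ F.s) ⋙ push (p ≫ q) ⋙ Over.map (w ≫ G.t) ⟶
      Over.pullback F.s ⋙ Over.pullback m ⋙ Over.pullback n ⋙ push p ⋙ push q ⋙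
        Over.map w ⋙ Over.map G.t :=
    Functor.whiskerRight ((pullbackCompIso rfl).hom ≫
        Functor.whiskerRight (pullbackCompIso rfl).hom (Over.pullback n))
        (push (p ≫ q) ⋙ Over.map (w ≫ G.t)) ≫
      Functor.whiskerLeft (Over.pullback F.s ⋙ Over.pullback m ⋙ Over.pullback n)
        (Functor.whiskerRight (pushCompIso rfl).hom (Over.map (w ≫ G.t)) ≫
          Functor.whiskerLeft (push p ⋙ push q) (mapCompIso rfl).hom)
  let c₂ : (Over.pullback F.s ⋙ Over.pullback m) ⋙ (Over.pullback n ⋙ push p) ⋙ push q ⋙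
        Over.map w ⋙ Over.map G.t ⟶
      (Over.pullback F.s ⋙ Over.pullback m) ⋙ (push r ⋙ Over.pullback ε) ⋙ push q ⋙
        Over.map w ⋙ Over.map G.t :=
    Functor.whiskerLeft (Over.pullback F.s ⋙ Over.pullback m)
      (Functor.whiskerRight (beckChevalleyProd sq₄).hom (push q ⋙ Over.map w ⋙ Over.map G.t))
  let c₃ : Over.pullback F.s ⋙ (Over.pullback m ⋙ push r) ⋙ Over.pullback ε ⋙ push q ⋙
        Over.map w ⋙ Over.map G.t ⟶
      Over.pullback F.s ⋙ (push F.f ⋙ Over.pullback h) ⋙ Over.pullback ε ⋙ push q ⋙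
        Over.map w ⋙ Over.map G.t :=
    Functor.whiskerLeft (Over.pullback F.s)
      (Functor.whiskerRight (beckChevalleyProd sq₃).hom
        (Over.pullback ε ⋙ push q ⋙ Over.map w ⋙ Over.map G.t))
  let c₄ : (Over.pullback F.s ⋙ push F.f ⋙ Over.pullback h) ⋙
        (Over.pullback ε ⋙ push q ⋙ Over.map w) ⋙ Over.map G.t ⟶
      (Over.pullback F.s ⋙ push F.f ⋙ Over.pullback h) ⋙ (Over.map k ⋙ push G.f) ⋙
        Over.map G.t :=
    Functor.whiskerLeft (Over.pullback F.s ⋙ push F.f ⋙ Over.pullback h)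
      (Functor.whiskerRight (distributivity (subK F G) G.f) (Over.map G.t))
  let c₅ : (Over.pullback F.s ⋙ push F.f) ⋙ (Over.pullback h ⋙ Over.map k) ⋙ push G.f ⋙
        Over.map G.t ⟶
      (Over.pullback F.s ⋙ push F.f) ⋙ (Over.map F.t ⋙ Over.pullback G.s) ⋙ push G.f ⋙
        Over.map G.t :=
    Functor.whiskerLeft (Over.pullback F.s ⋙ push F.f)
      (Functor.whiskerRight (beckChevalleySum sq₁).hom (push G.f ⋙ Over.map G.t))
  c₁ ≫ c₂ ≫ c₃ ≫ c₄ ≫ c₅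

/-- The extension of a polynomial: the functor `Σ_t Π_f s^*` with its canonical strength. -/
def ext [CartesianMonoidalCategory E] (F : Polynomial I J) : StrongFunctor I J where
  functor := extFunctor F
  strength :=
    letI := compStrength (push F.f) (Over.map F.t)
    compStrength (Over.pullback F.s) (push F.f ⋙ Over.map F.t)

end Polynomial

/-- The 0-cells of the bicategory of polynomials: the objects of `E`. -/
structure Poly (E : Type u) where
  base : E

variable [HasPullbacks E] [LocallyCartesianClosed E]

instance : CategoryStruct (Poly E) where
  Hom I J := Polynomial I.base J.base
  id I := Polynomial.id I.base
  comp F G := Polynomial.comp F G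

instance (I J : Poly E) : Category (I ⟶ J) :=
  inferInstanceAs (Category (Polynomial I.base J.base))

variable [CartesianMonoidalCategory E]

/-- A polynomial functor: a strong functor isomorphic, by a strong natural isomorphism, to the
extension of some polynomial. -/
def StrongFunctor.IsPolynomial {I J : E} (F : StrongFunctor I J) : Prop :=
  ∃ P : Polynomial I J, Nonempty (P.ext ≅ F)

/-- Polynomial functors as a property of the 1-cells of `Slice E`. -/
@[simps] def polyFunProperty
    (hid : ∀ I : Slice E, StrongFunctor.IsPolynomial (𝟙 I))
    (hcomp : ∀ {I J K : Slice E} (F : I ⟶ J) (G : J ⟶ K),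
      StrongFunctor.IsPolynomial F → StrongFunctor.IsPolynomial G →
        StrongFunctor.IsPolynomial (F ≫ G)) : OneCellProperty (Slice E) where
  prop _ _ F := StrongFunctor.IsPolynomial F
  id_mem := hid
  comp_mem := hcomp

/-- The 2-category of slices of `E`, polynomial functors and strong natural transformations. -/
abbrev PolyFun
    (hid : ∀ I : Slice E, StrongFunctor.IsPolynomial (𝟙 I))
    (hcomp : ∀ {I J K : Slice E} (F : I ⟶ J) (G : J ⟶ K),
      StrongFunctor.IsPolynomial F → StrongFunctor.IsPolynomial G →
        StrongFunctor.IsPolynomial (F ≫ G)) : Type u :=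
  SubBicategory (polyFunProperty hid hcomp)

/-- The action of the extension pseudofunctor on 0-cells, `I ↦ E/I`, and on 1-cells. -/
@[simps] def extPrefunctor
    (hid : ∀ I : Slice E, StrongFunctor.IsPolynomial (𝟙 I))
    (hcomp : ∀ {I J K : Slice E} (F : I ⟶ J) (G : J ⟶ K),
      StrongFunctor.IsPolynomial F → StrongFunctor.IsPolynomial G →
        StrongFunctor.IsPolynomial (F ≫ G)) : Poly E ⥤q PolyFun hid hcomp where
  obj I := ⟨⟨I.base⟩⟩
  map F := ⟨Polynomial.ext F, F, ⟨Iso.refl _⟩⟩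

end Polynomials

end Main

end

end PolyLCC

/-!
The proof works with generalized elements. An element `e : W ⟶ P_F x` of the extension of
`F = (I ⟵ B ⟶ A ⟶ J)` has a base point `base F x` in `A` and, for each element `b` of the fibre of
`B` over it, a value `eval F x e b` in `x`; it is determined by these at all stages
(`Polynomial.ext_elem`), and any such family comes from an element (`Polynomial.mkElem`). Each
canonical transformation is computed on elements: a diagram sends the base point along `α` and
reindexes the values along `w` (`extNatTrans_base`, `eval_extNatTrans`), a strength pairs each value
with the parameter (`eval_strength`), `P_id ⟶ 1` evaluates an element at its base point
(`comp_extId`), and `P_{G ∘ F} ⟶ P_G P_F` curries (`eval_extComp`). These formulas give the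
functoriality of the extension on diagrams and the compatibility of all these transformations with
strengths. The transformation `P_{G ∘ F} ⟶ P_G P_F` is invertible because every factor is, the only
factor not given as an isomorphism being the distributivity transformation `Σ_w Π_q ε^* ⟶ Π_g Σ_k`,
which is shown to be bijective on generalized elements.

That the extension is full and faithful on diagrams is a Yoneda argument internal to `E`. For
`G = (I ⟵ D ⟶ C ⟶ J)`, the functor `P_G` has a generic element `gen G : C ⟶ P_G (D ⟶ I)`, whose
values are given by the identity of `D`. Every element of `P_G x` is obtained from it by
reindexing, strength and functoriality, so a strong transformation out of `P_G` is determined by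
the image of the generic element (`natTrans_ext_of_gen`). For a transformation `θ` to `P_F`, the
base point of that image is a map `α : C ⟶ A`, and its values are a map `w : C ×_A B ⟶ D`. Strength
makes `w` a map over `C`, so that `α` and `w` form a diagram, and this diagram induces `θ`
(`exists_diagram`).

The bicategory structure on polynomials is transported from that of polynomial functors. Since the
maps from classes of diagrams to strong transformations are bijective, whiskerings, associators and
unitors of polynomials can be taken to be the unique 2-cells whose images are those of the
2-category of polynomial functors, conjugated by the comparison isomorphisms. The axioms hold
because they hold for the images, and the extension is a pseudofunctor by construction
(`TransportData.bicategoryCompletion`, `TransportData.pseudofunctorCompletion`). It is essentially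
surjective on 1-cells by the definition of polynomial functors, and surjective on 0-cells.
-/

namespace PolyLCC

noncomputable section

/-! ### Transport of a bicategory structure along fully faithful functors -/

section Transport

universe w₁ w₂ v₁ v₂ u₁ u₂

open Bicategory

/-- Data for transporting a bicategory structure: a map of 0-cells and 1-cells to a bicategory
that is fully faithful on 2-cells and preserves identities and composition of 1-cells up to
isomorphism. -/
structure TransportData {B : Type u₁} [CategoryStruct.{v₁} B]
    [∀ a b : B, Category.{w₁} (a ⟶ b)] {C : Type u₂} [Bicategory.{w₂, v₂} C]
    (F : Prefunctor B C) where
  map₂ {a b : B} {f g : a ⟶ b} (η : f ⟶ g) : F.map f ⟶ F.map g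
  map₂_id {a b : B} (f : a ⟶ b) : map₂ (𝟙 f) = 𝟙 (F.map f)
  map₂_comp {a b : B} {f g h : a ⟶ b} (η : f ⟶ g) (θ : g ⟶ h) :
    map₂ (η ≫ θ) = map₂ η ≫ map₂ θ
  map₂_injective {a b : B} {f g : a ⟶ b} {η θ : f ⟶ g} (h : map₂ η = map₂ θ) : η = θ
  map₂_surjective {a b : B} {f g : a ⟶ b} (φ : F.map f ⟶ F.map g) : ∃ η : f ⟶ g, map₂ η = φ
  mapId (a : B) : F.map (𝟙 a) ≅ 𝟙 (F.obj a)
  mapComp {a b c : B} (f : a ⟶ b) (g : b ⟶ c) : F.map (f ≫ g) ≅ F.map f ≫ F.map g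

namespace TransportData

variable {B : Type u₁} [CategoryStruct.{v₁} B] [∀ a b : B, Category.{w₁} (a ⟶ b)] {C : Type u₂}
  [Bicategory.{w₂, v₂} C] {F : Prefunctor B C} (T : TransportData F)

attribute [simp] map₂_id map₂_comp

/-- The 2-cell with a given image. -/
def preimage {a b : B} {f g : a ⟶ b} (φ : F.map f ⟶ F.map g) : f ⟶ g :=
  (T.map₂_surjective φ).choose

@[simp] lemma map₂_preimage {a b : B} {f g : a ⟶ b} (φ : F.map f ⟶ F.map g) :
    T.map₂ (T.preimage φ) = φ :=
  (T.map₂_surjective φ).choose_spec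

/-- The invertible 2-cell with a given image. -/
@[simps] def preimageIso {a b : B} {f g : a ⟶ b} (φ : F.map f ≅ F.map g) : f ≅ g where
  hom := T.preimage φ.hom
  inv := T.preimage φ.inv
  hom_inv_id := T.map₂_injective (by simp)
  inv_hom_id := T.map₂_injective (by simp)

lemma whiskerLeft_mapComp {a b c : B} {d : C} (f : a ⟶ b) (g : b ⟶ c) {h h' : F.obj c ⟶ d}
    (η : h ⟶ h') : F.map (f ≫ g) ◁ η = (T.mapComp f g).hom ▷ h ≫ (α_ _ _ _).hom ≫
      F.map f ◁ F.map g ◁ η ≫ (α_ _ _ _).inv ≫ (T.mapComp f g).inv ▷ h' := by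
  have := whisker_exchange (T.mapComp f g).hom η
  rw [← cancel_mono ((T.mapComp f g).hom ▷ h'), this]
  simp

lemma whiskerRight_mapComp {a b c : B} {d : C} (f : a ⟶ b) (g : b ⟶ c) {h h' : d ⟶ F.obj a}
    (η : h ⟶ h') : η ▷ F.map (f ≫ g) = h ◁ (T.mapComp f g).hom ≫ (α_ _ _ _).inv ≫
      η ▷ F.map f ▷ F.map g ≫ (α_ _ _ _).hom ≫ h' ◁ (T.mapComp f g).inv := by
  have := whisker_exchange η (T.mapComp f g).hom
  rw [← cancel_mono (h' ◁ (T.mapComp f g).hom), ← this]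
  simp

lemma whiskerLeft_mapId {a : B} {d : C} {h h' : F.obj a ⟶ d}
    (η : h ⟶ h') : F.map (𝟙 a) ◁ η = (T.mapId a).hom ▷ h ≫ (λ_ _).hom ≫ η ≫ (λ_ _).inv ≫
      (T.mapId a).inv ▷ h' := by
  have := whisker_exchange (T.mapId a).hom η
  rw [← cancel_mono ((T.mapId a).hom ▷ h'), this]
  simp

lemma whiskerRight_mapId {a : B} {d : C} {h h' : d ⟶ F.obj a}
    (η : h ⟶ h') : η ▷ F.map (𝟙 a) = h ◁ (T.mapId a).hom ≫ (ρ_ _).hom ≫ η ≫ (ρ_ _).inv ≫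
      h' ◁ (T.mapId a).inv := by
  have := whisker_exchange η (T.mapId a).hom
  rw [← cancel_mono (h' ◁ (T.mapId a).hom), ← this]
  simp

/-- The transported bicategory structure: each 2-cell of the structure is the one whose image is
the corresponding 2-cell of the target, conjugated by the comparison isomorphisms. -/
def bicategoryCompletion : BicategoryCompletion.{w₁} B where
  whiskerLeft f g h η :=
    T.preimage ((T.mapComp f g).hom ≫ F.map f ◁ T.map₂ η ≫ (T.mapComp f h).inv)
  whiskerRight {_ _ _ f g} η h :=
    T.preimage ((T.mapComp f h).hom ≫ T.map₂ η ▷ F.map h ≫ (T.mapComp g h).inv)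
  associator f g h := T.preimageIso
    (T.mapComp (f ≫ g) h ≪≫ whiskerRightIso (T.mapComp f g) (F.map h) ≪≫ α_ _ _ _ ≪≫
      whiskerLeftIso (F.map f) (T.mapComp g h).symm ≪≫ (T.mapComp f (g ≫ h)).symm)
  leftUnitor {a _} f := T.preimageIso
    (T.mapComp (𝟙 a) f ≪≫ whiskerRightIso (T.mapId a) (F.map f) ≪≫ λ_ _)
  rightUnitor {_ b} f := T.preimageIso
    (T.mapComp f (𝟙 b) ≪≫ whiskerLeftIso (F.map f) (T.mapId b) ≪≫ ρ_ _)
  whiskerLeft_id f g := T.map₂_injective (by simp)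
  whiskerLeft_comp f _ _ _ η θ := T.map₂_injective (by simp)
  id_whiskerLeft η := T.map₂_injective (by simp [T.whiskerLeft_mapId])
  comp_whiskerLeft f g _ _ η := T.map₂_injective (by simp [T.whiskerLeft_mapComp])
  id_whiskerRight f g := T.map₂_injective (by simp)
  comp_whiskerRight η θ i := T.map₂_injective (by simp)
  whiskerRight_id η := T.map₂_injective (by simp [T.whiskerRight_mapId])
  whiskerRight_comp η g h := T.map₂_injective (by simp [T.whiskerRight_mapComp])
  whisker_assoc f _ _ η h := T.map₂_injective (by simp)
  whisker_exchange η θ := T.map₂_injective (by simp [whisker_exchange_assoc])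
  pentagon f g h i := T.map₂_injective (by
    simp [T.whiskerLeft_mapComp])
  triangle f g := T.map₂_injective (by simp)

/-- The map along which the structure is transported is a pseudofunctor. -/
def pseudofunctorCompletion :
    letI := T.bicategoryCompletion.toBicategory
    PseudofunctorCompletion F :=
  letI := T.bicategoryCompletion.toBicategory
  { map₂ := T.map₂
    map₂_id := T.map₂_id
    map₂_comp := T.map₂_comp
    mapId := T.mapId
    mapComp := T.mapComp
    map₂_whisker_left := fun f _ _ η => T.map₂_preimage _
    map₂_whisker_right := fun η h => T.map₂_preimage _
    map₂_associator := fun f g h => (T.map₂_preimage _).trans (by simp)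
    map₂_left_unitor := fun f => (T.map₂_preimage _).trans (by simp)
    map₂_right_unitor := fun f => (T.map₂_preimage _).trans (by simp) }

end TransportData

end Transport

open MonoidalCategory CartesianMonoidalCategory
open scoped MonoidalLeftAction

attribute [-simp] Over.pullback_obj_left Over.pullback_obj_hom Over.pullback_map_left

variable {E : Type u} [Category.{v} E]

/-! ### Generalized elements of pullbacks -/

lemma mapCompIso_hom_left {X Y Z : E} {f : X ⟶ Y} {g : Y ⟶ Z} {k : X ⟶ Z} (h : k = f ≫ g)
    (x : Over X) : ((mapCompIso h).hom.app x).left = 𝟙 x.left := by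
  simp [mapCompIso]

lemma mapCompIso_inv_left {X Y Z : E} {f : X ⟶ Y} {g : Y ⟶ Z} {k : X ⟶ Z} (h : k = f ≫ g)
    (x : Over X) : ((mapCompIso h).inv.app x).left = 𝟙 x.left := by
  subst h
  simp [mapCompIso]

section PullbackElements

variable [HasPullbacks E]

lemma comp_pbLift {B A : E} (f : B ⟶ A) (x : Over A) {W T : E} (t : T ⟶ W) (a : W ⟶ x.left)
    (b : W ⟶ B) (h : a ≫ x.hom = b ≫ f) :
    t ≫ pbLift f x a b h = pbLift f x (t ≫ a) (t ≫ b) (by simp [h]) := by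
  apply pb_ext
  · simp
  · simp

lemma pbLift_map {B A : E} (f : B ⟶ A) {x y : Over A} (φ : x ⟶ y) {W : E} (a : W ⟶ x.left)
    (b : W ⟶ B) (h : a ≫ x.hom = b ≫ f) :
    pbLift f x a b h ≫ ((Over.pullback f).map φ).left =
      pbLift f y (a ≫ φ.left) b (by simpa using h) := by
  apply pb_ext
  · simp
  · simp

lemma mapPullbackAdj_counit_left {B A : E} (f : B ⟶ A) (x : Over A) :
    ((Over.mapPullbackAdj f).counit.app x).left = pbFst f x := by
  simp [pbFst]

lemma pullbackCompIso_hom_pbFst {X Y Z : E} {f : X ⟶ Y} {g : Y ⟶ Z} {k : X ⟶ Z} (h : k = f ≫ g)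
    (z : Over Z) : ((pullbackCompIso h).hom.app z).left ≫ pbFst f _ ≫ pbFst g z = pbFst k z := by
  have := congrArg CommaMorphism.left (conjugateEquiv_counit (Over.mapPullbackAdj k)
    ((Over.mapPullbackAdj f).comp (Over.mapPullbackAdj g)) (mapCompIso h).symm.hom z)
  rw [Adjunction.comp_counit_app] at this
  replace this : ((pullbackCompIso h).hom.app z).left ≫
      ((Over.mapPullbackAdj f).counit.app ((Over.pullback g).obj z)).left ≫
        ((Over.mapPullbackAdj g).counit.app z).left =
      ((mapCompIso h).inv.app ((Over.pullback k).obj z)).left ≫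
        ((Over.mapPullbackAdj k).counit.app z).left := this
  rw [mapPullbackAdj_counit_left, mapPullbackAdj_counit_left, mapPullbackAdj_counit_left,
    mapCompIso_inv_left] at this
  exact this.trans (Category.id_comp _)

lemma pullbackCompIso_inv_pbFst {X Y Z : E} {f : X ⟶ Y} {g : Y ⟶ Z} {k : X ⟶ Z} (h : k = f ≫ g)
    (z : Over Z) : ((pullbackCompIso h).inv.app z).left ≫ pbFst k z = pbFst f _ ≫ pbFst g z := by
  rw [← pullbackCompIso_hom_pbFst h, ← Over.comp_left_assoc, Iso.inv_hom_id_app]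
  simp

lemma pullbackId_hom_left {I : E} (x : Over I) :
    (Over.pullbackId.hom.app x).left = pbFst (𝟙 I) x := by
  have := congrArg CommaMorphism.left (conjugateEquiv_counit (Over.mapPullbackAdj (𝟙 I))
    (Adjunction.id (C := Over I)) (Over.mapId I).symm.hom x)
  replace this : (Over.pullbackId.hom.app x).left ≫ 𝟙 _ =
      ((Over.mapId I).inv.app ((Over.pullback (𝟙 I)).obj x)).left ≫
        ((Over.mapPullbackAdj (𝟙 I)).counit.app x).left := this
  rw [mapPullbackAdj_counit_left, Category.comp_id] at this
  rw [this]
  simp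

end PullbackElements

/-! ### Generalized elements of dependent products -/

section DependentProducts

variable [HasPullbacks E] [LocallyCartesianClosed E]

section Application

variable {B A : E} (f : B ⟶ A)

/-- The application `e(b)` of a generalized element `e : W ⟶ Π_f y` to an element `b : W ⟶ B` of
the fibre over which `e` lies. -/
def pushApply (y : Over B) {W : E} (e : W ⟶ ((push f).obj y).left) (b : W ⟶ B)
    (h : e ≫ ((push f).obj y).hom = b ≫ f) : W ⟶ y.left :=
  pbLift f ((push f).obj y) e b h ≫ ((pullbackPushAdj f).counit.app y).left

variable {f}

@[simp] lemma pushApply_hom (y : Over B) {W : E} (e : W ⟶ ((push f).obj y).left) (b : W ⟶ B)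
    (h : e ≫ ((push f).obj y).hom = b ≫ f) : pushApply f y e b h ≫ y.hom = b := by
  have := Over.w ((pullbackPushAdj f).counit.app y)
  dsimp only [Functor.id_obj] at this
  rw [pushApply, Category.assoc, this]
  exact pbLift_hom _ _ _ _ _

@[simp] lemma pushApply_hom_assoc (y : Over B) {W : E} (e : W ⟶ ((push f).obj y).left)
    (b : W ⟶ B) (h : e ≫ ((push f).obj y).hom = b ≫ f) {Z : E} (g : B ⟶ Z) :
    pushApply f y e b h ≫ y.hom ≫ g = b ≫ g := by
  rw [← Category.assoc, pushApply_hom]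

lemma comp_pushApply (y : Over B) {W T : E} (t : T ⟶ W) (e : W ⟶ ((push f).obj y).left) (b : W ⟶ B)
    (h : e ≫ ((push f).obj y).hom = b ≫ f) :
    t ≫ pushApply f y e b h = pushApply f y (t ≫ e) (t ≫ b) (by simp [h]) := by
  rw [pushApply, ← Category.assoc, comp_pbLift, pushApply]

lemma pushApply_congr {y : Over B} {W : E} {e e' : W ⟶ ((push f).obj y).left} {b b' : W ⟶ B}
    {h : e ≫ ((push f).obj y).hom = b ≫ f} (he : e = e') (hb : b = b') :
    pushApply f y e b h = pushApply f y e' b' (by rw [← he, ← hb, h]) := by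
  subst he hb; rfl

lemma pushApply_map {y y' : Over B} (φ : y ⟶ y') {W : E} (e : W ⟶ ((push f).obj y).left)
    (b : W ⟶ B) (h : (e ≫ ((push f).map φ).left) ≫ ((push f).obj y').hom = b ≫ f) :
    pushApply f y' (e ≫ ((push f).map φ).left) b h =
      pushApply f y e b (by simpa using h) ≫ φ.left := by
  have := congrArg CommaMorphism.left ((pullbackPushAdj f).counit.naturality φ)
  dsimp only [Functor.comp_map, Functor.id_map, Functor.comp_obj, Functor.id_obj,
    Over.comp_left] at this
  rw [pushApply, pushApply, Category.assoc, ← this, ← Category.assoc, pbLift_map]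

/-- Application to a transpose is composition with the original map. -/
lemma pushApply_homEquiv {y : Over B} {z : Over A} (φ : (Over.pullback f).obj z ⟶ y) {W : E}
    (e : W ⟶ z.left) (b : W ⟶ B)
    (h : (e ≫ ((pullbackPushAdj f).homEquiv z y φ).left) ≫ ((push f).obj y).hom = b ≫ f) :
    pushApply f y (e ≫ ((pullbackPushAdj f).homEquiv z y φ).left) b h =
      pbLift f z e b (by simpa using h) ≫ φ.left := by
  have : φ = (Over.pullback f).map ((pullbackPushAdj f).homEquiv z y φ) ≫
      (pullbackPushAdj f).counit.app y :=
    ((pullbackPushAdj f).homEquiv_counit (X := z) (Y := y) (g := _)).symm.trans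
      (Equiv.symm_apply_apply _ _) |>.symm
  have h' : e ≫ z.hom = b ≫ f := by simpa using h
  have h2 : pbLift f z e b h' ≫ φ.left = _ := congrArg (fun φ => pbLift f z e b h' ≫ φ.left) this
  rw [h2, pushApply, Over.comp_left, ← Category.assoc, pbLift_map]

/-- The element of `Π_f y` given by a base point and a family over its fibre. -/
def pushMk {y : Over B} {W : E} (a : W ⟶ A)
    (φ : ((Over.pullback f).obj (Over.mk a)).left ⟶ y.left)
    (hφ : φ ≫ y.hom = ((Over.pullback f).obj (Over.mk a)).hom) : W ⟶ ((push f).obj y).left :=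
  ((pullbackPushAdj f).homEquiv (Over.mk a) y (Over.homMk φ hφ)).left

@[simp] lemma pushMk_hom {y : Over B} {W : E} (a : W ⟶ A)
    (φ : ((Over.pullback f).obj (Over.mk a)).left ⟶ y.left)
    (hφ : φ ≫ y.hom = ((Over.pullback f).obj (Over.mk a)).hom) :
    pushMk a φ hφ ≫ ((push f).obj y).hom = a :=
  Over.w ((pullbackPushAdj f).homEquiv (Over.mk a) y (Over.homMk φ hφ))

lemma pushApply_pushMk {y : Over B} {W T : E} (a : W ⟶ A)
    (φ : ((Over.pullback f).obj (Over.mk a)).left ⟶ y.left)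
    (hφ : φ ≫ y.hom = ((Over.pullback f).obj (Over.mk a)).hom) (t : T ⟶ W) (b : T ⟶ B)
    (h : (t ≫ pushMk a φ hφ) ≫ ((push f).obj y).hom = b ≫ f) :
    pushApply f y (t ≫ pushMk a φ hφ) b h =
      pbLift f (Over.mk a) t b (by simpa using h) ≫ φ :=
  pushApply_homEquiv (z := Over.mk a) (Over.homMk φ hφ) t b h

/-- Extensionality: an element of a dependent product is determined by its base point and its
values at all stages. -/
lemma push_ext {y : Over B} {W : E} {e e' : W ⟶ ((push f).obj y).left}
    (hb : e ≫ ((push f).obj y).hom = e' ≫ ((push f).obj y).hom)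
    (he : ∀ {T : E} (t : T ⟶ W) (b : T ⟶ B)
      (h : (t ≫ e) ≫ ((push f).obj y).hom = b ≫ f)
      (h' : (t ≫ e') ≫ ((push f).obj y).hom = b ≫ f),
      pushApply f y (t ≫ e) b h = pushApply f y (t ≫ e') b h') : e = e' := by
  obtain ⟨a, ha⟩ : ∃ a, a = e ≫ ((push f).obj y).hom := ⟨_, rfl⟩
  -- an element is recovered from its values at the generic point of the fibre over its base
  have key : ∀ (e : W ⟶ ((push f).obj y).left) (ha : a = e ≫ ((push f).obj y).hom),
      e = pushMk a (pushApply f y (pbFst f (Over.mk a) ≫ e) ((Over.pullback f).obj (Over.mk a)).hom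
        (by rw [Category.assoc, ← ha]; exact pbFst_w f (Over.mk a))) (by simp) := by
    intro e ha
    let e₁ : Over.mk a ⟶ (push f).obj y := Over.homMk e ha.symm
    change e₁.left = _
    rw [pushMk, ← Equiv.apply_symm_apply ((pullbackPushAdj f).homEquiv (Over.mk a) y) e₁]
    congr 2
  rw [key e ha, key e' (ha.trans hb)]
  congr 1
  exact he _ _ _ _

/-- The unit `z ⟶ Π_f f^* z` sends an element to the constant family. -/
lemma pushApply_unit {z : Over A} {W : E} (e : W ⟶ z.left) (b : W ⟶ B)
    (h : (e ≫ ((pullbackPushAdj f).unit.app z).left) ≫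
      ((push f).obj ((Over.pullback f).obj z)).hom = b ≫ f) :
    pushApply f _ (e ≫ ((pullbackPushAdj f).unit.app z).left) b h =
      pbLift f z e b (by
        have := Over.w ((pullbackPushAdj f).unit.app z)
        dsimp only [Functor.id_obj, Functor.comp_obj] at this
        rw [← h, Category.assoc, this]) := by
  have := pushApply_homEquiv (𝟙 ((Over.pullback f).obj z)) e b
  simp only [Adjunction.homEquiv_id] at this
  rw [this h]
  simp

end Application

section Canonical

/-- Under `Π_{gf} ≅ Π_g Π_f`, application at `b` is application at `f(b)` followed by application
at `b`. -/
lemma pushApply_pushCompIso_hom {X Y Z : E} {f : X ⟶ Y} {g : Y ⟶ Z} {k : X ⟶ Z} (hk : k = f ≫ g)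
    (x : Over X) {W : E} (e : W ⟶ ((push k).obj x).left) (b : W ⟶ X)
    (h : (e ≫ ((pushCompIso hk).hom.app x).left) ≫ ((push g).obj ((push f).obj x)).hom =
      (b ≫ f) ≫ g) (h' h'') :
    pushApply f x (pushApply g _ (e ≫ ((pushCompIso hk).hom.app x).left) (b ≫ f) h) b h' =
      pushApply k x e b h'' := by
  have := congrArg CommaMorphism.left (conjugateEquiv_counit (pullbackPushAdj k)
    ((pullbackPushAdj g).comp (pullbackPushAdj f)) (pullbackCompIso hk).symm.hom x)
  have h1 : (e ≫ ((push k).obj x).hom) = (b ≫ f) ≫ g := by rw [h'', hk, Category.assoc]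
  rw [Adjunction.comp_counit_app] at this
  replace this : ((Over.pullback f).map ((Over.pullback g).map ((pushCompIso hk).hom.app x))).left ≫
      ((Over.pullback f).map ((pullbackPushAdj g).counit.app ((push f).obj x))).left ≫
        ((pullbackPushAdj f).counit.app x).left =
      ((pullbackCompIso hk).inv.app ((push k).obj x)).left ≫
        ((pullbackPushAdj k).counit.app x).left := this
  have h2 := congrArg (pbLift f _ (pbLift g ((push k).obj x) e (b ≫ f) h1) b
    (pbLift_hom _ _ _ _ _) ≫ ·) this
  rw [← Category.assoc, pbLift_map, ← Category.assoc, pbLift_map] at h2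
  refine (Eq.trans ?_ h2).trans ?_
  · rw [pushApply]
    congr 1
    apply pb_ext
    · refine (pbLift_pbFst _ _ _ _ _).trans (Eq.trans ?_ (pbLift_pbFst _ _ _ _ _).symm)
      rw [pushApply, pbLift_map]
      rfl
    · exact (pbLift_hom _ _ _ _ _).trans (pbLift_hom _ _ _ _ _).symm
  rw [pushApply, ← Category.assoc]
  congr 1
  apply pb_ext
  · rw [Category.assoc, pullbackCompIso_inv_pbFst]; simp
  · simp

lemma pushApply_pushCompIso_inv {X Y Z : E} {f : X ⟶ Y} {g : Y ⟶ Z} {k : X ⟶ Z} (hk : k = f ≫ g)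
    (x : Over X) {W : E} (e : W ⟶ ((push g).obj ((push f).obj x)).left) (b : W ⟶ X)
    (h : (e ≫ ((pushCompIso hk).inv.app x).left) ≫ ((push k).obj x).hom = b ≫ k) (h' h'') :
    pushApply k x (e ≫ ((pushCompIso hk).inv.app x).left) b h =
      pushApply f x (pushApply g _ e (b ≫ f) h') b h'' := by
  have he : (e ≫ ((pushCompIso hk).inv.app x).left) ≫ ((pushCompIso hk).hom.app x).left = e := by
    rw [Category.assoc, ← Over.comp_left, Iso.inv_hom_id_app]; simp
  rw [← pushApply_pushCompIso_hom hk x (e ≫ ((pushCompIso hk).inv.app x).left) b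
    (by rw [he, h']) (by simp)]
  exact pushApply_congr (pushApply_congr he rfl) rfl

/-- Under `Π_id ≅ Id`, an element goes to its application at its own base point. -/
lemma pushIdIso_hom_left {I : E} (x : Over I) :
    ((pushIdIso I).hom.app x).left =
      pushApply (𝟙 I) x (𝟙 _) ((push (𝟙 I)).obj x).hom (by simp) := by
  have := congrArg CommaMorphism.left (conjugateEquiv_counit (pullbackPushAdj (𝟙 I))
    Adjunction.id (Over.pullbackId (X := I)).symm.hom x)
  replace this : ((pushIdIso I).hom.app x).left ≫ 𝟙 _ =
      (Over.pullbackId.inv.app ((push (𝟙 I)).obj x)).left ≫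
        ((pullbackPushAdj (𝟙 I)).counit.app x).left := this
  rw [Category.comp_id] at this
  rw [this, pushApply]
  congr 1
  have h := congrArg CommaMorphism.left
    (Iso.inv_hom_id_app (Over.pullbackId (X := I)) ((push (𝟙 I)).obj x))
  replace h : (Over.pullbackId.inv.app ((push (𝟙 I)).obj x)).left ≫
      (Over.pullbackId.hom.app ((push (𝟙 I)).obj x)).left = 𝟙 _ := h
  rw [pullbackId_hom_left] at h
  apply pb_ext
  · simpa using h
  · simp

/-- The dependent product Beck–Chevalley isomorphism is reindexing of the argument along the
cartesian square. -/
lemma pushApply_beckChevalleyProd {P B C A : E} {β : P ⟶ B} {p : P ⟶ C} {f : B ⟶ A} {α : C ⟶ A}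
    (sq : IsPullback β p f α) (z : Over B) {W : E}
    (e : W ⟶ ((push p).obj ((Over.pullback β).obj z)).left) (b : W ⟶ B)
    (h : (e ≫ ((beckChevalleyProd sq).hom.app z).left ≫ pbFst α _) ≫ ((push f).obj z).hom = b ≫ f)
    (h' : b ≫ f = (e ≫ ((push p).obj _).hom) ≫ α) :
    pushApply f z (e ≫ ((beckChevalleyProd sq).hom.app z).left ≫ pbFst α _) b h =
      pushApply p _ e (sq.lift b (e ≫ ((push p).obj _).hom) h') (by simp) ≫ pbFst β z := by
  have := congrArg CommaMorphism.left (conjugateEquiv_counit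
    ((pullbackPushAdj p).comp (Over.mapPullbackAdj β))
    ((Over.mapPullbackAdj α).comp (pullbackPushAdj f)) (beckChevalleySum sq.flip).symm.hom z)
  rw [Adjunction.comp_counit_app, Adjunction.comp_counit_app] at this
  replace this : ((Over.pullback f).map ((Over.map α).map ((beckChevalleyProd sq).hom.app z))).left ≫
      ((Over.pullback f).map ((Over.mapPullbackAdj α).counit.app ((push f).obj z))).left ≫
        ((pullbackPushAdj f).counit.app z).left =
      ((beckChevalleySum sq.flip).inv.app ((push p).obj ((Over.pullback β).obj z))).left ≫
        ((pullbackPushAdj p).counit.app ((Over.pullback β).obj z)).left ≫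
          ((Over.mapPullbackAdj β).counit.app z).left := this
  have h2 := congrArg (pbLift f ((Over.map α).obj ((push p).obj ((Over.pullback β).obj z)))
    e b (by simpa using h'.symm) ≫ ·) this
  rw [← Category.assoc, pbLift_map, ← Category.assoc, pbLift_map] at h2
  refine (Eq.trans ?_ h2).trans ?_
  · rw [pushApply]
    congr 1
    apply pb_ext
    · refine (pbLift_pbFst _ _ _ _ _).trans (Eq.trans ?_ (pbLift_pbFst _ _ _ _ _).symm)
      rw [mapPullbackAdj_counit_left, Category.assoc]
      rfl
    · exact (pbLift_hom _ _ _ _ _).trans (pbLift_hom _ _ _ _ _).symm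
  · rw [pushApply, mapPullbackAdj_counit_left, ← Category.assoc, ← Category.assoc]
    congr 2
    apply pb_ext
    · simp [beckChevalleySum]
    · simp only [beckChevalleySum, NatIso.ofComponents_inv_app, Over.isoMk_inv_left,
        Category.assoc, pbLift_hom]
      apply sq.hom_ext <;> simp

section Distributivity

variable {X D C : E} (k : X ⟶ D) (g : D ⟶ C)

/-- The counit component `ε : D' ⟶ X` is application of an element of `M = Π_g k`. -/
lemma pbLift_distE_comp {W : E} (m : W ⟶ (distM k g).left) (d : W ⟶ D)
    (h : m ≫ (distM k g).hom = d ≫ g) : pbLift g (distM k g) m d h ≫ distE k g =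
      pushApply g (Over.mk k) m d h := rfl

@[simp] lemma pbLift_distQ {W : E} (m : W ⟶ (distM k g).left) (d : W ⟶ D)
    (h : m ≫ (distM k g).hom = d ≫ g) : pbLift g (distM k g) m d h ≫ distQ k g = m :=
  pbLift_pbFst _ _ _ _ _

/-- Distributivity turns an element `e` of `Π_q ε^* y` over `m` into the function sending `d` to
`e(m, d)`. -/
lemma pushApply_distributivity (y : Over X) {W : E}
    (e : W ⟶ ((push (distQ k g)).obj ((Over.pullback (distE k g)).obj y)).left) (d : W ⟶ D)
    (h : (e ≫ ((distributivity k g).app y).left) ≫ ((push g).obj ((Over.map k).obj y)).hom = d ≫ g)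
    (h' : (e ≫ ((push (distQ k g)).obj _).hom) ≫ (distM k g).hom = d ≫ g) :
    pushApply g ((Over.map k).obj y) (e ≫ ((distributivity k g).app y).left) d h =
      pushApply (distQ k g) _ e
        (pbLift g (distM k g) (e ≫ ((push (distQ k g)).obj _).hom) d h') (by simp) ≫
          pbFst (distE k g) y := by
  have h1 := pushApply_homEquiv ((distTranspose k g).app y) e d
  simp only [Adjunction.homEquiv_unit] at h1
  refine (h1 h).trans ?_
  rw [pushApply]
  have h2 : ((distTranspose k g).app y).left =
      ((beckChevalleySum (dist_isPullback k g)).inv.app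
        ((push (distQ k g)).obj ((Over.pullback (distE k g)).obj y))).left ≫
      ((pullbackPushAdj (distQ k g)).counit.app ((Over.pullback (distE k g)).obj y)).left ≫
      ((mapCompIso (distE_w k g)).hom.app ((Over.pullback (distE k g)).obj y)).left ≫
      ((Over.mapPullbackAdj (distE k g)).counit.app y).left := rfl
  rw [h2, mapCompIso_hom_left, mapPullbackAdj_counit_left]
  simp only [← Category.assoc]
  congr 1
  refine (Category.comp_id _).trans ?_
  congr 1
  apply pb_ext
  · simp [beckChevalleySum]
  · simp only [beckChevalleySum, NatIso.ofComponents_inv_app, Over.isoMk_inv_left,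
      Category.assoc, pbLift_hom]
    apply (dist_isPullback k g).hom_ext <;> simp

end Distributivity

end Canonical

end DependentProducts

/-! ### Invertibility of distributivity -/

section DistributivityIso

variable [HasPullbacks E] [LocallyCartesianClosed E] {X D C : E} (k : X ⟶ D) (g : D ⟶ C)

@[simp] lemma distributivity_app_hom (y : Over X) :
    ((distributivity k g).app y).left ≫ ((push g).obj ((Over.map k).obj y)).hom =
      ((push (distQ k g)).obj ((Over.pullback (distE k g)).obj y)).hom ≫ (distM k g).hom :=
  Over.w ((distributivity k g).app y)

/-- The instance of `push_ext` for `M = Π_g k`, with application written in terms of `ε`. -/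
lemma distM_ext {W : E} {m m' : W ⟶ (distM k g).left}
    (hw : m ≫ (distM k g).hom = m' ≫ (distM k g).hom)
    (he : ∀ {T : E} (t : T ⟶ W) (d : T ⟶ D) (h : (t ≫ m) ≫ (distM k g).hom = d ≫ g)
      (h' : (t ≫ m') ≫ (distM k g).hom = d ≫ g),
      pbLift g (distM k g) (t ≫ m) d h ≫ distE k g =
        pbLift g (distM k g) (t ≫ m') d h' ≫ distE k g) : m = m' :=
  push_ext hw he

/-- The base point in `M` of an element of `Π_q ε^* y` can be read off from its image under
distributivity. -/
lemma pbLift_base_distE (y : Over X) {W : E}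
    (e : W ⟶ ((push (distQ k g)).obj ((Over.pullback (distE k g)).obj y)).left) (d : W ⟶ D)
    (h : (e ≫ ((distributivity k g).app y).left) ≫ ((push g).obj ((Over.map k).obj y)).hom = d ≫ g)
    (h' : (e ≫ ((push (distQ k g)).obj ((Over.pullback (distE k g)).obj y)).hom) ≫
      (distM k g).hom = d ≫ g) :
    pbLift g (distM k g) (e ≫ ((push (distQ k g)).obj _).hom) d h' ≫ distE k g =
      pushApply g ((Over.map k).obj y) (e ≫ ((distributivity k g).app y).left) d h ≫ y.hom := by
  rw [pushApply_distributivity k g y e d h h', Category.assoc, pbFst_w, pushApply_hom_assoc]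

lemma distributivity_app_injective (y : Over X) {W : E}
    {e e' : W ⟶ ((push (distQ k g)).obj ((Over.pullback (distE k g)).obj y)).left}
    (he : e ≫ ((distributivity k g).app y).left = e' ≫ ((distributivity k g).app y).left) :
    e = e' := by
  have hw : (e ≫ ((push (distQ k g)).obj ((Over.pullback (distE k g)).obj y)).hom) ≫
      (distM k g).hom =
      (e' ≫ ((push (distQ k g)).obj ((Over.pullback (distE k g)).obj y)).hom) ≫
        (distM k g).hom := by
    simp only [Category.assoc, ← distributivity_app_hom]
    rw [reassoc_of% he]
  have hm : e ≫ ((push (distQ k g)).obj ((Over.pullback (distE k g)).obj y)).hom =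
      e' ≫ ((push (distQ k g)).obj ((Over.pullback (distE k g)).obj y)).hom := by
    refine distM_ext k g hw ?_
    intro T t d h h'
    simp only [← Category.assoc t] at h h' ⊢
    have h₁ : ((t ≫ e) ≫ ((distributivity k g).app y).left) ≫
        ((push g).obj ((Over.map k).obj y)).hom = d ≫ g := by
      rw [Category.assoc (t ≫ e), distributivity_app_hom, ← h, Category.assoc (t ≫ e)]
    have h₂ : ((t ≫ e') ≫ ((distributivity k g).app y).left) ≫
        ((push g).obj ((Over.map k).obj y)).hom = d ≫ g := by
      rw [Category.assoc (t ≫ e'), distributivity_app_hom, ← h', Category.assoc (t ≫ e')]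
    rw [pbLift_base_distE k g y (t ≫ e) d h₁ h, pbLift_base_distE k g y (t ≫ e') d h₂ h']
    congr 1
    exact pushApply_congr (by rw [Category.assoc, he, Category.assoc]) rfl
  refine push_ext hm ?_
  intro T t b h h'
  obtain ⟨d, hd⟩ : ∃ d, d = b ≫ ((Over.pullback g).obj (distM k g)).hom := ⟨_, rfl⟩
  have hc := (dist_isPullback k g).w
  have hb : ((t ≫ e) ≫ ((push (distQ k g)).obj ((Over.pullback (distE k g)).obj y)).hom) ≫
      (distM k g).hom = d ≫ g := by rw [h, hd, Category.assoc, Category.assoc, hc]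
  have hb' : ((t ≫ e') ≫ ((push (distQ k g)).obj ((Over.pullback (distE k g)).obj y)).hom) ≫
      (distM k g).hom = d ≫ g := by rw [h', hd, Category.assoc, Category.assoc, hc]
  have b₁ : b = pbLift g (distM k g) ((t ≫ e) ≫
      ((push (distQ k g)).obj ((Over.pullback (distE k g)).obj y)).hom) d hb := by
    apply pb_ext
    · rw [pbLift_pbFst, h]; rfl
    · rw [pbLift_hom, hd]
  have b₂ : b = pbLift g (distM k g) ((t ≫ e') ≫
      ((push (distQ k g)).obj ((Over.pullback (distE k g)).obj y)).hom) d hb' := by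
    apply pb_ext
    · rw [pbLift_pbFst, h']; rfl
    · rw [pbLift_hom, hd]
  apply pb_ext
  · rw [pushApply_congr rfl b₁, ← pushApply_distributivity k g y (t ≫ e) d (by simpa using hb),
      pushApply_congr (h := h') rfl b₂,
      ← pushApply_distributivity k g y (t ≫ e') d (by simpa using hb')]
    exact pushApply_congr (by rw [Category.assoc, he, Category.assoc]) rfl
  · rw [pushApply_hom, pushApply_hom]

lemma distributivity_app_surjective (y : Over X) {W : E}
    (e : W ⟶ ((push g).obj ((Over.map k).obj y)).left) :
    ∃ e', e' ≫ ((distributivity k g).app y).left = e := by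
  obtain ⟨a, ha⟩ : ∃ a, a = e ≫ ((push g).obj ((Over.map k).obj y)).hom := ⟨_, rfl⟩
  let φ : ((Over.pullback g).obj (Over.mk a)).left ⟶ y.left :=
    pushApply g ((Over.map k).obj y) (pbFst g (Over.mk a) ≫ e)
      ((Over.pullback g).obj (Over.mk a)).hom
      (by rw [Category.assoc, ← ha]; exact pbFst_w g (Over.mk a))
  have hφ : φ ≫ y.hom ≫ k = ((Over.pullback g).obj (Over.mk a)).hom :=
    pushApply_hom ((Over.map k).obj y) _ _ _
  -- the section of `k` underlying the family `φ`, and over it the family `φ` itself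
  let m : W ⟶ (distM k g).left := pushMk (f := g) (y := Over.mk k) a (φ ≫ y.hom) (by simpa using hφ)
  have hm : m ≫ (distM k g).hom = a := pushMk_hom _ _ _
  let q := distQ k g
  let t := pbFst q (Over.mk m)
  let b := ((Over.pullback q).obj (Over.mk m)).hom
  have htb : t ≫ m = b ≫ q := pbFst_w q (Over.mk m)
  let d := b ≫ ((Over.pullback g).obj (distM k g)).hom
  have htd : t ≫ a = d ≫ g := by
    rw [← hm, reassoc_of% htb]
    simp only [d, q, Category.assoc, (dist_isPullback k g).w]
  have hφt : pbLift g (Over.mk a) t d htd ≫ φ =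
      pushApply g ((Over.map k).obj y) (t ≫ e) d (by rw [Category.assoc, ← ha, htd]) := by
    simp only [φ]
    rw [comp_pushApply]
    exact pushApply_congr (by simp) (pbLift_hom _ _ _ _ _)
  have hbε : b ≫ distE k g = pbLift g (Over.mk a) t d htd ≫ φ ≫ y.hom := by
    have hb : b = pbLift g (distM k g) (t ≫ m) d (by rw [Category.assoc, hm, htd]) := by
      apply pb_ext
      · rw [pbLift_pbFst, htb]; rfl
      · rw [pbLift_hom]
    rw [hb, pbLift_distE_comp]
    exact pushApply_pushMk _ _ _ _ _ _
  let e' : W ⟶ ((push q).obj ((Over.pullback (distE k g)).obj y)).left :=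
    pushMk m (pbLift (distE k g) y (pbLift g (Over.mk a) t d htd ≫ φ) b (by
      rw [Category.assoc, hbε])) (by simp [b])
  have he' : e' ≫ ((push q).obj ((Over.pullback (distE k g)).obj y)).hom = m := pushMk_hom _ _ _
  refine ⟨e', push_ext ?_ ?_⟩
  · rw [Category.assoc, distributivity_app_hom, reassoc_of% he', hm, ha]
  · intro T s b' h h'
    have h₁ : ((s ≫ e') ≫ ((push q).obj ((Over.pullback (distE k g)).obj y)).hom) ≫
        (distM k g).hom = b' ≫ g := by
      have := s ≫= he'
      rw [← Category.assoc] at this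
      refine (congrArg (· ≫ _) this).trans ?_
      rw [Category.assoc, hm, ha, ← h', Category.assoc]
    rw [pushApply_congr (Category.assoc _ _ _).symm rfl, pushApply_distributivity k g y _ _ _ h₁,
      pushApply_pushMk, Category.assoc, pbLift_pbFst]
    refine (congrArg _ hφt).trans ?_
    rw [comp_pushApply]
    refine pushApply_congr ?_ ?_
    · rw [← Category.assoc]; congr 1; exact pbLift_pbFst _ _ _ _ _
    · simp only [d, b]
      rw [← Category.assoc]
      exact (congrArg (· ≫ _) (pbLift_hom _ _ _ _ _)).trans (pbLift_hom _ _ _ _ _)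

/-- The distributivity transformation is invertible: a family of elements of `y` over `d ∈ D` is a
section of `k` together with a family of elements of `y` over the values of that section. -/
instance : IsIso (distributivity k g) := by
  have (y : Over X) : IsIso ((distributivity k g).app y) := by
    have : IsIso ((Over.forget _).map ((distributivity k g).app y)) :=
      isIso_of_yoneda_map_bijective _ fun _ =>
        ⟨fun _ _ h => distributivity_app_injective k g y h,
          fun e => distributivity_app_surjective k g y e⟩
    exact isIso_of_reflects_iso _ (Over.forget _)
  exact NatIso.isIso_of_isIso_app _

end DistributivityIso

/-! ### Strengths on generalized elements -/

section Strength

variable [CartesianMonoidalCategory E] [HasPullbacks E]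

lemma pullback_strength_inv_left {B A : E} (f : B ⟶ A) (K : E) (x : Over A) :
    (Functor.OplaxLeftLinear.δₗ (Over.pullback f) K x).left =
      lift (pbFst f (K ⊙ₗ x) ≫ fst K x.left)
        (pbLift f x (pbFst f (K ⊙ₗ x) ≫ snd K x.left) ((Over.pullback f).obj (K ⊙ₗ x)).hom
          (by simpa using pbFst_w f (K ⊙ₗ x))) := rfl

variable [LocallyCartesianClosed E]

lemma pushStrength_left_hom {B A : E} (f : B ⟶ A) (K : E) (y : Over B) :
    (Functor.LaxLeftLinear.μₗ (push f) K y).left ≫ ((push f).obj (K ⊙ₗ y)).hom =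
      snd K _ ≫ ((push f).obj y).hom :=
  Over.w (Functor.LaxLeftLinear.μₗ (push f) K y)

/-- The strength of `Π_f` pairs the value of a function with the parameter. -/
lemma pushApply_pushStrength {B A : E} (f : B ⟶ A) (K : E) (y : Over B) {W : E}
    (e : W ⟶ K ⊗ ((push f).obj y).left) (b : W ⟶ B)
    (h : (e ≫ (Functor.LaxLeftLinear.μₗ (push f) K y).left) ≫
      ((push f).obj (K ⊙ₗ y)).hom = b ≫ f)
    (h' : (e ≫ snd _ _) ≫ ((push f).obj y).hom = b ≫ f) :
    pushApply f (K ⊙ₗ y) (e ≫ (Functor.LaxLeftLinear.μₗ (push f) K y).left) b h =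
      lift (e ≫ fst _ _) (pushApply f y (e ≫ snd _ _) b h') := by
  refine (pushApply_homEquiv (f := f) (y := K ⊙ₗ y) (z := K ⊙ₗ (push f).obj y) _ e b h).trans ?_
  apply CartesianMonoidalCategory.hom_ext
  · simp [pullback_strength_inv_left]
  · simp only [pullback_strength_inv_left, Over.comp_left, actionHomRight_left, Category.assoc,
      whiskerLeft_snd, lift_snd_assoc, lift_snd, pushApply]
    rw [← Category.assoc]
    congr 1
    apply pb_ext
    · simp
    · simp

end Strength

/-! ### Generalized elements of the extension of a polynomial -/

namespace Polynomial

section Extension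

variable [HasPullbacks E] [LocallyCartesianClosed E] {I J K : E}

/-- The base point in `A` of an element of `P_F x`. -/
def base (F : Polynomial I J) (x : Over I) : ((extFunctor F).obj x).left ⟶ F.A :=
  ((push F.f).obj ((Over.pullback F.s).obj x)).hom

lemma extFunctor_obj_hom (F : Polynomial I J) (x : Over I) :
    ((extFunctor F).obj x).hom = base F x ≫ F.t := rfl

/-- The value in `x` of an element `e` of `P_F x` at an element `b` of its fibre. -/
def eval (F : Polynomial I J) (x : Over I) {W : E} (e : W ⟶ ((extFunctor F).obj x).left)
    (b : W ⟶ F.B) (h : e ≫ base F x = b ≫ F.f) : W ⟶ x.left :=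
  pushApply F.f ((Over.pullback F.s).obj x) e b h ≫ pbFst F.s x

variable {F : Polynomial I J} {x : Over I}

lemma eval_hom {W : E} (e : W ⟶ ((extFunctor F).obj x).left)
    (b : W ⟶ F.B) (h : e ≫ base F x = b ≫ F.f) : eval F x e b h ≫ x.hom = b ≫ F.s := by
  rw [eval, Category.assoc, pbFst_w]
  exact pushApply_hom_assoc _ _ _ _ _

lemma eval_congr {W : E} {e e' : W ⟶ ((extFunctor F).obj x).left} {b b' : W ⟶ F.B}
    {h : e ≫ base F x = b ≫ F.f} (he : e = e') (hb : b = b') :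
    eval F x e b h = eval F x e' b' (by rw [← he, ← hb, h]) := by
  subst he hb; rfl

lemma comp_eval {W T : E} (t : T ⟶ W) (e : W ⟶ ((extFunctor F).obj x).left)
    (b : W ⟶ F.B) (h : e ≫ base F x = b ≫ F.f) :
    t ≫ eval F x e b h = eval F x (t ≫ e) (t ≫ b) (by simp [h]) := by
  rw [eval, ← Category.assoc]
  exact congrArg (· ≫ pbFst F.s x) (comp_pushApply (f := F.f) ((Over.pullback F.s).obj x) t e b h)

/-- An element of `P_F x` is determined by its base point and its values at all stages. -/
lemma ext_elem {W : E} {e e' : W ⟶ ((extFunctor F).obj x).left}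
    (hb : e ≫ base F x = e' ≫ base F x)
    (he : ∀ {T : E} (t : T ⟶ W) (b : T ⟶ F.B) (h : (t ≫ e) ≫ base F x = b ≫ F.f)
      (h' : (t ≫ e') ≫ base F x = b ≫ F.f), eval F x (t ≫ e) b h = eval F x (t ≫ e') b h') :
    e = e' := by
  refine push_ext hb ?_
  intro T t b h h'
  apply pb_ext
  · exact he t b h h'
  · rw [pushApply_hom, pushApply_hom]

/-- The element of `P_F x` with base point `a` and values `φ`. -/
def mkElem {W : E} (a : W ⟶ F.A) (φ : ((Over.pullback F.f).obj (Over.mk a)).left ⟶ x.left)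
    (hφ : φ ≫ x.hom = ((Over.pullback F.f).obj (Over.mk a)).hom ≫ F.s) :
    W ⟶ ((extFunctor F).obj x).left :=
  pushMk (f := F.f) (y := (Over.pullback F.s).obj x) a
    (pbLift F.s x φ ((Over.pullback F.f).obj (Over.mk a)).hom hφ) (by simp)

lemma mkElem_base {W : E} (a : W ⟶ F.A)
    (φ : ((Over.pullback F.f).obj (Over.mk a)).left ⟶ x.left)
    (hφ : φ ≫ x.hom = ((Over.pullback F.f).obj (Over.mk a)).hom ≫ F.s) :
    mkElem a φ hφ ≫ base F x = a := pushMk_hom _ _ _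

lemma eval_mkElem {W T : E} (a : W ⟶ F.A)
    (φ : ((Over.pullback F.f).obj (Over.mk a)).left ⟶ x.left)
    (hφ : φ ≫ x.hom = ((Over.pullback F.f).obj (Over.mk a)).hom ≫ F.s) (t : T ⟶ W) (b : T ⟶ F.B)
    (h : (t ≫ mkElem a φ hφ) ≫ base F x = b ≫ F.f)
    (h' : t ≫ a = b ≫ F.f) :
    eval F x (t ≫ mkElem a φ hφ) b h = pbLift F.f (Over.mk a) t b h' ≫ φ := by
  refine (congrArg (· ≫ pbFst F.s x) (pushApply_pushMk a _ _ t b h)).trans ?_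
  simp

lemma extFunctor_map_base {y : Over I} (φ : x ⟶ y) :
    ((extFunctor F).map φ).left ≫ base F y = base F x :=
  Over.w ((push F.f).map ((Over.pullback F.s).map φ))

lemma eval_map {y : Over I} (φ : x ⟶ y) {W : E} (e : W ⟶ ((extFunctor F).obj x).left)
    (b : W ⟶ F.B) (h : (e ≫ ((extFunctor F).map φ).left) ≫ base F y = b ≫ F.f)
    (h' : e ≫ base F x = b ≫ F.f) :
    eval F y (e ≫ ((extFunctor F).map φ).left) b h = eval F x e b h' ≫ φ.left := by
  refine (congrArg (· ≫ pbFst F.s y)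
    (pushApply_map (f := F.f) ((Over.pullback F.s).map φ) e b h)).trans ?_
  rw [eval, Category.assoc, Category.assoc]
  exact congrArg (_ ≫ ·) (pullback_map_pbFst F.s φ)

section Diagram

variable {G : Polynomial I J} (d : Diagram G F)

lemma extNatTrans_app_left (x : Over I) : (d.extNatTrans.app x).left =
    ((push G.f).map ((pullbackPushAdj d.w).unit.app ((Over.pullback G.s).obj x))).left ≫
    ((push G.f).map ((push d.w).map ((pullbackCompIso rfl).inv.app x ≫
      (pullbackCompIso d.w_s).hom.app x))).left ≫
    ((pushCompIso (f := d.w) (g := G.f) rfl).inv.app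
      ((Over.pullback d.β).obj ((Over.pullback F.s).obj x))).left ≫
    ((beckChevalleyProd d.isPullback).hom.app ((Over.pullback F.s).obj x)).left ≫
    pbFst d.α ((push F.f).obj ((Over.pullback F.s).obj x)) := by
  have h : (d.extNatTrans.app x).left =
    ((push G.f).map ((pullbackPushAdj d.w).unit.app ((Over.pullback G.s).obj x))).left ≫
    (((push G.f).map ((push d.w).map ((pullbackCompIso rfl).inv.app x ≫
      (pullbackCompIso d.w_s).hom.app x))).left ≫
    ((pushCompIso (f := d.w) (g := G.f) rfl).inv.app
      ((Over.pullback d.β).obj ((Over.pullback F.s).obj x))).left) ≫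
    (((beckChevalleyProd d.isPullback).hom.app ((Over.pullback F.s).obj x)).left ≫
    ((mapCompIso d.α_t.symm).hom.app ((push F.f ⋙ Over.pullback d.α).obj
      ((Over.pullback F.s).obj x))).left) ≫
    ((Over.mapPullbackAdj d.α).counit.app ((push F.f).obj ((Over.pullback F.s).obj x))).left :=
    rfl
  rw [h, mapCompIso_hom_left, mapPullbackAdj_counit_left]
  simp only [Category.assoc]
  congr 4
  exact Category.id_comp _

/-- A diagram acts on base points by `α`. -/
lemma extNatTrans_base (x : Over I) :
    (d.extNatTrans.app x).left ≫ base F x = base G x ≫ d.α := by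
  have h₁ := Over.w ((beckChevalleyProd d.isPullback).hom.app ((Over.pullback F.s).obj x))
  have h₂ := Over.w ((pushCompIso (f := d.w) (g := G.f) rfl).inv.app
      ((Over.pullback d.β).obj ((Over.pullback F.s).obj x)))
  have h₃ := Over.w ((push G.f).map ((push d.w).map
    ((pullbackCompIso (f := d.w) (g := G.s) rfl).inv.app x ≫ (pullbackCompIso d.w_s).hom.app x)))
  have h₄ := Over.w ((push G.f).map
    ((pullbackPushAdj d.w).unit.app ((Over.pullback G.s).obj x)))
  dsimp only [Functor.comp_obj, Functor.id_obj] at h₁ h₂ h₃ h₄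
  rw [extNatTrans_app_left]
  change (_ ≫ _ ≫ _ ≫ _ ≫ _) ≫ ((push F.f).obj ((Over.pullback F.s).obj x)).hom =
    ((push G.f).obj ((Over.pullback G.s).obj x)).hom ≫ d.α
  simp only [Category.assoc]
  rw [pbFst_w, reassoc_of% h₁, reassoc_of% h₂, reassoc_of% h₃, reassoc_of% h₄]

lemma extNatTrans_base_assoc (x : Over I) {Z : E} (g : F.A ⟶ Z) :
    (d.extNatTrans.app x).left ≫ base F x ≫ g = base G x ≫ d.α ≫ g := by
  rw [← Category.assoc, extNatTrans_base, Category.assoc]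

/-- A diagram acts on values by reindexing along `w : M ⟶ D`, where `M` is identified with the
pullback of `f` along `α`. -/
lemma eval_extNatTrans {W : E} (e : W ⟶ ((extFunctor G).obj x).left) (b : W ⟶ F.B)
    (h : (e ≫ (d.extNatTrans.app x).left) ≫ base F x = b ≫ F.f)
    (m : W ⟶ d.mid) (hb : m ≫ d.β = b) (hm : e ≫ base G x = (m ≫ d.w) ≫ G.f) :
    eval F x (e ≫ (d.extNatTrans.app x).left) b h = eval G x e (m ≫ d.w) hm := by
  revert h
  rw [extNatTrans_app_left]
  intro h
  have hbα : b ≫ F.f = (e ≫ base G x) ≫ d.α := by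
    rw [hm, ← hb, Category.assoc, d.isPullback.w]
    simp
  let y := (Over.pullback F.s).obj x
  let e₀ : W ⟶ ((push G.f).obj ((Over.pullback G.s).obj x)).left := e
  let e₁ := e₀ ≫ ((push G.f).map
    ((pullbackPushAdj d.w).unit.app ((Over.pullback G.s).obj x))).left
  let c := (pullbackCompIso (f := d.w) (g := G.s) rfl).inv.app x ≫
      (pullbackCompIso d.w_s).hom.app x
  let e₂ := e₁ ≫ ((push G.f).map ((push d.w).map c)).left
  let e₃ := e₂ ≫ ((pushCompIso (f := d.w) (g := G.f) rfl).inv.app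
    ((Over.pullback d.β).obj y)).left
  have hb₁ : e₁ ≫ ((push G.f).obj _).hom = (m ≫ d.w) ≫ G.f :=
    ((Category.assoc _ _ _).trans (e₀ ≫= Over.w _)).trans hm
  have hb₂ : e₂ ≫ ((push G.f).obj _).hom = (m ≫ d.w) ≫ G.f :=
    ((Category.assoc _ _ _).trans (e₁ ≫= Over.w _)).trans hb₁
  have hb₃ : e₃ ≫ ((push (d.w ≫ G.f)).obj _).hom = (m ≫ d.w) ≫ G.f :=
    ((Category.assoc _ _ _).trans (e₂ ≫= Over.w _)).trans hb₂
  have hb₃' : e₃ ≫ ((push (d.w ≫ G.f)).obj _).hom = m ≫ d.w ≫ G.f :=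
    hb₃.trans (Category.assoc _ _ _)
  have ha : e ≫ ((push G.f).map
      ((pullbackPushAdj d.w).unit.app ((Over.pullback G.s).obj x))).left ≫
      ((push G.f).map ((push d.w).map c)).left ≫
      ((pushCompIso (f := d.w) (g := G.f) rfl).inv.app ((Over.pullback d.β).obj y)).left ≫
      ((beckChevalleyProd d.isPullback).hom.app y).left ≫ pbFst d.α ((push F.f).obj y) =
      e₃ ≫ ((beckChevalleyProd d.isPullback).hom.app y).left ≫ pbFst d.α ((push F.f).obj y) := by
    simp only [e₃, e₂, e₁, Category.assoc]
    rfl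
  have hb₄ : (e₃ ≫ ((beckChevalleyProd d.isPullback).hom.app y).left ≫
      pbFst d.α ((push F.f).obj y)) ≫ ((push F.f).obj y).hom = b ≫ F.f := by
    rw [← ha]
    exact h
  have s₄ := pushApply_beckChevalleyProd d.isPullback y e₃ b
    hb₄ (by rw [hb₃, ← hm, hbα])
  have hl : d.isPullback.lift b (e₃ ≫ ((push (d.w ≫ G.f)).obj _).hom)
      (by rw [hb₃, ← hm, hbα]) = m := by
    apply d.isPullback.hom_ext
    · rw [IsPullback.lift_fst, hb]
    · rw [IsPullback.lift_snd, hb₃']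
  have s₃ : pushApply _ _ e₃ m hb₃' = _ := pushApply_pushCompIso_inv
    (f := d.w) (g := G.f) rfl _ e₂ m hb₃' hb₂ (pushApply_hom _ _ _ _)
  have s₂ : pushApply G.f _ e₂ (m ≫ d.w) hb₂ = _ :=
    pushApply_map ((push d.w).map c) e₁ (m ≫ d.w) hb₂
  have s₁ : pushApply G.f _ e₁ (m ≫ d.w) hb₁ = _ :=
    pushApply_map ((pullbackPushAdj d.w).unit.app ((Over.pullback G.s).obj x)) e₀ (m ≫ d.w) hb₁
  have hm₂ : pushApply G.f _ e₂ (m ≫ d.w) hb₂ ≫ ((push d.w).obj _).hom = m ≫ d.w :=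
    pushApply_hom _ _ _ _
  have hm₁ : pushApply G.f _ e₁ (m ≫ d.w) hb₁ ≫ ((push d.w).obj _).hom = m ≫ d.w :=
    pushApply_hom _ _ _ _
  have s₅ : pushApply d.w _ (pushApply G.f _ e₂ (m ≫ d.w) hb₂) m hm₂ =
      pushApply d.w _ (pushApply G.f _ e₁ (m ≫ d.w) hb₁) m hm₁ ≫ c.left :=
    (pushApply_congr s₂ rfl).trans (pushApply_map c _ m _)
  have s₆ : pushApply d.w _ (pushApply G.f _ e₁ (m ≫ d.w) hb₁) m hm₁ = _ :=
    (pushApply_congr s₁ rfl).trans (pushApply_unit (f := d.w) _ m _)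
  have hc : c.left ≫ pbFst d.β y ≫ pbFst F.s x = pbFst d.w _ ≫ pbFst G.s x := by
    simp only [c, y, Over.comp_left, Category.assoc]
    rw [pullbackCompIso_hom_pbFst, pullbackCompIso_inv_pbFst]
  calc _ = pushApply F.f y _ b hb₄ ≫ pbFst F.s x :=
        congrArg (· ≫ pbFst F.s x) (pushApply_congr ha rfl)
    _ = (pushApply (d.w ≫ G.f) _ e₃ m hb₃' ≫ pbFst d.β y) ≫ pbFst F.s x := by
        rw [s₄, pushApply_congr (h := hb₃') rfl hl.symm]
    _ = pbLift d.w _ (pushApply G.f _ e₀ (m ≫ d.w) hm) m (pushApply_hom _ _ _ _) ≫ c.left ≫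
          pbFst d.β y ≫ pbFst F.s x := by
        rw [s₃, s₅, s₆]; simp only [Category.assoc]; rfl
    _ = eval G x e (m ≫ d.w) hm := by
        rw [hc, pbLift_pbFst_assoc]; rfl

end Diagram

end Extension

end Polynomial

/-! ### Diagrams and strong transformations -/

namespace Polynomial

variable [HasPullbacks E] [LocallyCartesianClosed E] {I J K : E}

section Functoriality

lemma extNatTrans_eq_of_equiv {G F : Polynomial I J} {d d' : Diagram G F} (h : d ≈ d') :
    d.extNatTrans = d'.extNatTrans := by
  obtain ⟨hα, φ, hw, hβ⟩ := h
  ext x : 3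
  refine ext_elem ?_ ?_
  · rw [extNatTrans_base, extNatTrans_base, hα]
  · intro T t b h h'
    have hb : b ≫ F.f = (t ≫ base G x) ≫ d.α := by
      rw [← h, Category.assoc, extNatTrans_base, Category.assoc]
    rw [eval_extNatTrans d t b h (d.isPullback.lift b (t ≫ base G x) hb) (by simp) (by simp),
      eval_extNatTrans d' t b h' (d.isPullback.lift b (t ≫ base G x) hb ≫ φ.hom)
        (by simp [hβ]) (by simp [reassoc_of% hw])]
    exact eval_congr rfl (by simp [hw])

lemma extNatTrans_id (F : Polynomial I J) :
    (Diagram.id F).extNatTrans = 𝟙 (extFunctor F) := by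
  ext x : 3
  refine ext_elem ?_ ?_
  · rw [extNatTrans_base]
    exact (Category.comp_id _).trans (Category.id_comp _).symm
  · intro T t b h h'
    have hb : t ≫ base F x = (b ≫ (Diagram.id F).w) ≫ F.f := by
      have := (Category.assoc t _ _).trans (t ≫= extFunctor_map_base (F := F) (𝟙 x))
      rw [CategoryTheory.Functor.map_id] at this
      rw [← this]
      exact h'.trans (by simp [Diagram.id])
    rw [eval_extNatTrans (Diagram.id F) t b h b (Category.comp_id b) hb]
    exact eval_congr (Category.comp_id _).symm (Category.comp_id _)

lemma extNatTrans_comp {G F H : Polynomial I J} (d : Diagram G F) (d' : Diagram F H) :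
    (d.comp d').extNatTrans = d.extNatTrans ≫ d'.extNatTrans := by
  ext x : 3
  rw [NatTrans.comp_app, Over.comp_left]
  refine ext_elem ?_ ?_
  · rw [extNatTrans_base, Category.assoc, extNatTrans_base, extNatTrans_base_assoc]
    rfl
  · intro T t b h h'
    have hb : b ≫ H.f = (t ≫ base G x) ≫ (d.comp d').α := by
      rw [← h, Category.assoc, extNatTrans_base, Category.assoc]
    let m := (d.comp d').isPullback.lift b (t ≫ base G x) hb
    have hm₁ : m ≫ (d.comp d').β = b := (d.comp d').isPullback.lift_fst _ _ _
    have hm₂ : m ≫ (d.comp d').w ≫ G.f = t ≫ base G x := (d.comp d').isPullback.lift_snd _ _ _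
    have hG : t ≫ base G x = ((m ≫ d.compFst d') ≫ d.w) ≫ G.f := by
      rw [← hm₂, Diagram.comp_w]; simp only [Category.assoc]
    have hF : (t ≫ (d.extNatTrans.app x).left) ≫ base F x =
        ((m ≫ d.compSnd d') ≫ d'.w) ≫ F.f := by
      rw [Category.assoc, extNatTrans_base, reassoc_of% hG]
      have := d.isPullback.w
      simp only [Category.assoc] at this ⊢
      rw [← this, reassoc_of% (d.comp_condition d')]
    have h'' : ((t ≫ (d.extNatTrans.app x).left) ≫ (d'.extNatTrans.app x).left) ≫ base H x =
        b ≫ H.f := by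
      simpa only [Category.assoc] using h'
    rw [eval_extNatTrans (d.comp d') t b h m hm₁ (by rw [Category.assoc, hm₂]),
      eval_congr (h := h') (Category.assoc _ _ _).symm rfl,
      eval_extNatTrans d' _ b h'' (m ≫ d.compSnd d')
        (by rw [← hm₁, Diagram.comp_β, Category.assoc]) hF,
      eval_extNatTrans d t _ hF (m ≫ d.compFst d')
        (by rw [Category.assoc, Category.assoc, Diagram.comp_condition]) hG]
    exact eval_congr rfl (by rw [Diagram.comp_w, Category.assoc])

end Functoriality

section Strength

variable [CartesianMonoidalCategory E]

/-- The underlying map of the strength of an extension. -/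
def strength (F : Polynomial I J) (K : E) (x : Over I) :
    K ⊗ ((extFunctor F).obj x).left ⟶ ((extFunctor F).obj (K ⊙ₗ x)).left :=
  (F.ext.strength.μₗ K x).left

lemma strength_eq (F : Polynomial I J) (K : E) (x : Over I) : strength F K x =
    (Functor.LaxLeftLinear.μₗ (push F.f) K ((Over.pullback F.s).obj x)).left ≫
      ((push F.f).map (Functor.LaxLeftLinear.μₗ (Over.pullback F.s) K x)).left := by
  have : strength F K x =
    (𝟙 _ ≫ (Functor.LaxLeftLinear.μₗ (push F.f) K ((Over.pullback F.s).obj x)).left) ≫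
      ((push F.f).map (Functor.LaxLeftLinear.μₗ (Over.pullback F.s) K x)).left := rfl
  rw [this, Category.id_comp]

lemma strength_base (F : Polynomial I J) (K : E) (x : Over I) :
    strength F K x ≫ base F (K ⊙ₗ x) = snd _ _ ≫ base F x := by
  rw [strength_eq]
  refine (Category.assoc _ _ _).trans ?_
  refine (_ ≫= Over.w ((push F.f).map (Functor.LaxLeftLinear.μₗ (Over.pullback F.s) K x))).trans ?_
  exact pushStrength_left_hom _ _ _

lemma strength_base_assoc (F : Polynomial I J) (K : E) (x : Over I) {Z : E} (g : F.A ⟶ Z) :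
    strength F K x ≫ base F (K ⊙ₗ x) ≫ g = snd _ _ ≫ base F x ≫ g := by
  rw [← Category.assoc, strength_base, Category.assoc]

/-- The strength of `P_F` pairs each value with the parameter. -/
lemma eval_strength {F : Polynomial I J} {K : E} {x : Over I} {W : E}
    (e : W ⟶ K ⊗ ((extFunctor F).obj x).left) (b : W ⟶ F.B)
    (h : (e ≫ strength F K x) ≫ base F (K ⊙ₗ x) = b ≫ F.f)
    (h' : (e ≫ snd _ _) ≫ base F x = b ≫ F.f) :
    eval F (K ⊙ₗ x) (e ≫ strength F K x) b h =
      lift (e ≫ fst _ _) (eval F x (e ≫ snd _ _) b h') := by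
  let y := (Over.pullback F.s).obj x
  let μ := Functor.LaxLeftLinear.μₗ (push F.f) K y
  let ν := Functor.LaxLeftLinear.μₗ (Over.pullback F.s) K x
  have hs : e ≫ strength F K x = (e ≫ μ.left) ≫ ((push F.f).map ν).left := by
    rw [strength_eq]
    exact (Category.assoc _ _ _).symm
  have h₁ : (e ≫ μ.left) ≫ ((push F.f).obj (K ⊙ₗ y)).hom = b ≫ F.f :=
    ((Category.assoc _ _ _).trans (e ≫= pushStrength_left_hom F.f K y)).trans
      ((Category.assoc _ _ _).symm.trans h')
  have h₂ : ((e ≫ μ.left) ≫ ((push F.f).map ν).left) ≫ ((push F.f).obj _).hom = b ≫ F.f :=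
    ((Category.assoc _ _ _).trans (_ ≫= Over.w _)).trans h₁
  calc _ = pushApply F.f _ ((e ≫ μ.left) ≫ ((push F.f).map ν).left) b h₂ ≫ pbFst F.s (K ⊙ₗ x) :=
        congrArg (· ≫ pbFst F.s (K ⊙ₗ x)) (pushApply_congr hs rfl)
    _ = lift (e ≫ fst _ _) (pushApply F.f y (e ≫ snd _ _) b h') ≫ ν.left ≫
          pbFst F.s (K ⊙ₗ x) := by
        rw [pushApply_map ν _ b h₂, Category.assoc]
        congr 1
        exact pushApply_pushStrength F.f K y e b h₁ h'
    _ = _ := by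
        simp only [ν, pullbackStrength_left, pbLift_pbFst]
        exact lift_whiskerLeft _ _ _

lemma extNatTrans_strong {G F : Polynomial I J} (d : Diagram G F) (L : E) (x : Over I) :
    G.ext.strength.μₗ L x ≫ d.extNatTrans.app (L ⊙ₗ x) =
      L ⊴ₗ d.extNatTrans.app x ≫ F.ext.strength.μₗ L x := by
  ext1
  change strength G L x ≫ (d.extNatTrans.app (L ⊙ₗ x)).left =
    L ◁ (d.extNatTrans.app x).left ≫ strength F L x
  refine ext_elem ?_ ?_
  · rw [Category.assoc, Category.assoc, extNatTrans_base, strength_base_assoc, strength_base,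
      whiskerLeft_snd_assoc, extNatTrans_base]
  · intro T t b h h'
    have hb : b ≫ F.f = (t ≫ snd _ _ ≫ base G x) ≫ d.α := by
      rw [← h]; simp only [Category.assoc, extNatTrans_base, strength_base_assoc]
    let m := d.isPullback.lift b (t ≫ snd _ _ ≫ base G x) hb
    have hm₁ : m ≫ d.β = b := d.isPullback.lift_fst _ _ _
    have hm₂ : m ≫ d.w ≫ G.f = t ≫ snd _ _ ≫ base G x := d.isPullback.lift_snd _ _ _
    have k₁ : ((t ≫ strength G L x) ≫ (d.extNatTrans.app (L ⊙ₗ x)).left) ≫ base F _ = b ≫ F.f := by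
      simpa only [Category.assoc] using h
    have k₂ : ((t ≫ L ◁ (d.extNatTrans.app x).left) ≫ strength F L x) ≫ base F _ = b ≫ F.f := by
      simpa only [Category.assoc] using h'
    have k₃ : ((t ≫ snd _ _) ≫ (d.extNatTrans.app x).left) ≫ base F x = b ≫ F.f := by
      rw [hb, Category.assoc, extNatTrans_base]; simp only [Category.assoc]
    rw [eval_congr (h := h) (Category.assoc _ _ _).symm rfl,
      eval_congr (h := h') (Category.assoc _ _ _).symm rfl,
      eval_extNatTrans d _ b k₁ m hm₁ (by
        simp only [Category.assoc, hm₂, strength_base]),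
      eval_strength _ _ _ (by simp only [Category.assoc, hm₂]),
      eval_strength _ b k₂ (by
        simpa only [Category.assoc, whiskerLeft_snd] using k₃)]
    congr 1
    · simp
    · rw [← eval_extNatTrans d (t ≫ snd _ _) b k₃ m hm₁ (by simp only [Category.assoc, hm₂])]
      exact eval_congr (by simp only [Category.assoc, whiskerLeft_snd]) rfl

end Strength

section Generic

/-- The generic element of `P_G (u : D ⟶ I)`, at stage `C`, with value the identity of `D`. -/
def gen (G : Polynomial I J) : G.A ⟶ ((extFunctor G).obj (Over.mk G.s)).left :=
  mkElem (x := Over.mk G.s) (𝟙 _) ((Over.pullback G.f).obj (Over.mk (𝟙 _))).hom rfl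

@[simp] lemma gen_base (G : Polynomial I J) : gen G ≫ base G (Over.mk G.s) = 𝟙 _ :=
  mkElem_base _ _ _

@[simp] lemma gen_base_assoc (G : Polynomial I J) {Z : E} (g : G.A ⟶ Z) :
    gen G ≫ base G (Over.mk G.s) ≫ g = g := by
  rw [← Category.assoc, gen_base, Category.id_comp]

lemma eval_gen {G : Polynomial I J} {W : E} (c : W ⟶ G.A) (b : W ⟶ G.B)
    (h : (c ≫ gen G) ≫ base G _ = b ≫ G.f) : eval G (Over.mk G.s) (c ≫ gen G) b h = b := by
  refine (eval_mkElem _ _ _ c b h (by simpa using h)).trans ?_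
  exact pbLift_hom _ _ _ _ _

/-- A diagram is determined up to equivalence by the image of the generic element. -/
lemma Diagram.equiv_of_gen {G F : Polynomial I J} {d d' : Diagram G F}
    (h : gen G ≫ (d.extNatTrans.app (Over.mk G.s)).left =
      gen G ≫ (d'.extNatTrans.app (Over.mk G.s)).left) : d ≈ d' := by
  have hα : d.α = d'.α := by
    have := congrArg (· ≫ base F _) h
    simpa [extNatTrans_base] using this
  have hsq : d.β ≫ F.f = (d.w ≫ G.f) ≫ d'.α := by rw [← hα, d.isPullback.w]
  let φ := d'.isPullback.lift d.β (d.w ≫ G.f) hsq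
  have hφ₁ : φ ≫ d'.β = d.β := d'.isPullback.lift_fst _ _ _
  have hφ₂ : φ ≫ d'.w ≫ G.f = d.w ≫ G.f := d'.isPullback.lift_snd _ _ _
  refine Diagram.equiv_of d d' hα φ ?_ hφ₁
  have k : (((d.w ≫ G.f) ≫ gen G) ≫ (d.extNatTrans.app (Over.mk G.s)).left) ≫ base F _ =
      d.β ≫ F.f := by
    simp [extNatTrans_base, d.isPullback.w]
  have k' : (((d.w ≫ G.f) ≫ gen G) ≫ (d'.extNatTrans.app (Over.mk G.s)).left) ≫ base F _ =
      d.β ≫ F.f := by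
    simp [extNatTrans_base, hsq]
  have e₁ := eval_extNatTrans d ((d.w ≫ G.f) ≫ gen G) d.β k (𝟙 _) (Category.id_comp _) (by simp)
  have e₂ := eval_extNatTrans d' ((d.w ≫ G.f) ≫ gen G) d.β k' φ hφ₁ (by simp [hφ₂])
  rw [eval_gen, Category.id_comp] at e₁
  rw [eval_gen] at e₂
  rw [← e₁, ← e₂]
  exact eval_congr (by rw [Category.assoc, ← h, ← Category.assoc]) rfl

variable [CartesianMonoidalCategory E]

/-- Strong transformations out of an extension are determined by the image of the generic element.
Every element of `P_G x`, at stage `W`, over `c : W ⟶ C`, is the image of an element of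
`P_G (W ×_C D)`, which the monomorphism `W ×_C D ⟶ W × D` carries to the strength applied to the
pair of `𝟙 W` and the generic element at `c`. It is enough to take the universal element, the
identity of `P_G x`. -/
lemma natTrans_ext_of_gen {G F : Polynomial I J} {θ θ' : extFunctor G ⟶ extFunctor F}
    (hθ : ∀ (L : E) (x : Over I), G.ext.strength.μₗ L x ≫ θ.app (L ⊙ₗ x) =
      L ⊴ₗ θ.app x ≫ F.ext.strength.μₗ L x)
    (hθ' : ∀ (L : E) (x : Over I), G.ext.strength.μₗ L x ≫ θ'.app (L ⊙ₗ x) =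
      L ⊴ₗ θ'.app x ≫ F.ext.strength.μₗ L x)
    (h : gen G ≫ (θ.app (Over.mk G.s)).left = gen G ≫ (θ'.app (Over.mk G.s)).left) :
    θ = θ' := by
  ext x : 3
  let W := ((extFunctor G).obj x).left
  let c : W ⟶ G.A := base G x
  let Q := ((Over.pullback G.f).obj (Over.mk c)).left
  let p : Q ⟶ W := pbFst G.f (Over.mk c)
  let r : Q ⟶ G.B := ((Over.pullback G.f).obj (Over.mk c)).hom
  have hpr : p ≫ base G x = r ≫ G.f := pbFst_w G.f (Over.mk c)
  let z : Over I := Over.mk (r ≫ G.s)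
  let e₀ : W ⟶ ((extFunctor G).obj z).left := mkElem (x := z) c (𝟙 _) (Category.id_comp _)
  have he₀ : e₀ ≫ base G z = c := mkElem_base _ _ _
  let φ : z ⟶ x := Over.homMk (eval G x p r hpr) (eval_hom p r hpr)
  -- the universal element of `P_G x` is the image under `φ` of the tautological element `e₀`
  have hφ : e₀ ≫ ((extFunctor G).map φ).left = 𝟙 W := by
    refine ext_elem ?_ ?_
    · rw [Category.assoc, extFunctor_map_base, he₀]; exact (Category.id_comp _).symm
    · intro T t b k k'
      have kb : t ≫ c = b ≫ G.f := by rw [← k']; simp [c]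
      have k₁ : ((t ≫ e₀) ≫ ((extFunctor G).map φ).left) ≫ base G x = b ≫ G.f := by
        simpa only [Category.assoc] using k
      rw [eval_congr (h := k) (Category.assoc _ _ _).symm rfl,
        eval_map φ (t ≫ e₀) b k₁ (by rw [Category.assoc, he₀, kb])]
      refine (congrArg (· ≫ φ.left) (eval_mkElem (x := z) c (𝟙 _) (Category.id_comp _) t b _
        kb)).trans ?_
      change (_ ≫ 𝟙 _) ≫ eval G x p r hpr = _
      rw [Category.comp_id, comp_eval]
      refine eval_congr ?_ (pbLift_hom _ _ _ _ _)
      exact (pbLift_pbFst _ _ _ _ _).trans (Category.comp_id t).symm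
  -- the inclusion `W ×_C D ⟶ W × D` relates `e₀` to the generic element
  let ι : z ⟶ W ⊙ₗ Over.mk G.s := Over.homMk (lift p r) (by simp [z])
  have hι : e₀ ≫ ((extFunctor G).map ι).left =
      lift (𝟙 W) (c ≫ gen G) ≫ strength G W (Over.mk G.s) := by
    refine ext_elem ?_ ?_
    · rw [Category.assoc, extFunctor_map_base, he₀, Category.assoc, strength_base]
      simp
    · intro T t b k k'
      have k₁ : ((t ≫ e₀) ≫ ((extFunctor G).map ι).left) ≫ base G _ = b ≫ G.f := by
        simpa only [Category.assoc] using k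
      have k₂ : ((t ≫ lift (𝟙 W) (c ≫ gen G)) ≫ strength G W _) ≫ base G _ = b ≫ G.f := by
        simpa only [Category.assoc] using k'
      have kb : t ≫ c = b ≫ G.f := by
        rw [← k₁, Category.assoc, extFunctor_map_base, Category.assoc, he₀]
      rw [eval_congr (h := k) (Category.assoc _ _ _).symm rfl,
        eval_map ι (t ≫ e₀) b k₁ (by rw [Category.assoc, he₀, kb]),
        eval_congr (h := k') (Category.assoc _ _ _).symm rfl,
        eval_strength _ b k₂ (by simp [kb])]
      refine (congrArg (· ≫ ι.left) (eval_mkElem (x := z) c (𝟙 _) (Category.id_comp _) t b _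
        kb)).trans ?_
      change (_ ≫ 𝟙 _) ≫ lift p r = _
      rw [Category.comp_id, comp_lift]
      congr 1
      · exact (pbLift_pbFst _ _ _ _ _).trans (by simp)
      · refine (pbLift_hom _ _ _ _ _).trans ?_
        rw [eval_congr (e' := (t ≫ c) ≫ gen G) (b' := b) (by simp) rfl, eval_gen]
  have key : ∀ (θ : extFunctor G ⟶ extFunctor F)
      (_ : ∀ (L : E) (x : Over I), G.ext.strength.μₗ L x ≫ θ.app (L ⊙ₗ x) =
        L ⊴ₗ θ.app x ≫ F.ext.strength.μₗ L x),
      e₀ ≫ (θ.app z).left ≫ ((extFunctor F).map ι).left =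
        lift (𝟙 W) (c ≫ gen G ≫ (θ.app (Over.mk G.s)).left) ≫ strength F W (Over.mk G.s) := by
    intro θ hθ
    have n := congrArg Over.Hom.left (θ.naturality ι)
    have s := congrArg Over.Hom.left (hθ W (Over.mk G.s))
    replace s : strength G W (Over.mk G.s) ≫ (θ.app (W ⊙ₗ Over.mk G.s)).left =
      W ◁ (θ.app (Over.mk G.s)).left ≫ strength F W (Over.mk G.s) := s
    rw [Over.comp_left, Over.comp_left] at n
    rw [← n, reassoc_of% hι, s]
    simp
  -- `P_F ι` reflects equality of elements, since `ι` is a monomorphism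
  have hz : e₀ ≫ (θ.app z).left = e₀ ≫ (θ'.app z).left := by
    have hk : e₀ ≫ (θ.app z).left ≫ ((extFunctor F).map ι).left =
        e₀ ≫ (θ'.app z).left ≫ ((extFunctor F).map ι).left := by
      rw [key θ hθ, key θ' hθ', h]
    refine ext_elem ?_ ?_
    · have := congrArg (· ≫ base F _) hk
      simpa only [Category.assoc, extFunctor_map_base] using this
    · intro T t b k k'
      have m₁ := eval_map ι (t ≫ e₀ ≫ (θ.app z).left) b
        (by simpa only [Category.assoc, extFunctor_map_base] using k) k
      have m₂ := eval_map ι (t ≫ e₀ ≫ (θ'.app z).left) b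
        (by simpa only [Category.assoc, extFunctor_map_base] using k') k'
      have m : eval F z _ b k ≫ lift p r = eval F z _ b k' ≫ lift p r := by
        refine m₁.symm.trans (Eq.trans ?_ m₂)
        exact eval_congr (by simp only [Category.assoc, hk]) rfl
      have f₁ := congrArg (· ≫ fst _ _) m
      have f₂ := congrArg (· ≫ snd _ _) m
      simp only [Category.assoc, lift_fst, lift_snd] at f₁ f₂
      exact pb_ext G.f f₁ f₂
  have n := congrArg Over.Hom.left (θ.naturality φ)
  have n' := congrArg Over.Hom.left (θ'.naturality φ)
  rw [Over.comp_left, Over.comp_left] at n n'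
  have := congrArg (· ≫ ((extFunctor F).map φ).left) hz
  simp only [Category.assoc] at this
  rw [← n, ← n', reassoc_of% hφ, reassoc_of% hφ] at this
  exact this

/-- Every strong transformation between extensions is induced by a diagram. The naturality of the
strength at the graph `D ⟶ C × D` shows that the values of the image of the generic element lie
over `C`. -/
lemma exists_diagram {G F : Polynomial I J} (θ : extFunctor G ⟶ extFunctor F)
    (hθ : ∀ (L : E) (x : Over I), G.ext.strength.μₗ L x ≫ θ.app (L ⊙ₗ x) =
      L ⊴ₗ θ.app x ≫ F.ext.strength.μₗ L x) :
    ∃ d : Diagram G F, d.extNatTrans = θ := by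
  let u : Over I := Over.mk G.s
  let g₀ := gen G ≫ (θ.app u).left
  let α : G.A ⟶ F.A := g₀ ≫ base F u
  let β : pullback F.f α ⟶ F.B := pullback.fst _ _
  let c : pullback F.f α ⟶ G.A := pullback.snd _ _
  have hβ : (c ≫ g₀) ≫ base F u = β ≫ F.f := by
    rw [Category.assoc]; exact pullback.condition.symm
  let w : pullback F.f α ⟶ G.B := eval F u (c ≫ g₀) β hβ
  let ι : u ⟶ G.A ⊙ₗ u := Over.homMk (lift G.f (𝟙 _)) (by simp [u])
  have hι : gen G ≫ ((extFunctor G).map ι).left =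
      lift (𝟙 _) (gen G) ≫ strength G G.A u := by
    refine ext_elem ?_ ?_
    · rw [Category.assoc, extFunctor_map_base, Category.assoc, strength_base, lift_snd_assoc]
    · intro T t b k k'
      have k₁ : ((t ≫ gen G) ≫ ((extFunctor G).map ι).left) ≫ base G _ = b ≫ G.f := by
        simpa only [Category.assoc] using k
      have k₂ : ((t ≫ lift (𝟙 _) (gen G)) ≫ strength G G.A u) ≫ base G _ = b ≫ G.f := by
        simpa only [Category.assoc] using k'
      have k₃ : (t ≫ gen G) ≫ base G u = b ≫ G.f := by
        rw [← k₁, Category.assoc (t ≫ gen G), extFunctor_map_base]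
      rw [eval_congr (h := k) (Category.assoc _ _ _).symm rfl, eval_map ι _ b k₁ k₃,
        eval_congr (h := k') (Category.assoc _ _ _).symm rfl,
        eval_strength _ b k₂ (by rw [Category.assoc t, lift_snd, k₃]), eval_gen]
      change b ≫ lift G.f (𝟙 _) = _
      rw [comp_lift]
      congr 1
      · rw [← k₃]; simp [u]
      · rw [eval_congr (e' := t ≫ gen G) (b' := b) (by simp) rfl, eval_gen, Category.comp_id]
  -- `w` is a map over `C`: compare the first components of the values in `C × D`
  have hc : w ≫ G.f = c := by
    have n := congrArg Over.Hom.left (θ.naturality ι)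
    have s := congrArg Over.Hom.left (hθ G.A u)
    replace s : strength G G.A u ≫ (θ.app (G.A ⊙ₗ u)).left =
      G.A ◁ (θ.app u).left ≫ strength F G.A u := s
    rw [Over.comp_left, Over.comp_left] at n
    have e : g₀ ≫ ((extFunctor F).map ι).left = lift (𝟙 _) g₀ ≫ strength F G.A u := by
      simp only [g₀, Category.assoc]
      rw [← n, reassoc_of% hι, s]
      simp
    have k₁ : ((c ≫ g₀) ≫ ((extFunctor F).map ι).left) ≫ base F _ = β ≫ F.f := by
      rw [Category.assoc (c ≫ g₀), extFunctor_map_base, hβ]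
    have k₂ : ((c ≫ lift (𝟙 _) g₀) ≫ strength F G.A u) ≫ base F _ = β ≫ F.f := by
      rw [← k₁]; simp only [Category.assoc, reassoc_of% e]
    have m₁ := eval_map ι (c ≫ g₀) β k₁ hβ
    have m₂ := eval_strength _ β k₂ (by simpa using hβ)
    rw [eval_congr (e' := (c ≫ lift (𝟙 _) g₀) ≫ strength F G.A u) (b' := β)
      (by rw [Category.assoc, e, Category.assoc]) rfl, m₂] at m₁
    have := congrArg (· ≫ fst _ _) m₁
    simp [ι] at this
    exact this.symm
  let d : Diagram G F :=
    { mid := pullback F.f α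
      w := w
      β := β
      α := α
      isPullback := by rw [hc]; exact IsPullback.of_hasPullback _ _
      w_s := eval_hom _ _ _
      α_t := by
        have := Over.w (θ.app u)
        rw [extFunctor_obj_hom, extFunctor_obj_hom] at this
        simp only [α, g₀, Category.assoc]
        rw [this, gen_base_assoc] }
  refine ⟨d, natTrans_ext_of_gen (extNatTrans_strong d) hθ ?_⟩
  refine ext_elem ?_ ?_
  · rw [Category.assoc, extNatTrans_base, gen_base_assoc]
  · intro T t b k k'
    have hb : b ≫ F.f = t ≫ α := by
      rw [← k']; simp [α, g₀, u]
    let m : T ⟶ d.mid := pullback.lift b t hb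
    have hm₁ : m ≫ β = b := pullback.lift_fst _ _ _
    have hm₂ : m ≫ c = t := pullback.lift_snd _ _ _
    have k₁ : ((t ≫ gen G) ≫ (d.extNatTrans.app u).left) ≫ base F u = b ≫ F.f := by
      simpa only [Category.assoc] using k
    rw [eval_congr (h := k) (Category.assoc _ _ _).symm rfl,
      eval_extNatTrans d (t ≫ gen G) b k₁ m hm₁ (by
        rw [Category.assoc, gen_base, Category.assoc]
        exact (Category.comp_id t).trans (hm₂.symm.trans (m ≫= hc.symm))), eval_gen]
    change m ≫ eval F u (c ≫ g₀) β hβ = _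
    rw [comp_eval]
    exact eval_congr (by rw [reassoc_of% hm₂]) hm₁

end Generic

end Polynomial

/-! ### The structure transformations on generalized elements -/

section BeckChevalley

variable [HasPullbacks E]

@[simp] lemma beckChevalleySum_hom_pbFst {P X Y Z : E} {h : P ⟶ X} {k : P ⟶ Y} {t : X ⟶ Z}
    {u : Y ⟶ Z} (sq : IsPullback h k t u) (x : Over X) :
    ((beckChevalleySum sq).hom.app x).left ≫ pbFst u ((Over.map t).obj x) = pbFst h x := by
  simp [beckChevalleySum]

end BeckChevalley

namespace Polynomial

variable [HasPullbacks E] [LocallyCartesianClosed E] {I J K : E}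

section Identity

instance (I : E) : IsIso (extId I) := by
  refine @IsIso.comp_isIso _ _ _ _ _ _ _ ?_ (@IsIso.comp_isIso _ _ _ _ _ _ _ ?_ ?_)
  · exact (Functor.isoWhiskerRight Over.pullbackId (push (𝟙 I) ⋙ Over.map (𝟙 I))).isIso_hom
  · infer_instance
  · exact (Over.mapId I).isIso_hom

/-- The transformation `P_id ⟶ 1` evaluates an element at its base point. -/
lemma comp_extId {x : Over I} {W : E} (e : W ⟶ ((extFunctor (id I)).obj x).left) :
    e ≫ ((extId I).app x).left = eval (id I) x e (e ≫ base (id I) x)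
      (Category.comp_id _).symm := by
  have h : ((extId I).app x).left = ((push (𝟙 I)).map (Over.pullbackId.hom.app x)).left ≫
      ((pushIdIso I).hom.app x).left ≫ ((Over.mapId I).hom.app x).left := rfl
  have h' : ((Over.mapId I).hom.app x).left = 𝟙 x.left := by simp
  have hb : ((push (𝟙 I)).map (Over.pullbackId.hom.app x)).left ≫ ((push (𝟙 I)).obj x).hom =
    ((push (𝟙 I)).obj ((Over.pullback (𝟙 I)).obj x)).hom := Over.w _
  let e' : W ⟶ ((push (𝟙 I)).obj ((Over.pullback (𝟙 I)).obj x)).left := e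
  have key : e' ≫ ((push (𝟙 I)).map (Over.pullbackId.hom.app x)).left ≫
      ((pushIdIso I).hom.app x).left =
      pushApply (𝟙 I) _ e' (e' ≫ ((push (𝟙 I)).obj ((Over.pullback (𝟙 I)).obj x)).hom) (by simp) ≫
        pbFst (𝟙 I) x := by
    rw [pushIdIso_hom_left, ← Category.assoc, comp_pushApply,
      pushApply_congr (Category.comp_id _) rfl, pushApply_map, pullbackId_hom_left]
    exact congrArg (· ≫ pbFst (𝟙 I) x) (pushApply_congr rfl (by rw [Category.assoc, hb]))
  refine Eq.trans ?_ key
  rw [h, h']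
  exact congrArg (e' ≫ ·) (congrArg (_ ≫ ·) (Category.comp_id _))

end Identity

section Composition

variable (F : Polynomial I J) (G : Polynomial J K)

lemma extComp_app_left (x : Over I) : ((extComp F G).app x).left =
    ((push (subP F G ≫ distQ (subK F G) G.f)).map
      ((pullbackCompIso (f := subN F G) (g := subM F G ≫ F.s) rfl).hom.app x ≫
        (Over.pullback (subN F G)).map
          ((pullbackCompIso (f := subM F G) (g := F.s) rfl).hom.app x))).left ≫
    ((pushCompIso (f := subP F G) (g := distQ (subK F G) G.f) rfl).hom.app
      ((Over.pullback (subN F G)).obj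
        ((Over.pullback (subM F G)).obj ((Over.pullback F.s).obj x)))).left ≫
    ((push (distQ (subK F G) G.f)).map
      ((beckChevalleyProd (IsPullback.of_hasPullback (subR F G) (distE (subK F G) G.f))).hom.app
        ((Over.pullback (subM F G)).obj ((Over.pullback F.s).obj x)))).left ≫
    ((push (distQ (subK F G) G.f)).map ((Over.pullback (distE (subK F G) G.f)).map
      ((beckChevalleyProd (IsPullback.of_hasPullback F.f (subH F G))).hom.app
        ((Over.pullback F.s).obj x)))).left ≫
    ((distributivity (subK F G) G.f).app ((Over.pullback (subH F G)).obj
      ((push F.f).obj ((Over.pullback F.s).obj x)))).left ≫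
    ((push G.f).map ((beckChevalleySum (IsPullback.of_hasPullback F.t G.s)).hom.app
      ((push F.f).obj ((Over.pullback F.s).obj x)))).left := by
  have h : ((extComp F G).app x).left =
    (((push (subP F G ≫ distQ (subK F G) G.f)).map
      ((pullbackCompIso (f := subN F G) (g := subM F G ≫ F.s) rfl).hom.app x ≫
        (Over.pullback (subN F G)).map
          ((pullbackCompIso (f := subM F G) (g := F.s) rfl).hom.app x))).left ≫
    (((pushCompIso (f := subP F G) (g := distQ (subK F G) G.f) rfl).hom.app
      ((Over.pullback (subN F G)).obj
        ((Over.pullback (subM F G)).obj ((Over.pullback F.s).obj x)))).left ≫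
      ((mapCompIso (f := (distM (subK F G) G.f).hom) (g := G.t) rfl).hom.app
        ((push (distQ (subK F G) G.f)).obj ((push (subP F G)).obj
          ((Over.pullback (subN F G)).obj
            ((Over.pullback (subM F G)).obj ((Over.pullback F.s).obj x)))))).left)) ≫
    ((push (distQ (subK F G) G.f)).map
      ((beckChevalleyProd (IsPullback.of_hasPullback (subR F G) (distE (subK F G) G.f))).hom.app
        ((Over.pullback (subM F G)).obj ((Over.pullback F.s).obj x)))).left ≫
    ((push (distQ (subK F G) G.f)).map ((Over.pullback (distE (subK F G) G.f)).map
      ((beckChevalleyProd (IsPullback.of_hasPullback F.f (subH F G))).hom.app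
        ((Over.pullback F.s).obj x)))).left ≫
    ((distributivity (subK F G) G.f).app ((Over.pullback (subH F G)).obj
      ((push F.f).obj ((Over.pullback F.s).obj x)))).left ≫
    ((push G.f).map ((beckChevalleySum (IsPullback.of_hasPullback F.t G.s)).hom.app
      ((push F.f).obj ((Over.pullback F.s).obj x)))).left := rfl
  rw [h, mapCompIso_hom_left]
  refine (Category.assoc _ _ _).trans (congrArg (_ ≫ ·) ?_)
  refine (Category.assoc _ _ _).trans (congrArg (_ ≫ ·) ?_)
  exact Category.id_comp _

instance : IsIso (extComp F G) := by
  refine @IsIso.comp_isIso _ _ _ _ _ _ _ (@IsIso.comp_isIso _ _ _ _ _ _ _ ?_ ?_)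
    (@IsIso.comp_isIso _ _ _ _ _ _ _ ?_ (@IsIso.comp_isIso _ _ _ _ _ _ _ ?_
      (@IsIso.comp_isIso _ _ _ _ _ _ _ ?_ ?_)))
  · exact (Functor.isoWhiskerRight (pullbackCompIso rfl ≪≫
      Functor.isoWhiskerRight (pullbackCompIso rfl) (Over.pullback (subN F G))) _).isIso_hom
  · infer_instance
  · infer_instance
  · infer_instance
  · infer_instance
  · exact (Functor.isoWhiskerLeft (Over.pullback F.s ⋙ push F.f)
      (Functor.isoWhiskerRight (beckChevalleySum (IsPullback.of_hasPullback F.t G.s))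
        (push G.f ⋙ Over.map G.t))).isIso_hom

variable {F G} {x : Over I}

lemma extComp_base : ((extComp F G).app x).left ≫ base G ((extFunctor F).obj x) =
    base (comp F G) x ≫ (distM (subK F G) G.f).hom := by
  rw [extComp_app_left]
  refine ((Category.assoc _ _ _).trans (_ ≫= ((Category.assoc _ _ _).trans (_ ≫=
    ((Category.assoc _ _ _).trans (_ ≫= ((Category.assoc _ _ _).trans (_ ≫=
      ((Category.assoc _ _ _).trans (_ ≫= Over.w _)))))))))).trans ?_
  refine (_ ≫= _ ≫= _ ≫= _ ≫= distributivity_app_hom _ _ _).trans ?_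
  refine (_ ≫= _ ≫= _ ≫= Over.w_assoc _ _).trans ?_
  refine (_ ≫= _ ≫= Over.w_assoc _ _).trans ?_
  exact (_ ≫= Over.w_assoc _ _).trans (Over.w_assoc _ _)

/-- The canonical transformation `P_{G ∘ F} ⟶ P_G P_F` splits the argument of an element: its
image takes `d` in the fibre of `D` to the element of `P_F x` over `h(ε(d))` that takes `b` to the
value of the original element at `(b, d)`. -/
lemma eval_extComp {W : E} (e : W ⟶ ((extFunctor (comp F G)).obj x).left)
    (δ : W ⟶ ((Over.pullback G.f).obj (distM (subK F G) G.f)).left)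
    (hδ : e ≫ base (comp F G) x = δ ≫ distQ (subK F G) G.f)
    (hd : (e ≫ ((extComp F G).app x).left) ≫ base G ((extFunctor F).obj x) =
      (δ ≫ ((Over.pullback G.f).obj (distM (subK F G) G.f)).hom) ≫ G.f) :
    eval G _ (e ≫ ((extComp F G).app x).left) _ hd ≫ base F x =
        δ ≫ distE (subK F G) G.f ≫ subH F G ∧
      ∀ (n : W ⟶ pullback (subR F G) (distE (subK F G) G.f)) (_ : n ≫ subP F G = δ) (hb)
        (hn : e ≫ base (comp F G) x = n ≫ subP F G ≫ distQ (subK F G) G.f),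
        eval F x (eval G _ (e ≫ ((extComp F G).app x).left) _ hd) (n ≫ subN F G ≫ subM F G) hb =
          eval (comp F G) x e n hn := by
  let k := subK F G
  let q := distQ k G.f
  let ε := distE k G.f
  let y := (Over.pullback F.s).obj x
  let z := (push F.f).obj y
  let y₃ := (Over.pullback (subM F G)).obj y
  let y₄ := (Over.pullback (subN F G)).obj y₃
  let sq₁ := IsPullback.of_hasPullback F.t G.s
  let sq₃ : IsPullback (subM F G) (subR F G) F.f (subH F G) := IsPullback.of_hasPullback _ _
  let sq₄ : IsPullback (subN F G) (subP F G) (subR F G) ε := IsPullback.of_hasPullback _ _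
  let c := (pullbackCompIso (f := subN F G) (g := subM F G ≫ F.s) rfl).hom.app x ≫
    (Over.pullback (subN F G)).map ((pullbackCompIso (f := subM F G) (g := F.s) rfl).hom.app x)
  let bc₄ := (beckChevalleyProd sq₄).hom.app y₃
  let bc₃ := (beckChevalleyProd sq₃).hom.app y
  let bc₁ := (beckChevalleySum sq₁).hom.app z
  let pc := (pushCompIso (f := subP F G) (g := q) rfl).hom.app y₄
  let e₀ : W ⟶ ((push (subP F G ≫ q)).obj
    ((Over.pullback (subN F G ≫ subM F G ≫ F.s)).obj x)).left := e
  let e₁ := (e₀ ≫ ((push (subP F G ≫ q)).map c).left) ≫ pc.left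
  let e₂ := e₁ ≫ ((push q).map bc₄).left
  let e₃ := e₂ ≫ ((push q).map ((Over.pullback ε).map bc₃)).left
  let e₄ := e₃ ≫ ((distributivity k G.f).app ((Over.pullback (subH F G)).obj z)).left
  let e₅ := e₄ ≫ ((push G.f).map bc₁).left
  have he : e ≫ ((extComp F G).app x).left = e₅ := by
    rw [extComp_app_left]
    iterate 5 refine (Category.assoc _ _ _).symm.trans ?_
    rfl
  have hδ₁ : e₁ ≫ ((push q).obj _).hom = δ ≫ q :=
    ((Category.assoc _ _ _).trans (_ ≫= Over.w _)).trans
      (((Category.assoc _ _ _).trans (_ ≫= Over.w _)).trans hδ)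
  have hδ₂ : e₂ ≫ ((push q).obj _).hom = δ ≫ q :=
    ((Category.assoc _ _ _).trans (_ ≫= Over.w _)).trans hδ₁
  have hδ₃ : e₃ ≫ ((push q).obj _).hom = δ ≫ q :=
    ((Category.assoc _ _ _).trans (_ ≫= Over.w _)).trans hδ₂
  let d := δ ≫ ((Over.pullback G.f).obj (distM k G.f)).hom
  have hd₅ : e₅ ≫ ((push G.f).obj _).hom = d ≫ G.f := by rw [← he]; exact hd
  have hd₄ : e₄ ≫ ((push G.f).obj _).hom = d ≫ G.f :=
    ((Category.assoc _ _ _).trans (_ ≫= Over.w _)).symm.trans hd₅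
  have hd₃ : (e₃ ≫ ((push q).obj _).hom) ≫ (distM k G.f).hom = d ≫ G.f := by
    rw [hδ₃, Category.assoc, (dist_isPullback k G.f).w, Category.assoc]
  have hδd : pbLift G.f (distM k G.f) (e₃ ≫ ((push q).obj _).hom) d hd₃ = δ := by
    apply pb_ext
    · rw [pbLift_pbFst, hδ₃]; rfl
    · rw [pbLift_hom]
  -- the value at `d` in `D`, by distributivity; the factors before it change the value only by
  -- reindexing, and the last one is the identity on the `P_F x` component
  have hv : eval G _ (e ≫ ((extComp F G).app x).left) _ hd =
      pushApply q _ e₁ δ hδ₁ ≫ bc₄.left ≫ pbFst ε ((push (subR F G)).obj y₃) ≫ bc₃.left ≫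
        pbFst (subH F G) z := by
    calc _ = pushApply G.f ((Over.pullback G.s).obj ((Over.map F.t).obj z)) e₅ d hd₅ ≫
          pbFst G.s ((Over.map F.t).obj z) :=
          congrArg (· ≫ pbFst G.s ((Over.map F.t).obj z)) (pushApply_congr he rfl)
      _ = pushApply G.f _ e₄ d hd₄ ≫ bc₁.left ≫ pbFst G.s ((Over.map F.t).obj z) :=
          (congrArg (· ≫ pbFst G.s ((Over.map F.t).obj z))
            (pushApply_map bc₁ e₄ d hd₅)).trans (Category.assoc _ _ _)
      _ = pushApply G.f _ e₄ d hd₄ ≫ pbFst (subH F G) z :=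
          congrArg (_ ≫ ·) (beckChevalleySum_hom_pbFst sq₁ z)
      _ = (pushApply q _ e₃ δ hδ₃ ≫ pbFst ε _) ≫ pbFst (subH F G) z :=
          congrArg (· ≫ pbFst (subH F G) z)
            ((pushApply_distributivity k G.f ((Over.pullback (subH F G)).obj z) e₃ d hd₄
              hd₃).trans (congrArg (· ≫ _) (pushApply_congr rfl hδd)))
      _ = ((pushApply q _ e₂ δ hδ₂ ≫ ((Over.pullback ε).map bc₃).left) ≫ pbFst ε _) ≫
            pbFst (subH F G) z :=
          congrArg (fun a => (a ≫ pbFst ε _) ≫ pbFst (subH F G) z)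
            (pushApply_map ((Over.pullback ε).map bc₃) e₂ δ hδ₃)
      _ = ((pushApply q _ e₂ δ hδ₂ ≫ pbFst ε _) ≫ bc₃.left) ≫ pbFst (subH F G) z := by
          rw [Category.assoc (pushApply q _ e₂ δ hδ₂), pullback_map_pbFst, ← Category.assoc]
          rfl
      _ = (((pushApply q _ e₁ δ hδ₁ ≫ bc₄.left) ≫ pbFst ε _) ≫ bc₃.left) ≫
            pbFst (subH F G) z :=
          congrArg (fun a => ((a ≫ pbFst ε _) ≫ bc₃.left) ≫ pbFst (subH F G) z)
            (pushApply_map bc₄ e₁ δ hδ₂)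
      _ = _ := by simp only [Category.assoc]
  let e' := pushApply q _ e₁ δ hδ₁
  have he' : e' ≫ ((push (subP F G)).obj y₄).hom = δ := pushApply_hom _ _ _ _
  let u := e' ≫ bc₄.left ≫ pbFst ε ((push (subR F G)).obj y₃)
  have hu : u ≫ ((push (subR F G)).obj y₃).hom = δ ≫ ε := by
    have : bc₄.left ≫ ((Over.pullback ε).obj ((push (subR F G)).obj y₃)).hom =
      ((push (subP F G)).obj y₄).hom := Over.w bc₄
    simp only [u, Category.assoc]
    rw [pbFst_w, reassoc_of% this, reassoc_of% he']
  have hv' : eval G _ (e ≫ ((extComp F G).app x).left) _ hd =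
      u ≫ bc₃.left ≫ pbFst (subH F G) z := by
    rw [hv]; simp only [u, e', Category.assoc]; rfl
  have hvb : (u ≫ bc₃.left ≫ pbFst (subH F G) z) ≫ z.hom = (δ ≫ ε) ≫ subH F G := by
    have : bc₃.left ≫ ((Over.pullback (subH F G)).obj z).hom =
      ((push (subR F G)).obj y₃).hom := Over.w bc₃
    simp only [Category.assoc]
    rw [pbFst_w, reassoc_of% this, reassoc_of% hu]
  refine ⟨?_, ?_⟩
  · rw [hv']
    exact hvb.trans (Category.assoc _ _ _)
  · intro n hnp hb hn
    -- the value at `n = (b, d)`: currying along `Π_{qp} ≅ Π_q Π_p`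
    have hn' : n ≫ subN F G ≫ subR F G = δ ≫ ε :=
      (n ≫= pullback.condition).trans ((Category.assoc _ _ _).symm.trans (congrArg (· ≫ ε) hnp))
    let b := n ≫ subN F G ≫ subM F G
    have hvb' : (u ≫ bc₃.left ≫ pbFst (subH F G) z) ≫ z.hom = b ≫ F.f :=
      (congrArg (· ≫ z.hom) hv').symm.trans hb
    have hbu : b ≫ F.f = (u ≫ ((push (subR F G)).obj y₃).hom) ≫ subH F G := by
      rw [hu, ← hvb, hvb']
    have hl₃ : sq₃.lift b (u ≫ ((push (subR F G)).obj y₃).hom) hbu = n ≫ subN F G := by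
      apply sq₃.hom_ext
      · rw [IsPullback.lift_fst, Category.assoc]
      · rw [IsPullback.lift_snd, hu, Category.assoc, hn']
    have hub : u ≫ ((push (subR F G)).obj y₃).hom = (n ≫ subN F G) ≫ subR F G := by
      rw [hu, Category.assoc, hn']
    have hl₄ : sq₄.lift (n ≫ subN F G) (e' ≫ ((push (subP F G)).obj y₄).hom)
        (by rw [he', Category.assoc, hn']) = n := by
      apply sq₄.hom_ext
      · rw [IsPullback.lift_fst]
      · rw [IsPullback.lift_snd, he', hnp]
    have hn₀ : e₀ ≫ ((push (subP F G ≫ q)).obj _).hom = n ≫ subP F G ≫ q := hn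
    have hn₁ : (e₀ ≫ ((push (subP F G ≫ q)).map c).left) ≫ ((push (subP F G ≫ q)).obj _).hom =
        n ≫ subP F G ≫ q := ((Category.assoc _ _ _).trans (_ ≫= Over.w _)).trans hn₀
    have hc : c.left ≫ pbFst (subN F G) y₃ ≫ pbFst (subM F G) y ≫ pbFst F.s x =
        pbFst (subN F G ≫ subM F G ≫ F.s) x := by
      simp only [c, Over.comp_left, Category.assoc]
      refine (_ ≫= pullback_map_pbFst_assoc (subN F G) _ _).trans ?_
      refine (_ ≫= _ ≫= pullbackCompIso_hom_pbFst rfl x).trans ?_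
      exact pullbackCompIso_hom_pbFst rfl x
    have hδn : e₁ ≫ ((push q).obj ((push (subP F G)).obj y₄)).hom = (n ≫ subP F G) ≫ q := by
      rw [hnp, hδ₁]
    have hen : e' = pushApply q ((push (subP F G)).obj y₄) e₁ (n ≫ subP F G) hδn :=
      pushApply_congr rfl hnp.symm
    calc _ = pushApply F.f y (u ≫ bc₃.left ≫ pbFst (subH F G) z) b hvb' ≫ pbFst F.s x :=
          congrArg (· ≫ pbFst F.s x) (pushApply_congr hv' rfl)
      _ = (pushApply (subR F G) y₃ u (n ≫ subN F G) hub ≫ pbFst (subM F G) y) ≫ pbFst F.s x :=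
          congrArg (· ≫ pbFst F.s x) ((pushApply_beckChevalleyProd sq₃ y u b hvb' hbu).trans
            (congrArg (· ≫ _) (pushApply_congr rfl hl₃)))
      _ = ((pushApply (subP F G) y₄ e' n (by rw [he', hnp]) ≫ pbFst (subN F G) y₃) ≫
            pbFst (subM F G) y) ≫ pbFst F.s x :=
          congrArg (fun a => (a ≫ pbFst (subM F G) y) ≫ pbFst F.s x)
            ((pushApply_beckChevalleyProd sq₄ y₃ e' (n ≫ subN F G) hub
              (by rw [he', Category.assoc, hn'])).trans
              (congrArg (· ≫ _) (pushApply_congr rfl hl₄)))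
      _ = ((pushApply (subP F G ≫ q) y₄ (e₀ ≫ ((push (subP F G ≫ q)).map c).left) n hn₁ ≫
            pbFst (subN F G) y₃) ≫ pbFst (subM F G) y) ≫ pbFst F.s x :=
          congrArg (fun a => ((a ≫ pbFst (subN F G) y₃) ≫ pbFst (subM F G) y) ≫ pbFst F.s x)
            ((pushApply_congr hen rfl).trans (pushApply_pushCompIso_hom rfl y₄ _ n hδn
              (pushApply_hom _ _ _ _) hn₁))
      _ = (((pushApply (subP F G ≫ q) _ e₀ n hn₀ ≫ c.left) ≫
            pbFst (subN F G) y₃) ≫ pbFst (subM F G) y) ≫ pbFst F.s x :=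
          congrArg (fun a => ((a ≫ pbFst (subN F G) y₃) ≫ pbFst (subM F G) y) ≫ pbFst F.s x)
            (pushApply_map c e₀ n hn₁)
      _ = pushApply (subP F G ≫ q) _ e₀ n hn₀ ≫ pbFst (subN F G ≫ subM F G ≫ F.s) x := by
          rw [← hc]; simp only [Category.assoc]
      _ = _ := rfl

/-- An element of `P_G P_F x` is determined by its base point, the base points of its values, and
the values of its values. -/
lemma ext_elem_comp {W : E} {e e' : W ⟶ ((extFunctor G).obj ((extFunctor F).obj x)).left}
    (hb : e ≫ base G _ = e' ≫ base G _)
    (hd : ∀ {T : E} (t : T ⟶ W) (d : T ⟶ G.B) (h : (t ≫ e) ≫ base G _ = d ≫ G.f)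
      (h' : (t ≫ e') ≫ base G _ = d ≫ G.f),
      eval G _ (t ≫ e) d h ≫ base F x = eval G _ (t ≫ e') d h' ≫ base F x)
    (he : ∀ {T : E} (t : T ⟶ W) (d : T ⟶ G.B) (h : (t ≫ e) ≫ base G _ = d ≫ G.f)
      (h' : (t ≫ e') ≫ base G _ = d ≫ G.f) (b : T ⟶ F.B)
      (k : eval G _ (t ≫ e) d h ≫ base F x = b ≫ F.f)
      (k' : eval G _ (t ≫ e') d h' ≫ base F x = b ≫ F.f),
      eval F x (eval G _ (t ≫ e) d h) b k = eval F x (eval G _ (t ≫ e') d h') b k') :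
    e = e' := by
  refine ext_elem hb fun {T} t d h h' => ext_elem (hd t d h h') ?_
  intro T' t' b k k'
  have m : t' ≫ eval G _ (t ≫ e) d h = eval G _ ((t' ≫ t) ≫ e) (t' ≫ d)
      (by simp only [Category.assoc] at h ⊢; rw [h]) :=
    (comp_eval _ _ _ _).trans (eval_congr (Category.assoc _ _ _).symm rfl)
  have m' : t' ≫ eval G _ (t ≫ e') d h' = eval G _ ((t' ≫ t) ≫ e') (t' ≫ d)
      (by simp only [Category.assoc] at h' ⊢; rw [h']) :=
    (comp_eval _ _ _ _).trans (eval_congr (Category.assoc _ _ _).symm rfl)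
  rw [eval_congr (h := k) m rfl, eval_congr (h := k') m' rfl]
  exact he _ _ _ _ _ _ _

end Composition

end Polynomial

/-! ### The structure transformations are strong -/

namespace Polynomial

variable [HasPullbacks E] [LocallyCartesianClosed E] [CartesianMonoidalCategory E] {I J K : E}

lemma extId_strong (L : E) (x : Over I) :
    (id I).ext.strength.μₗ L x ≫ (extId I).app (L ⊙ₗ x) =
      L ⊴ₗ (extId I).app x ≫ (StrongFunctor.id I).strength.μₗ L x := by
  ext1
  change strength (id I) L x ≫ ((extId I).app (L ⊙ₗ x)).left = L ◁ ((extId I).app x).left ≫ 𝟙 _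
  refine (comp_extId _).trans ((eval_congr (e' := 𝟙 _ ≫ strength (id I) L x)
    (b' := snd _ _ ≫ base (id I) x) (Category.id_comp _).symm (strength_base _ _ _)).trans ?_)
  refine (eval_strength _ _ _ ((congrArg (· ≫ base (id I) x) (Category.id_comp _)).trans
    (Category.comp_id _).symm)).trans ?_
  refine Eq.trans ?_ (Category.comp_id _).symm
  apply CartesianMonoidalCategory.hom_ext
  · refine (lift_fst _ _).trans ((Category.id_comp _).trans ?_)
    exact (whiskerLeft_fst _ _).symm
  · refine (lift_snd _ _).trans (Eq.trans ?_ (whiskerLeft_snd _ _).symm)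
    refine Eq.trans ?_ (comp_extId _).symm
    exact eval_congr (Category.id_comp _) rfl

section Composition

variable {F : Polynomial I J} {G : Polynomial J K} {x : Over I}

/-- On an element with parameter `l`, both composites have the values `(l, -)`, where `-` stands
for the values of the curried element. -/
lemma extComp_strong (L : E) (x : Over I) :
    (comp F G).ext.strength.μₗ L x ≫ (extComp F G).app (L ⊙ₗ x) =
      L ⊴ₗ (extComp F G).app x ≫ (F.ext.comp G.ext).strength.μₗ L x := by
  let σ : L ⊙ₗ (extFunctor F).obj x ⟶ (extFunctor F).obj (L ⊙ₗ x) := F.ext.strength.μₗ L x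
  let ξ : ((extFunctor (comp F G)).obj x).left ⟶
    ((extFunctor G).obj ((extFunctor F).obj x)).left := ((extComp F G).app x).left
  let ξ' : ((extFunctor (comp F G)).obj (L ⊙ₗ x)).left ⟶
    ((extFunctor G).obj ((extFunctor F).obj (L ⊙ₗ x))).left := ((extComp F G).app (L ⊙ₗ x)).left
  let a : ((extFunctor (comp F G)).obj x).left ⟶ (distM (subK F G) G.f).left := base (comp F G) x
  have hξ : ξ ≫ base G _ = a ≫ (distM (subK F G) G.f).hom := extComp_base
  ext1
  change strength (comp F G) L x ≫ ξ' =
    L ◁ ξ ≫ strength G L ((extFunctor F).obj x) ≫ ((extFunctor G).map σ).left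
  have hb : (L ◁ ξ ≫ strength G L ((extFunctor F).obj x) ≫ ((extFunctor G).map σ).left) ≫
      base G _ = snd _ _ ≫ a ≫ (distM (subK F G) G.f).hom := by
    simp only [Category.assoc]
    rw [extFunctor_map_base, strength_base, whiskerLeft_snd_assoc, hξ]
  have hb' : (strength (comp F G) L x ≫ ξ') ≫ base G _ =
      snd _ _ ≫ a ≫ (distM (subK F G) G.f).hom :=
    (Category.assoc _ _ _).trans ((_ ≫= extComp_base).trans (strength_base_assoc (comp F G) L x _))
  -- the right-hand side pairs the parameter with the value of the element
  have hr : ∀ {T : E} (t : T ⟶ L ⊗ ((extFunctor (comp F G)).obj x).left) (d : T ⟶ G.B)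
      (h' : (t ≫ L ◁ ξ ≫ strength G L ((extFunctor F).obj x) ≫ ((extFunctor G).map σ).left) ≫
        base G _ = d ≫ G.f) (h : ((t ≫ snd _ _) ≫ ξ) ≫ base G _ = d ≫ G.f),
      eval G _ (t ≫ L ◁ ξ ≫ strength G L ((extFunctor F).obj x) ≫ ((extFunctor G).map σ).left)
        d h' = lift (t ≫ fst _ _) (eval G _ ((t ≫ snd _ _) ≫ ξ) d h) ≫ strength F L x := by
    intro T t d h' h
    have k₁ : (((t ≫ L ◁ ξ) ≫ strength G L _) ≫ ((extFunctor G).map σ).left) ≫ base G _ =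
        d ≫ G.f := by
      simpa only [Category.assoc] using h'
    have k₂ : ((t ≫ L ◁ ξ) ≫ snd _ _) ≫ base G _ = d ≫ G.f := by
      simpa only [Category.assoc, whiskerLeft_snd] using h
    have k₃ : ((t ≫ L ◁ ξ) ≫ strength G L _) ≫ base G _ = d ≫ G.f := by
      rw [Category.assoc, strength_base, ← Category.assoc, k₂]
    rw [eval_congr (h := h') (e' := ((t ≫ L ◁ ξ) ≫ strength G L _) ≫ ((extFunctor G).map σ).left)
      (b' := d) (by simp only [Category.assoc]) rfl, eval_map σ _ d k₁ k₃,
      eval_strength (t ≫ L ◁ ξ) d k₃ k₂]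
    refine congrArg₂ (fun a b => lift a b ≫ strength F L x) ?_ (eval_congr ?_ rfl)
    · rw [Category.assoc, whiskerLeft_fst]
    · rw [Category.assoc, whiskerLeft_snd, Category.assoc]
  -- both sides have the same values, by the description of `extComp` on elements
  have key : ∀ {T : E} (t : T ⟶ L ⊗ ((extFunctor (comp F G)).obj x).left) (d : T ⟶ G.B)
      (h : (t ≫ strength (comp F G) L x ≫ ξ') ≫ base G _ =
        d ≫ G.f) (h' : ((t ≫ snd _ _) ≫ ξ) ≫ base G _ = d ≫ G.f),
      eval G _ (t ≫ strength (comp F G) L x ≫ ξ') d h ≫ base F _ =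
          eval G _ ((t ≫ snd _ _) ≫ ξ) d h' ≫ base F _ ∧
        ∀ b k k', eval F _ (eval G _ (t ≫ strength (comp F G) L x ≫
            ξ') d h) b k =
          lift (t ≫ fst _ _) (eval F _ (eval G _ ((t ≫ snd _ _) ≫ ξ) d h') b k') := by
    intro T t d h h'
    have ha : (t ≫ snd _ _ ≫ a) ≫ (distM (subK F G) G.f).hom = d ≫ G.f := by
      rw [← h']; simp only [Category.assoc, hξ]
    let δ := pbLift G.f (distM (subK F G) G.f) (t ≫ snd _ _ ≫ a) d ha
    have hδ : δ ≫ ((Over.pullback G.f).obj (distM (subK F G) G.f)).hom = d := pbLift_hom _ _ _ _ _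
    have hδ' : δ ≫ distQ (subK F G) G.f = t ≫ snd _ _ ≫ a := pbLift_pbFst _ _ _ _ _
    clear_value δ
    subst hδ
    have e₁ : (t ≫ strength (comp F G) L x) ≫ base (comp F G) _ = δ ≫ distQ (subK F G) G.f :=
      (Category.assoc _ _ _).trans ((_ ≫= strength_base _ _ _).trans hδ'.symm)
    have h₁ : ((t ≫ strength (comp F G) L x) ≫ ξ') ≫ base G _ =
        (δ ≫ ((Over.pullback G.f).obj (distM (subK F G) G.f)).hom) ≫ G.f := by
      simpa only [Category.assoc] using h
    have e₂ : (t ≫ snd _ _) ≫ base (comp F G) x = δ ≫ distQ (subK F G) G.f :=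
      (Category.assoc _ _ _).trans hδ'.symm
    obtain ⟨p, q⟩ := eval_extComp (t ≫ strength (comp F G) L x) δ e₁ h₁
    obtain ⟨p', q'⟩ := eval_extComp (t ≫ snd _ _) δ e₂ h'
    have r : eval G _ (t ≫ strength (comp F G) L x ≫ ξ') _ h = _ :=
      eval_congr (Category.assoc _ _ _).symm rfl
    refine ⟨by rw [r, p, p'], fun b k k' => ?_⟩
    have hbδ : b ≫ F.f = (δ ≫ distE (subK F G) G.f) ≫ subH F G := by
      rw [← k', p', Category.assoc]
    let n : T ⟶ pullback (subR F G) (distE (subK F G) G.f) :=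
      pullback.lift (pullback.lift b (δ ≫ distE (subK F G) G.f) hbδ) δ (pullback.lift_snd _ _ _)
    have hn : n ≫ subP F G = δ := pullback.lift_snd _ _ _
    have hn' : n ≫ subN F G ≫ subM F G = b :=
      (pullback.lift_fst_assoc _ _ _ _).trans (pullback.lift_fst _ _ _)
    clear_value n
    subst hn'
    have e₃ : (t ≫ strength (comp F G) L x) ≫ base (comp F G) _ =
        n ≫ subP F G ≫ distQ (subK F G) G.f :=
      e₁.trans ((congrArg (· ≫ distQ (subK F G) G.f) hn.symm).trans (Category.assoc _ _ _))
    have e₄ : (t ≫ snd _ _) ≫ base (comp F G) x = n ≫ subP F G ≫ distQ (subK F G) G.f :=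
      e₂.trans ((congrArg (· ≫ distQ (subK F G) G.f) hn.symm).trans (Category.assoc _ _ _))
    rw [eval_congr (h := k) r rfl, q n hn _ e₃, q' n hn _ e₄]
    exact eval_strength t n e₃ e₄
  have hd : ∀ {T : E} (t : T ⟶ L ⊗ ((extFunctor (comp F G)).obj x).left) (d : T ⟶ G.B)
      (_ : (t ≫ L ◁ ξ ≫ strength G L ((extFunctor F).obj x) ≫ ((extFunctor G).map σ).left) ≫
        base G _ = d ≫ G.f), ((t ≫ snd _ _) ≫ ξ) ≫ base G _ = d ≫ G.f := by
    intro T t d h'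
    have h₀ : ((t ≫ snd _ _) ≫ ξ) ≫ base G _ = t ≫ snd _ _ ≫ a ≫ (distM (subK F G) G.f).hom := by
      simp only [Category.assoc, hξ]
    exact h₀.trans ((t ≫= hb.symm).trans ((Category.assoc _ _ _).symm.trans h'))
  refine ext_elem_comp (hb'.trans hb.symm) ?_ ?_
  · intro T t d h h'
    have h'' : ((t ≫ snd _ _) ≫ ξ) ≫ base G _ = d ≫ G.f := hd t d h'
    rw [(key t d h h'').1, hr t d h' h'']
    refine Eq.trans ?_ (Category.assoc _ _ _).symm
    rw [strength_base, lift_snd_assoc]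
  · intro T t d h h' b k k'
    have h'' : ((t ≫ snd _ _) ≫ ξ) ≫ base G _ = d ≫ G.f := hd t d h'
    have k₁ : eval G _ ((t ≫ snd _ _) ≫ ξ) d h'' ≫ base F _ = b ≫ F.f := by
      rw [← (key t d h h'').1, k]
    have k₂ : (lift (t ≫ fst _ _) (eval G _ ((t ≫ snd _ _) ≫ ξ) d h'') ≫ strength F L x) ≫
        base F _ = b ≫ F.f := by
      rw [Category.assoc, strength_base, lift_snd_assoc, k₁]
    rw [(key t d h h'').2 b k k₁, eval_congr (h := k') (hr t d h' h'') rfl,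
      eval_strength _ b k₂ (by rw [lift_snd, k₁]), lift_fst]
    exact congrArg _ (eval_congr (lift_snd _ _).symm rfl)

end Composition

end Polynomial

/-! ### The extension pseudofunctor -/

section Extension

variable [HasPullbacks E] [LocallyCartesianClosed E] [CartesianMonoidalCategory E]

namespace Polynomial

variable {I J K : E}

/-- The strong transformation induced by a class of diagrams. -/
def extMap {G F : Polynomial I J} (η : G ⟶ F) : G.ext ⟶ F.ext :=
  Quotient.lift (s := Diagram.setoid G F)
    (fun d => (⟨d.extNatTrans, extNatTrans_strong d⟩ : StrongFunctor.Hom G.ext F.ext))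
    (fun _ _ h => StrongFunctor.Hom.ext (extNatTrans_eq_of_equiv h)) η

lemma extMap_id (F : Polynomial I J) : extMap (𝟙 F) = 𝟙 F.ext :=
  StrongFunctor.hom_ext (extNatTrans_id F)

lemma extMap_comp {G F H : Polynomial I J} (η : G ⟶ F) (θ : F ⟶ H) :
    extMap (η ≫ θ) = extMap η ≫ extMap θ := by
  induction η using Quotient.inductionOn
  induction θ using Quotient.inductionOn
  exact StrongFunctor.hom_ext (extNatTrans_comp _ _)

lemma extMap_injective {G F : Polynomial I J} {η θ : G ⟶ F} (h : extMap η = extMap θ) :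
    η = θ := by
  induction η using Quotient.inductionOn with | _ d
  induction θ using Quotient.inductionOn with | _ d'
  have h' : d.extNatTrans = d'.extNatTrans := congrArg StrongFunctor.Hom.natTrans h
  exact Quotient.sound (Diagram.equiv_of_gen (by rw [h']))

lemma extMap_surjective {G F : Polynomial I J} (φ : G.ext ⟶ F.ext) :
    ∃ η : G ⟶ F, extMap η = φ := by
  obtain ⟨d, hd⟩ := exists_diagram φ.natTrans φ.strong
  exact ⟨d.toHom, StrongFunctor.hom_ext hd⟩

/-- The extension of the identity polynomial is the identity, as a strong functor. -/
def extIdIso (I : E) : (id I).ext ≅ StrongFunctor.id I :=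
  StrongFunctor.isoMk (asIso (extId I) : extFunctor (id I) ≅ 𝟭 _) extId_strong

/-- The extension of a substitution is the composite of the extensions, as a strong functor. -/
def extCompIso (F : Polynomial I J) (G : Polynomial J K) :
    (comp F G).ext ≅ F.ext.comp G.ext :=
  StrongFunctor.isoMk
    (asIso (extComp F G) : extFunctor (comp F G) ≅ extFunctor F ⋙ extFunctor G) extComp_strong

end Polynomial

lemma StrongFunctor.isPolynomial_id (I : Slice E) : StrongFunctor.IsPolynomial (𝟙 I) :=
  ⟨Polynomial.id I.base, ⟨Polynomial.extIdIso I.base⟩⟩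

lemma StrongFunctor.isPolynomial_comp {I J K : Slice E} (F : I ⟶ J) (G : J ⟶ K)
    (hF : StrongFunctor.IsPolynomial F) (hG : StrongFunctor.IsPolynomial G) :
    StrongFunctor.IsPolynomial (F ≫ G) := by
  obtain ⟨P, ⟨e⟩⟩ := hF
  obtain ⟨Q, ⟨e'⟩⟩ := hG
  let e₁ : (show I ⟶ J from P.ext) ≅ F := e
  let e₂ : (show J ⟶ K from Q.ext) ≅ G := e'
  exact ⟨Polynomial.comp P Q, ⟨Polynomial.extCompIso P Q ≪≫
    Bicategory.whiskerRightIso e₁ (show J ⟶ K from Q.ext) ≪≫ Bicategory.whiskerLeftIso F e₂⟩⟩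

/-- The extension of polynomials and diagrams, as data for transporting the 2-category of
polynomial functors to polynomials. -/
def extTransportData : TransportData (extPrefunctor (E := E)
    StrongFunctor.isPolynomial_id StrongFunctor.isPolynomial_comp) where
  map₂ η := ObjectProperty.homMk (Polynomial.extMap η)
  map₂_id F := ObjectProperty.hom_ext _ (Polynomial.extMap_id F)
  map₂_comp η θ := ObjectProperty.hom_ext _ (Polynomial.extMap_comp η θ)
  map₂_injective h := Polynomial.extMap_injective (congrArg (·.hom) h)
  map₂_surjective φ := by
    obtain ⟨η, hη⟩ := Polynomial.extMap_surjective φ.hom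
    exact ⟨η, ObjectProperty.hom_ext _ hη⟩
  mapId I := ObjectProperty.isoMk _ (Polynomial.extIdIso I.base)
  mapComp F G := ObjectProperty.isoMk _ (Polynomial.extCompIso F G)

end Extension

end

end PolyLCC

theorem mainTheorem3 {E : Type u} [Category.{v} E]
    [CartesianMonoidalCategory E] [HasPullbacks E]
    [PolyLCC.LocallyCartesianClosed E] :
    ∃ (hid : ∀ I : PolyLCC.Slice E, PolyLCC.StrongFunctor.IsPolynomial (𝟙 I))
      (hcomp : ∀ {I J K : PolyLCC.Slice E} (F : I ⟶ J) (G : J ⟶ K),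
        PolyLCC.StrongFunctor.IsPolynomial F → PolyLCC.StrongFunctor.IsPolynomial G →
          PolyLCC.StrongFunctor.IsPolynomial (F ≫ G))
      (S : PolyLCC.BicategoryCompletion (PolyLCC.Poly E)),
      letI := S.toBicategory
      ∃ Ext : PolyLCC.PseudofunctorCompletion (PolyLCC.extPrefunctor hid hcomp),
        (∀ {I J : PolyLCC.Poly E} {G F : I ⟶ J} (d : PolyLCC.Polynomial.Diagram G F),
          (Ext.map₂ d.toHom).hom.natTrans = d.extNatTrans) ∧
        (∀ I : PolyLCC.Poly E,
          (Ext.mapId I).hom.hom.natTrans = PolyLCC.Polynomial.extId I.base) ∧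
        (∀ {I J K : PolyLCC.Poly E} (F : I ⟶ J) (G : J ⟶ K),
          (Ext.mapComp F G).hom.hom.natTrans = PolyLCC.Polynomial.extComp F G) ∧
        (∀ I J : PolyLCC.Poly E, (Ext.toPseudofunctor.mapFunctor I J).IsEquivalence) ∧
        PolyLCC.IsBiequivalence Ext.toPseudofunctor := by
  let T := PolyLCC.extTransportData (E := E)
  let _ := T.bicategoryCompletion.toBicategory
  have hE : ∀ I J : PolyLCC.Poly E,
      (T.pseudofunctorCompletion.toPseudofunctor.mapFunctor I J).IsEquivalence := fun I J =>
    { faithful := ⟨fun h => T.map₂_injective h⟩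
      full := ⟨fun φ => T.map₂_surjective φ⟩
      essSurj := ⟨fun H => by
        obtain ⟨P, ⟨e⟩⟩ := H.property
        exact ⟨P, ⟨ObjectProperty.isoMk _ e⟩⟩⟩ }
  exact ⟨PolyLCC.StrongFunctor.isPolynomial_id, PolyLCC.StrongFunctor.isPolynomial_comp,
    T.bicategoryCompletion, T.pseudofunctorCompletion, fun _ => rfl, fun _ => rfl, fun _ _ => rfl,
    hE, fun c => ⟨⟨c.obj.base⟩, ⟨Bicategory.Equivalence.id c⟩⟩, hE⟩
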